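/- Let $n\ge 2$, $m_1,\dots,m_n>0$ and $g\in\mathbb R\setminus\{0\}$. For $1\le i<j\le n$ let $\tau_{(ij)}:H^1(\mathbb R^n)\to L^2(\mathbb R^{n-1})$ be the trace on the hyperplane $x_i=x_j$, i.e. the continuous extension of the restriction map $\varphi\mapsto \varphi|_{x_i=x_j=R}$ on smooth rapidly decreasing functions, where $\mathbb R^{n-1}$ carries the coordinates $R$ and $x_k$ ($k\ne i,j$) and Lebesgue measure. Let $(H,\mathcal D_H)$ be the operator on $L^2(\mathbb R^n)$ associated with the form $$t(\varphi,\psi)=\sum_{j=1}^n\frac1{2m_j}\int_{\mathbb R^n}\overline{\partial_j\varphi}\,\partial_j\psi-g\sum_{1\le i<j\le n}\int_{\mathbb R^{n-1}}\overline{\tau_{(ij)}\varphi}\;\tau_{(ij)}\psi,\qquad \varphi,\psi\in H^1(\mathbb R^n),$$ that is, $\psi\in\mathcal D_H$ and $H\psi=\eta$ if and only if $\psi\in H^1(\mathbb R^n)$, $\eta\in L^2(\mathbb R^n)$ and $t(\chi,\psi)=\langle\chi,\eta\rangle$ for all $\chi\in H^1(\mathbb R^n)$ (formally $H=-\sum_i\frac1{2m_i}\partial_i^2-g\sum_{i<j}\delta(x_i-x_j)$).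 Let $\pi_S[\mathcal R(\mathbb R^{2n},\sigma)]$ be the image of the resolvent algebra in the Schrödinger representation, i.e. the C*-subalgebra of $\mathcal B(L^2(\mathbb R^n))$ generated by the resolvents $(i\mu-\phi(a,b))^{-1}$, $\mu\in\mathbb R\setminus\{0\}$, $a,b\in\mathbb R^n$, of the self-adjoint field operators $\phi(a,b)=\overline{\sum_k(a_kx_k-ib_k\partial_k)}$ (closure from the Schwartz functions). Let $\mathfrak K_0$ be the C*-algebra generated by the compact operators on $L^2(\mathbb R^n)$ and the identity, $f_0(H)$ the C*-algebra generated by the resolvents $R_H(z)=(H-z)^{-1}$, $z\in i\mathbb R\setminus\{0\}$, and $\mathfrak S_0$ the C*-algebra generated by $f_0(H)$ and $\mathfrak K_0$. Then $H$ is self-adjoint (so that the resolvents $R_H(z)$, $z\in i\mathbb R\setminus\{0\}$, and the strongly continuous unitary group $t\mapsto e^{itH}$ with generator $iH$ exist), $f_0(H)$ is commutative, $\mathfrak S_0$ is a C*-subalgebra of $\pi_S[\mathcal R(\mathbb R^{2n},\sigma)]$, and $$e^{itH}\,a\,e^{-itH}\in\mathfrak S_0\qquad\text{for all } a\in\mathfrak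 S_0,\ t\in\mathbb R.$$ -/

import Mathlib

open MeasureTheory Filter Topology
open scoped SchwartzMap LineDeriv

noncomputable section

namespace DeltaGas

/-- `L²(ℝ^ι)` with Lebesgue measure, for a finite index set `ι`. -/
abbrev L2 (ι : Type) [Fintype ι] : Type :=
  Lp ℂ 2 (volume : Measure (EuclideanSpace ℝ ι))

/-- `B(L²(ℝⁿ))`, the C*-algebra of bounded operators on `L²(ℝⁿ)`. -/
abbrev Bdd (n : ℕ) : Type := L2 (Fin n) →L[ℂ] L2 (Fin n)

/-! ### Unbounded operators: resolvents and one-parameter unitary groups -/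

section Operators

variable {E : Type*} [NormedAddCommGroup E] [InnerProductSpace ℂ E]

/-- The bounded operator `R` is the resolvent `(T - z)⁻¹` of `T` at `z`:
`R φ = ψ` exactly if `ψ ∈ dom T` and `(T - z) ψ = φ`. -/
def IsResolvent (T : E →ₗ.[ℂ] E) (z : ℂ) (R : E →L[ℂ] E) : Prop :=
  ∀ φ ψ : E, R φ = ψ ↔ (ψ, φ + z • ψ) ∈ T.graph

/-- A resolvent at a given point is unique. -/
theorem IsResolvent.unique {T : E →ₗ.[ℂ] E} {z : ℂ} {R S : E →L[ℂ] E}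
    (hR : IsResolvent T z R) (hS : IsResolvent T z S) : R = S := by
  ext φ
  exact ((hS φ (R φ)).2 ((hR φ (R φ)).1 rfl)).symm

open scoped Classical in
/-- The resolvent `R_T(z) = (T - z)⁻¹` (and `0` if `z` is not in the resolvent set of `T`). -/
def resolventOp (T : E →ₗ.[ℂ] E) (z : ℂ) : E →L[ℂ] E :=
  if h : ∃ R : E →L[ℂ] E, IsResolvent T z R then h.choose else 0

/-- `resolventOp T z` is the resolvent wherever there is one. -/
theorem IsResolvent.resolventOp_eq {T : E →ₗ.[ℂ] E} {z : ℂ} {R : E →L[ℂ] E}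
    (hR : IsResolvent T z R) : resolventOp T z = R := by
  have h : ∃ R : E →L[ℂ] E, IsResolvent T z R := ⟨R, hR⟩
  rw [resolventOp, dif_pos h]
  exact h.choose_spec.unique hR

variable [CompleteSpace E]

/-- `U` is the strongly continuous one-parameter unitary group `t ↦ exp(i t T)`: its
infinitesimal generator is `i T`, domains included. -/
structure IsUnitaryGroup (T : E →ₗ.[ℂ] E) (U : ℝ → E →L[ℂ] E) : Prop where
  map_zero : U 0 = 1
  map_add : ∀ s t : ℝ, U (s + t) = U s * U t
  star_eq : ∀ t : ℝ, star (U t) = U (-t)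
  continuous_apply : ∀ ψ : E, Continuous fun t => U t ψ
  hasDerivAt_zero_iff : ∀ ψ φ : E,
    HasDerivAt (fun t : ℝ => U t ψ) (Complex.I • φ) 0 ↔ (ψ, φ) ∈ T.graph

/-- The unitary group generated by a densely defined operator is unique. -/
theorem IsUnitaryGroup.unique {T : E →ₗ.[ℂ] E} (hT : Dense (T.domain : Set E))
    {U V : ℝ → E →L[ℂ] E} (hU : IsUnitaryGroup T U) (hV : IsUnitaryGroup T V) : U = V := by
  have inner_group : ∀ {W : ℝ → E →L[ℂ] E}, IsUnitaryGroup T W → ∀ (t : ℝ) (x y : E),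
      inner ℂ (W t x) (W t y) = inner ℂ x y := by
    intro W hW t x y
    rw [← ContinuousLinearMap.adjoint_inner_right, ← ContinuousLinearMap.star_eq_adjoint,
      hW.star_eq, ← mul_apply_eq_comp, ← hW.map_add, neg_add_cancel, hW.map_zero,
      one_apply_eq_self]
  -- the group leaves the domain invariant and solves the evolution equation
  have deriv_group : ∀ {W : ℝ → E →L[ℂ] E}, IsUnitaryGroup T W → ∀ (t : ℝ) (x x' : E),
      (x, x') ∈ T.graph → HasDerivAt (fun s : ℝ => W s x) (Complex.I • W t x') t ∧
        (W t x, W t x') ∈ T.graph := by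
    intro W hW t x x' hx
    have h0 := (hW.hasDerivAt_zero_iff x x').2 hx
    have h1 : HasDerivAt (fun s : ℝ => W t (W s x)) (W t (Complex.I • x')) 0 :=
      ((W t).restrictScalars ℝ).hasFDerivAt.comp_hasDerivAt (0 : ℝ) h0
    rw [_root_.map_smul] at h1
    constructor
    · have h2 : HasDerivAt (fun s : ℝ => W t (W (s - t) x)) (Complex.I • W t x') t := by
        have h1' : HasDerivAt (fun s : ℝ => W t (W s x)) (Complex.I • W t x') (t - t) := by
          rwa [sub_self]
        exact HasDerivAt.comp_sub_const (f := fun s : ℝ => W t (W s x)) t t h1'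
      refine h2.congr_of_eventuallyEq (Eventually.of_forall fun s => ?_)
      change W s x = W t (W (s - t) x)
      rw [← mul_apply_eq_comp, ← hW.map_add, add_sub_cancel]
    · rw [← hW.hasDerivAt_zero_iff]
      refine h1.congr_of_eventuallyEq (Eventually.of_forall fun s => ?_)
      change W s (W t x) = W t (W s x)
      rw [← mul_apply_eq_comp, ← mul_apply_eq_comp, ← hW.map_add,
        ← hW.map_add, add_comm]
  have skew : ∀ x x' y y' : E, (x, x') ∈ T.graph → (y, y') ∈ T.graph →
      inner ℂ x (Complex.I • y') + inner ℂ (Complex.I • x') y = (0 : ℂ) := by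
    intro x x' y y' hx hy
    have h := ((hU.hasDerivAt_zero_iff x x').2 hx).inner ℂ ((hU.hasDerivAt_zero_iff y y').2 hy)
    have h' : HasDerivAt (fun t : ℝ => inner ℂ (U t x) (U t y)) (0 : ℂ) 0 := by
      have : (fun t : ℝ => inner ℂ (U t x) (U t y)) = fun _ : ℝ => (inner ℂ x y : ℂ) :=
        funext fun t => inner_group hU t x y
      rw [this]
      exact hasDerivAt_const _ _
    have h'' := h.unique h'
    rwa [hU.map_zero, one_apply_eq_self, one_apply_eq_self] at h''
  have key : ∀ (t : ℝ), ∀ x ∈ T.domain, ∀ y ∈ T.domain,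
      inner ℂ (V t x) (U t y) = (inner ℂ x y : ℂ) := by
    intro t x hx y hy
    have hx' := T.mem_graph ⟨x, hx⟩
    have hy' := T.mem_graph ⟨y, hy⟩
    have hd : ∀ s : ℝ, HasDerivAt (fun s : ℝ => inner ℂ (V s x) (U s y)) (0 : ℂ) s := by
      intro s
      obtain ⟨h1, h2⟩ := deriv_group hV s _ _ hx'
      obtain ⟨h3, h4⟩ := deriv_group hU s _ _ hy'
      have h := h1.inner ℂ h3
      rwa [skew _ _ _ _ h2 h4] at h
    have := is_const_of_deriv_eq_zero (fun s => (hd s).differentiableAt) (fun s => (hd s).deriv) t 0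
    simpa [hU.map_zero, hV.map_zero] using this
  funext t
  have key2 : ∀ x y : E, inner ℂ (V t x) (U t y) = (inner ℂ x y : ℂ) := by
    intro x y
    have hy : ∀ z ∈ T.domain, inner ℂ (V t z) (U t y) = (inner ℂ z y : ℂ) := by
      intro z hz
      refine hT.induction (P := fun y => inner ℂ (V t z) (U t y) = (inner ℂ z y : ℂ))
        (fun y hy => key t z hz y hy) (isClosed_eq (by fun_prop) (by fun_prop)) y
    refine hT.induction (P := fun x => inner ℂ (V t x) (U t y) = (inner ℂ x y : ℂ))
      hy (isClosed_eq (by fun_prop) (by fun_prop)) x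
  ext y
  refine ext_inner_left ℂ fun z => ?_
  have hz : V t (V (-t) z) = z := by
    rw [← mul_apply_eq_comp, ← hV.map_add, add_neg_cancel, hV.map_zero,
      one_apply_eq_self]
  rw [← hz, key2, inner_group hV]

open scoped Classical in
/-- `expI T t = exp(i t T)` for a self-adjoint operator `T` (and `1` if `i T` does not generate a
strongly continuous unitary group). -/
def expI (T : E →ₗ.[ℂ] E) (t : ℝ) : E →L[ℂ] E :=
  if h : ∃ U : ℝ → E →L[ℂ] E, IsUnitaryGroup T U then h.choose t else 1

/-- `expI T` is the unitary group generated by `i T` whenever there is one. -/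
theorem IsUnitaryGroup.expI_eq {T : E →ₗ.[ℂ] E} (hT : Dense (T.domain : Set E))
    {U : ℝ → E →L[ℂ] E} (hU : IsUnitaryGroup T U) : expI T = U := by
  have h : ∃ U : ℝ → E →L[ℂ] E, IsUnitaryGroup T U := ⟨U, hU⟩
  funext t
  rw [expI, dif_pos h, h.choose_spec.unique hT hU]

end Operators

/-! ### C*-subalgebras of `B(L²(ℝⁿ))` -/

/-- The C*-subalgebra generated by a set: the norm closure of the generated `*`-subalgebra
(which need not contain the identity). -/
def cstarGenerated {n : ℕ} (S : Set (Bdd n)) : NonUnitalStarSubalgebra ℂ (Bdd n) :=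
  (NonUnitalStarAlgebra.adjoin ℂ S).topologicalClosure

/-! ### The resolvent algebra of `(ℝ²ⁿ, σ)` in the Schrödinger representation -/

/-- The field operator `∑ₖ (aₖ qₖ + bₖ pₖ)` on Schwartz functions, where `qₖ` is multiplication by
the coordinate `xₖ` and `pₖ = -i ∂ₖ`. -/
def fieldSchwartz {n : ℕ} (a b : Fin n → ℝ) :
    𝓢(EuclideanSpace ℝ (Fin n), ℂ) →ₗ[ℂ] 𝓢(EuclideanSpace ℝ (Fin n), ℂ) :=
  ∑ k : Fin n,
    ((a k : ℂ) • (SchwartzMap.smulLeftCLM ℂ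
        (fun x : EuclideanSpace ℝ (Fin n) => ((x k : ℝ) : ℂ))).toLinearMap +
      (b k : ℂ) • (-Complex.I) • (LineDeriv.lineDerivOpCLM ℂ
        𝓢(EuclideanSpace ℝ (Fin n), ℂ) (EuclideanSpace.single k (1 : ℝ))).toLinearMap)

/-- The graph of the field operator on Schwartz functions, inside `L² × L²`. -/
def fieldGraph {n : ℕ} (a b : Fin n → ℝ) : Submodule ℂ (L2 (Fin n) × L2 (Fin n)) :=
  LinearMap.range
    ((SchwartzMap.toLpCLM ℂ ℂ 2 volume).toLinearMap.prod
      ((SchwartzMap.toLpCLM ℂ ℂ 2 volume).toLinearMap ∘ₗ fieldSchwartz a b))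

/-- The self-adjoint field operator `φ(a, b)` on `L²(ℝⁿ)`: the closure of `∑ₖ (aₖ qₖ + bₖ pₖ)`,
which is essentially self-adjoint on the Schwartz space. -/
def fieldOp {n : ℕ} (a b : Fin n → ℝ) : L2 (Fin n) →ₗ.[ℂ] L2 (Fin n) :=
  (fieldGraph a b).toLinearPMap.closure

/-- `π_S(R(μ, f)) = (i μ - φ(f))⁻¹`, for `μ ∈ ℝ∖{0}` and `f = (a, b) ∈ ℝ²ⁿ`. -/
def fieldResolvent {n : ℕ} (μ : ℝ) (a b : Fin n → ℝ) : Bdd n :=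
  -resolventOp (fieldOp a b) (Complex.I * μ)

/-- `π_S[𝓡(ℝ²ⁿ, σ)]`: the image of the resolvent algebra in the Schrödinger representation. As
`𝓡(ℝ²ⁿ, σ)` is the C*-algebra generated by the `R(μ, f)`, its image is the C*-subalgebra of
`B(L²(ℝⁿ))` generated by the operators `π_S(R(μ, f))`. -/
def resolventAlgebra (n : ℕ) : NonUnitalStarSubalgebra ℂ (Bdd n) :=
  cstarGenerated {A | ∃ (μ : ℝ) (a b : Fin n → ℝ), μ ≠ 0 ∧ A = fieldResolvent μ a b}

/-! ### The Sobolev space `H¹(ℝⁿ)` and the trace operators -/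

/-- `H¹(ℝⁿ)`: an element is an `L²` function `u.1` together with its distributional partial
derivatives `∂ⱼ u.1 = u.2 j ∈ L²`. The topology (of the product of `L²` spaces) is that of the
`H¹` norm. -/
def sobolevH1 (n : ℕ) : Submodule ℂ (L2 (Fin n) × (Fin n → L2 (Fin n))) where
  carrier := {u | ∀ j : Fin n,
    ∂_{(EuclideanSpace.single j (1 : ℝ) : EuclideanSpace ℝ (Fin n))}
      (Lp.toTemperedDistributionCLM ℂ volume 2 u.1) =
        Lp.toTemperedDistributionCLM ℂ volume 2 (u.2 j)}
  add_mem' := fun {u v} hu hv j => by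
    simp only [Set.mem_ofPred_eq] at hu hv
    simp only [Prod.fst_add, Prod.snd_add, Pi.add_apply, _root_.map_add,
      LineDeriv.lineDerivOp_add, hu j, hv j]
  zero_mem' := fun j => by
    simp only [Prod.fst_zero, Prod.snd_zero, Pi.zero_apply, _root_.map_zero]
    exact (LineDeriv.lineDerivOpCLM ℂ 𝓢'(EuclideanSpace ℝ (Fin n), ℂ)
      (EuclideanSpace.single j (1 : ℝ) : EuclideanSpace ℝ (Fin n))).map_zero
  smul_mem' := fun c u hu j => by
    simp only [Set.mem_ofPred_eq] at hu
    simp only [Prod.smul_fst, Prod.smul_snd, Pi.smul_apply, _root_.map_smul,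
      LineDeriv.lineDerivOp_smul, hu j]

/-- The inclusion of the Schwartz functions into `H¹(ℝⁿ)`. -/
def schwartzToH1 (n : ℕ) : 𝓢(EuclideanSpace ℝ (Fin n), ℂ) →ₗ[ℂ] sobolevH1 n :=
  LinearMap.codRestrict (sobolevH1 n)
    ((SchwartzMap.toLpCLM ℂ ℂ 2 volume).toLinearMap.prod
      (LinearMap.pi fun j => (SchwartzMap.toLpCLM ℂ ℂ 2 volume).toLinearMap ∘ₗ
        (LineDeriv.lineDerivOpCLM ℂ 𝓢(EuclideanSpace ℝ (Fin n), ℂ)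
          (EuclideanSpace.single j (1 : ℝ))).toLinearMap))
    (fun f j => by
      simp [Lp.toTemperedDistribution_toLp_eq,
        TemperedDistribution.lineDerivOp_toTemperedDistributionCLM_eq])

/-- The interacting pairs `σ = (i, j)`, `i < j`. -/
abbrev Pair (n : ℕ) : Type := {σ : Fin n × Fin n // σ.1 < σ.2}

/-- The parametrization of the hyperplane `xᵢ = xⱼ` by `ℝⁿ⁻¹`, whose coordinates are the common
value `R = xᵢ = xⱼ` (placed at index `i`) and `xₖ`, `k ≠ i, j`. This is
`(R, y) ↦ f_(ij)⁻¹(0, R, y)` for the change of variables to the relative coordinate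
`r = xᵢ - xⱼ` and the centre of mass `R = (mᵢ xᵢ + mⱼ xⱼ) / (mᵢ + mⱼ)`. -/
def hyperplane {n : ℕ} (σ : Pair n) :
    EuclideanSpace ℝ {k : Fin n // k ≠ σ.1.2} →L[ℝ] EuclideanSpace ℝ (Fin n) :=
  LinearMap.toContinuousLinearMap
    { toFun := fun y => WithLp.toLp 2 fun k =>
        if h : k ≠ σ.1.2 then y ⟨k, h⟩ else y ⟨σ.1.1, σ.2.ne⟩
      map_add' := fun x y => by
        ext k
        by_cases h : k = σ.1.2 <;> simp [h]
      map_smul' := fun c y => by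
        ext k
        by_cases h : k = σ.1.2 <;> simp [h] }

theorem hyperplane_apply {n : ℕ} (σ : Pair n) (y : EuclideanSpace ℝ {k : Fin n // k ≠ σ.1.2})
    (k : Fin n) :
    hyperplane σ y k = if h : k ≠ σ.1.2 then y ⟨k, h⟩ else y ⟨σ.1.1, σ.2.ne⟩ := rfl

theorem hyperplane_antilipschitz {n : ℕ} (σ : Pair n) : AntilipschitzWith 1 (hyperplane σ) := by
  refine AddMonoidHomClass.antilipschitz_of_bound _ fun y => ?_
  rw [NNReal.coe_one, one_mul, EuclideanSpace.norm_eq, EuclideanSpace.norm_eq]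
  apply Real.sqrt_le_sqrt
  calc ∑ k : {k : Fin n // k ≠ σ.1.2}, ‖y k‖ ^ 2
      = ∑ k : {k : Fin n // k ≠ σ.1.2}, ‖hyperplane σ y k.1‖ ^ 2 := by
        refine Finset.sum_congr rfl fun k _ => ?_
        rw [hyperplane_apply, dif_pos k.2]
    _ = ∑ k ∈ Finset.univ.map (Function.Embedding.subtype fun k : Fin n => k ≠ σ.1.2),
          ‖hyperplane σ y k‖ ^ 2 := by
        rw [Finset.sum_map]
        rfl
    _ ≤ ∑ k : Fin n, ‖hyperplane σ y k‖ ^ 2 :=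
        Finset.sum_le_univ_sum_of_nonneg fun k => sq_nonneg _

/-- The restriction `φ ↦ φ|_{xᵢ = xⱼ}` of Schwartz functions, as an `L²(ℝⁿ⁻¹)` function. -/
def restrictHyperplane {n : ℕ} (σ : Pair n) :
    𝓢(EuclideanSpace ℝ (Fin n), ℂ) →ₗ[ℂ] L2 {k : Fin n // k ≠ σ.1.2} :=
  (SchwartzMap.toLpCLM ℂ ℂ 2 volume).toLinearMap ∘ₗ
    (SchwartzMap.compCLMOfAntilipschitz ℂ (hyperplane σ).hasTemperateGrowth
      (hyperplane_antilipschitz σ)).toLinearMap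

/-- The trace operator `τ_(ij) : H¹(ℝⁿ) → L²(ℝⁿ⁻¹)`: the extension by continuity of the
restriction to the hyperplane `xᵢ = xⱼ`. -/
def trace {n : ℕ} (σ : Pair n) : sobolevH1 n →L[ℂ] L2 {k : Fin n // k ≠ σ.1.2} :=
  (restrictHyperplane σ).extendOfNorm (schwartzToH1 n)

/-! ### The Hamiltonian -/

/-- The form `t(φ, ψ) = ∑ⱼ (2 mⱼ)⁻¹ ∫ conj(∂ⱼφ) ∂ⱼψ - g ∑_{i<j} ∫ conj(τ_(ij) φ) τ_(ij) ψ` on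
`H¹(ℝⁿ)`. -/
def energyForm {n : ℕ} (m : Fin n → ℝ) (g : ℝ) (φ ψ : sobolevH1 n) : ℂ :=
  ∑ j : Fin n, (((2 * m j)⁻¹ : ℝ) : ℂ) * inner ℂ (φ.1.2 j) (ψ.1.2 j) -
    (g : ℂ) * ∑ σ : Pair n, inner ℂ (trace σ φ) (trace σ ψ)

/-- The graph of the operator associated with the form `t`: the pairs `(ψ, η)` with `ψ ∈ H¹(ℝⁿ)`
and `t(χ, ψ) = ⟨χ, η⟩` for all `χ ∈ H¹(ℝⁿ)`. -/
def hamiltonianGraph {n : ℕ} (m : Fin n → ℝ) (g : ℝ) :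
    Submodule ℂ (L2 (Fin n) × L2 (Fin n)) where
  carrier := {p | ∃ u : sobolevH1 n, u.1.1 = p.1 ∧
    ∀ v : sobolevH1 n, energyForm m g v u = inner ℂ v.1.1 p.2}
  add_mem' := by
    rintro p q ⟨u, hu, hu'⟩ ⟨w, hw, hw'⟩
    refine ⟨u + w, by simp [hu, hw], fun v => ?_⟩
    rw [Prod.snd_add, inner_add_right, ← hu' v, ← hw' v]
    simp only [energyForm, Submodule.coe_add, Prod.snd_add, Pi.add_apply, _root_.map_add,
      inner_add_right, mul_add, Finset.sum_add_distrib]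
    ring
  zero_mem' := ⟨0, by simp, fun v => by simp [energyForm]⟩
  smul_mem' := by
    rintro c p ⟨u, hu, hu'⟩
    refine ⟨c • u, by simp [hu], fun v => ?_⟩
    rw [Prod.smul_snd, inner_smul_right, ← hu' v]
    simp only [energyForm, Submodule.coe_smul, Prod.smul_snd, Pi.smul_apply, _root_.map_smul,
      inner_smul_right, Finset.mul_sum, mul_sub]
    congr 1 <;> refine Finset.sum_congr rfl fun _ _ => by ring

/-- The Hamiltonian `H = -∑ᵢ (2 mᵢ)⁻¹ ∂ᵢ² - g ∑_{i<j} δ(xᵢ - xⱼ)`: the self-adjoint operator on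
`L²(ℝⁿ)` associated with the form `t`. -/
def hamiltonian {n : ℕ} (m : Fin n → ℝ) (g : ℝ) : L2 (Fin n) →ₗ.[ℂ] L2 (Fin n) :=
  (hamiltonianGraph m g).toLinearPMap

/-! ### The algebras `𝔎₀`, `f₀(H)` and `𝔖₀` -/

/-- `𝔎₀`: the C*-algebra generated by the compact operators and the identity. -/
def algK (n : ℕ) : NonUnitalStarSubalgebra ℂ (Bdd n) :=
  cstarGenerated ({K : Bdd n | IsCompactOperator K} ∪ {1})

/-- `f₀(H)`: the C*-algebra generated by the resolvents `R_H(z)`, `z ∈ iℝ∖{0}`. -/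
def algF {n : ℕ} (m : Fin n → ℝ) (g : ℝ) : NonUnitalStarSubalgebra ℂ (Bdd n) :=
  cstarGenerated {A | ∃ s : ℝ, s ≠ 0 ∧ A = resolventOp (hamiltonian m g) (Complex.I * s)}

/-- `𝔖₀`: the C*-algebra generated by `f₀(H)` and `𝔎₀`. -/
def algS {n : ℕ} (m : Fin n → ℝ) (g : ℝ) : NonUnitalStarSubalgebra ℂ (Bdd n) :=
  cstarGenerated ((algF m g : Set (Bdd n)) ∪ (algK n : Set (Bdd n)))

end DeltaGas

end

/-! Put A = (H₀ + λ)^(-1/2), a Fourier multiplier carrying L² onto H¹ (`toH1_surjective`), and let W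
be g times the sum over all pairs of A τ* τ A. In the sense of forms, H + λ = A⁻¹ (1 - W) A⁻¹. The
one-dimensional Sobolev inequality on lines transversal to a collision plane bounds the trace with
an arbitrarily small share of the derivative, so ‖W‖ < 1 once λ is large
(`exists_norm_interactionOp_lt_one`). Then B = A (1 - W)⁻¹ A is bounded, self-adjoint and injective,
and the equation B (η + λψ) = ψ describes the graph of H (`mem_hamiltonian_graph_iff`). All operator
theory of H is read off from B: self-adjointness, the resolvents (1 - (λ + z) B)⁻¹ B, and the
unitary group, which is recovered from the continuous function b exp(it(b⁻¹ - λ)) of B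
(`isUnitaryGroup_groupOp`).

For membership in the resolvent algebra, Stone–Weierstrass shows that it contains all functions of
position, and all functions of momentum, that vanish at infinity (`mem_of_tendsto_zero`); in
particular it contains A. It contains the compact operators because f(Q) G(P) h(Q)* tends in norm to
a rank-one operator as G concentrates at momentum zero (`rankOne_schwartz_mem`). The contact
interaction alone is no operator on L², but A τ* τ A is the norm limit of A P_ε A, where P_ε is the
Poisson kernel of the relative coordinate, a combination of two field resolvents (`contactOp_mem`).
Inverses stay in the algebra by spectral permanence, hence so do B and the resolvents of H.

The remaining claims are soft. The resolvents of H are built from B alone, so a double centralizer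
argument makes f₀(H) commutative. The unitary group commutes with these resolvents, and conjugation
by it preserves the compact operators and the identity, so it maps generators of 𝔖₀ into 𝔖₀. -/

noncomputable section

namespace DeltaGas

open scoped FourierTransform BoundedContinuousFunction ContDiff

/-! ### Multiplication operators and Fourier multipliers -/

section Multiplication

variable {n : ℕ}

/-- Configuration space `ℝⁿ`. -/
abbrev Conf (n : ℕ) : Type := EuclideanSpace ℝ (Fin n)

theorem memLp_mul (f : Conf n →ᵇ ℂ) (φ : L2 (Fin n)) : MemLp (fun x => f x * φ x) 2 volume := by
  refine MemLp.of_le_mul (c := ‖f‖) (Lp.memLp φ)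
    (f.continuous.aestronglyMeasurable.mul (Lp.aestronglyMeasurable φ)) (Eventually.of_forall fun x => ?_)
  rw [norm_mul]
  gcongr
  exact f.norm_coe_le_norm x

/-- The operator of multiplication by a bounded continuous function. -/
def mulOp (f : Conf n →ᵇ ℂ) : Bdd n :=
  LinearMap.mkContinuous
    { toFun := fun φ => (memLp_mul f φ).toLp
      map_add' := fun φ ψ => by
        rw [← MemLp.toLp_add, MemLp.toLp_eq_toLp_iff]
        filter_upwards [Lp.coeFn_add φ ψ] with x hx
        simp only [Pi.add_apply] at hx ⊢
        rw [hx, mul_add]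
      map_smul' := fun c φ => by
        rw [RingHom.id_apply, ← MemLp.toLp_const_smul, MemLp.toLp_eq_toLp_iff]
        filter_upwards [Lp.coeFn_smul c φ] with x hx
        simp [hx, mul_left_comm] }
    ‖f‖ fun φ => by
      refine Lp.norm_le_mul_norm_of_ae_le_mul ?_
      filter_upwards [(memLp_mul f φ).coeFn_toLp] with x hx
      simp only [LinearMap.coe_mk, AddHom.coe_mk, hx, norm_mul]
      gcongr
      exact f.norm_coe_le_norm x

theorem coeFn_mulOp (f : Conf n →ᵇ ℂ) (φ : L2 (Fin n)) :
    mulOp f φ =ᵐ[volume] fun x => f x * φ x :=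
  (memLp_mul f φ).coeFn_toLp

theorem norm_mulOp_le (f : Conf n →ᵇ ℂ) : ‖mulOp f‖ ≤ ‖f‖ :=
  LinearMap.mkContinuous_norm_le _ (norm_nonneg f) _

theorem mulOp_eq_of_ae {f : Conf n →ᵇ ℂ} {φ ψ : L2 (Fin n)}
    (h : ∀ᵐ x, f x * φ x = ψ x) : mulOp f φ = ψ :=
  Lp.ext ((coeFn_mulOp f φ).trans h)

/-- Multiplication operators as a `*`-homomorphism. -/
def mulHom (n : ℕ) : (Conf n →ᵇ ℂ) →⋆ₐ[ℂ] Bdd n where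
  toFun := mulOp
  map_one' := by
    ext1 φ
    exact mulOp_eq_of_ae (Eventually.of_forall fun x => by simp)
  map_mul' f g := by
    ext1 φ
    refine mulOp_eq_of_ae ?_
    filter_upwards [coeFn_mulOp f (mulOp g φ), coeFn_mulOp g φ] with x h1 h2
    rw [mul_apply_eq_comp, h1, h2, BoundedContinuousFunction.mul_apply, mul_assoc]
  map_zero' := by
    ext1 φ
    refine mulOp_eq_of_ae ?_
    filter_upwards [Lp.coeFn_zero ℂ 2 (volume : Measure (Conf n))] with x h1
    rw [_root_.zero_apply (F := Bdd n), h1]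
    simp
  map_add' f g := by
    ext1 φ
    refine mulOp_eq_of_ae ?_
    filter_upwards [coeFn_mulOp f φ, coeFn_mulOp g φ, Lp.coeFn_add (mulOp f φ) (mulOp g φ)]
      with x h1 h2 h3
    rw [_root_.add_apply (F := Bdd n), h3, Pi.add_apply, h1, h2,
      BoundedContinuousFunction.add_apply, add_mul]
  commutes' c := by
    ext1 φ
    refine mulOp_eq_of_ae ?_
    filter_upwards [Lp.coeFn_smul c φ] with x h1
    rw [Algebra.algebraMap_eq_smul_one, Algebra.algebraMap_eq_smul_one,
      _root_.smul_apply (F := Bdd n), one_apply_eq_self, h1]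
    simp
  map_star' f := by
    rw [ContinuousLinearMap.star_eq_adjoint, ContinuousLinearMap.eq_adjoint_iff]
    intro φ ψ
    rw [L2.inner_def, L2.inner_def]
    refine integral_congr_ae ?_
    filter_upwards [coeFn_mulOp (star f) φ, coeFn_mulOp f ψ] with x h1 h2
    rw [h1, h2]
    simp only [RCLike.inner_apply, BoundedContinuousFunction.star_apply, RCLike.star_def, map_mul,
      RingHomCompTriple.comp_apply, RingHom.id_apply]
    ring

/-- The Fourier transform on `L²(ℝⁿ)`. -/
abbrev fourierL2 (n : ℕ) : L2 (Fin n) ≃ₗᵢ[ℂ] L2 (Fin n) :=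
  Lp.fourierTransformₗᵢ (Conf n) ℂ

/-- Conjugation with a unitary map of `L²(ℝⁿ)`. -/
def unitaryConj (U : L2 (Fin n) ≃ₗᵢ[ℂ] L2 (Fin n)) : Bdd n →⋆ₐ[ℂ] Bdd n where
  toFun A := (U.symm.toContinuousLinearEquiv : Bdd n) * A * (U.toContinuousLinearEquiv : Bdd n)
  map_one' := by ext1 φ; simp
  map_mul' A B := by ext1 φ; simp
  map_zero' := by simp
  map_add' A B := by ext1 φ; simp
  commutes' c := by ext1 φ; simp [Algebra.algebraMap_eq_smul_one]
  map_star' A := by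
    refine (ContinuousLinearMap.eq_adjoint_iff _ _).2 fun φ ψ => ?_
    change inner ℂ (U.symm (star A (U φ))) ψ = inner ℂ φ (U.symm (A (U ψ)))
    rw [← U.inner_map_map, U.apply_symm_apply, ← U.inner_map_map φ, U.apply_symm_apply,
      ContinuousLinearMap.star_eq_adjoint, ContinuousLinearMap.adjoint_inner_left]

theorem unitaryConj_apply (U : L2 (Fin n) ≃ₗᵢ[ℂ] L2 (Fin n)) (A : Bdd n) (φ : L2 (Fin n)) :
    unitaryConj U A φ = U.symm (A (U φ)) := rfl

theorem norm_unitaryConj_le (U : L2 (Fin n) ≃ₗᵢ[ℂ] L2 (Fin n)) (A : Bdd n) :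
    ‖unitaryConj U A‖ ≤ ‖A‖ := by
  refine ContinuousLinearMap.opNorm_le_bound _ (norm_nonneg A) fun φ => ?_
  rw [unitaryConj_apply, U.symm.norm_map]
  simpa using A.le_opNorm (U φ)

/-- Fourier multipliers as a `*`-homomorphism. -/
def fourierHom (n : ℕ) : (Conf n →ᵇ ℂ) →⋆ₐ[ℂ] Bdd n :=
  (unitaryConj (fourierL2 n)).comp (mulHom n)

theorem fourierHom_apply (f : Conf n →ᵇ ℂ) (φ : L2 (Fin n)) :
    fourierHom n f φ = (fourierL2 n).symm (mulOp f (fourierL2 n φ)) := rfl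

theorem continuous_mulHom : Continuous (mulHom n) :=
  AddMonoidHomClass.continuous_of_bound (mulHom n) 1 fun f => by
    rw [one_mul]; exact norm_mulOp_le f

theorem continuous_fourierHom : Continuous (fourierHom n) :=
  AddMonoidHomClass.continuous_of_bound (fourierHom n) 1 fun f => by
    rw [one_mul]; exact (norm_unitaryConj_le _ _).trans (norm_mulOp_le f)

end Multiplication

/-! ### The resolvents of the field operators -/

section FieldResolvents

variable {n : ℕ}

/-- The identity R (T - z) = 1 on `D` survives closure by continuity. Conversely, the vectors y with
(R y, y + z R y) in the closed graph form a closed set containing a dense one. Injectivity of R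
makes the graphs single-valued, so essential self-adjointness need not be known beforehand. -/
theorem isResolvent_closure {E : Type*} [NormedAddCommGroup E] [InnerProductSpace ℂ E]
    {D : Submodule ℂ (E × E)} {R : E →L[ℂ] E} {z : ℂ}
    (hR : ∀ p ∈ D, R (p.2 - z • p.1) = p.1) (hinj : Function.Injective R)
    (hd : Dense {y | ∃ p ∈ D, p.2 - z • p.1 = y}) :
    IsResolvent D.toLinearPMap.closure z R := by
  have hG : IsClosed {p : E × E | R (p.2 - z • p.1) = p.1} :=
    isClosed_eq (by fun_prop) (by fun_prop)
  have hDG : ∀ p ∈ D.topologicalClosure, R (p.2 - z • p.1) = p.1 := fun p hp =>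
    closure_minimal (fun p hp => hR p hp) hG hp
  have single : ∀ {D' : Submodule ℂ (E × E)}, (∀ p ∈ D', R (p.2 - z • p.1) = p.1) →
      ∀ p ∈ D', p.1 = 0 → p.2 = 0 := by
    intro D' h p hp h0
    have := h p hp
    rw [h0, smul_zero, sub_zero, ← map_zero R] at this
    exact hinj this
  have hgr : D.toLinearPMap.graph = D := Submodule.toLinearPMap_graph_eq D (single hR)
  have hcl : D.toLinearPMap.IsClosable :=
    ⟨D.topologicalClosure.toLinearPMap, by
      rw [hgr, Submodule.toLinearPMap_graph_eq _ (single hDG)]⟩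
  intro φ ψ
  rw [← hcl.graph_closure_eq_closure_graph, hgr]
  constructor
  · rintro rfl
    have hcont : Continuous fun y : E => (R y, y + z • R y) := by fun_prop
    refine hd.induction (P := fun y => (R y, y + z • R y) ∈ D.topologicalClosure) ?_
      (D.isClosed_topologicalClosure.preimage hcont) φ
    rintro y ⟨p, hp, rfl⟩
    rw [hR p hp, sub_add_cancel]
    exact D.le_topologicalClosure hp
  · intro h
    simpa using hDG _ h

theorem resolvent_denom_ne {μ : ℝ} (hμ : μ ≠ 0) (r : ℝ) : Complex.I * μ - r ≠ 0 := by
  intro h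
  have := congrArg Complex.im h
  simp at this
  exact hμ this

theorem norm_resolvent_le {μ : ℝ} (hμ : μ ≠ 0) (r : ℝ) :
    ‖(Complex.I * μ - r)⁻¹‖ ≤ |μ|⁻¹ := by
  rw [norm_inv]
  refine inv_anti₀ (abs_pos.2 hμ) ?_
  simpa using Complex.abs_im_le_norm (Complex.I * μ - r)

/-- The function `x ↦ (i μ - x · c)⁻¹`. -/
def resolventFun (c : Conf n) {μ : ℝ} (hμ : μ ≠ 0) : Conf n →ᵇ ℂ :=
  BoundedContinuousFunction.ofNormedAddCommGroup
    (fun x => (Complex.I * μ - (inner ℝ x c : ℝ))⁻¹)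
    (Continuous.inv₀ (by fun_prop) fun x => resolvent_denom_ne hμ _) |μ|⁻¹
    fun x => norm_resolvent_le hμ _

theorem resolventFun_apply (c : Conf n) {μ : ℝ} (hμ : μ ≠ 0) (x : Conf n) :
    resolventFun c hμ x = (Complex.I * μ - (inner ℝ x c : ℝ))⁻¹ := rfl

theorem dense_smooth (n : ℕ) : Dense {φ : L2 (Fin n) | ∃ g : Conf n → ℂ,
    φ =ᵐ[volume] g ∧ HasCompactSupport g ∧ ContDiff ℝ ∞ g} :=
  MeasureTheory.Lp.dense_hasCompactSupport_contDiff (by simp)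

theorem exists_schwartz_mul {g h : Conf n → ℂ} (hg : HasCompactSupport g) (hg' : ContDiff ℝ ∞ g)
    (hh : ContDiff ℝ ∞ h) : ∃ f : 𝓢(Conf n, ℂ), ∀ x, f x = h x * g x :=
  ⟨(hg.mul_left (f := h)).toSchwartzMap (hh.mul hg'), fun _ => rfl⟩

/-- A unitary that maps Schwartz space to itself and diagonalizes the field operator diagonalizes
its resolvent. It is used for pure position fields (the identity) and pure momentum fields (the
Fourier transform); no mixed field is needed below. -/
theorem fieldResolvent_eq_of_intertwine {a b : Fin n → ℝ} {c : Conf n}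
    (U : L2 (Fin n) ≃ₗᵢ[ℂ] L2 (Fin n)) (u : 𝓢(Conf n, ℂ) ≃ 𝓢(Conf n, ℂ))
    (hU : ∀ f : 𝓢(Conf n, ℂ), U (f.toLp 2 volume) = (u f).toLp 2 volume)
    (h : ∀ f x, u (fieldSchwartz a b f) x = (inner ℝ x c : ℝ) * u f x) {μ : ℝ} (hμ : μ ≠ 0) :
    fieldResolvent μ a b = unitaryConj U (mulHom n (resolventFun c hμ)) := by
  have hsub : ∀ f : 𝓢(Conf n, ℂ), ∀ᵐ x, (U ((fieldSchwartz a b f).toLp 2 volume -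
      (Complex.I * μ) • f.toLp 2 volume)) x = ((inner ℝ x c : ℝ) - Complex.I * μ) * u f x := by
    intro f
    rw [map_sub, map_smul, hU, hU]
    filter_upwards [Lp.coeFn_sub ((u (fieldSchwartz a b f)).toLp 2 volume)
      ((Complex.I * μ) • (u f).toLp 2 volume), Lp.coeFn_smul (Complex.I * μ : ℂ) ((u f).toLp 2 volume),
      (u f).coeFn_toLp 2 volume, (u (fieldSchwartz a b f)).coeFn_toLp 2 volume] with x h1 h2 h3 h4
    rw [h1, Pi.sub_apply, h2, Pi.smul_apply, h3, h4, h, smul_eq_mul]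
    ring
  have key : IsResolvent (fieldOp a b) (Complex.I * μ)
      (-unitaryConj U (mulHom n (resolventFun c hμ))) := by
    refine isResolvent_closure ?_ ?_ ?_
    · rintro _ ⟨f, rfl⟩
      change -U.symm (mulOp (resolventFun c hμ) (U ((fieldSchwartz a b f).toLp 2 volume -
        (Complex.I * μ) • f.toLp 2 volume))) = f.toLp 2 volume
      rw [← map_neg, LinearIsometryEquiv.symm_apply_eq, hU, neg_eq_iff_eq_neg]
      refine mulOp_eq_of_ae ?_
      filter_upwards [hsub f, (u f).coeFn_toLp 2 volume, Lp.coeFn_neg ((u f).toLp 2 volume)] with x h1 h2 h3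
      rw [h1, h3, Pi.neg_apply, h2, resolventFun_apply, inv_mul_eq_iff_eq_mul₀
        (resolvent_denom_ne hμ _)]
      ring
    · rw [injective_iff_map_eq_zero]
      intro φ h0
      have h1 : mulOp (resolventFun c hμ) (U φ) = 0 := by
        have : U.symm (mulOp (resolventFun c hμ) (U φ)) = 0 := neg_eq_zero.1 h0
        simpa using this
      have h2 : U φ = 0 := by
        refine Lp.ext ?_
        have h3 := coeFn_mulOp (resolventFun c hμ) (U φ)
        rw [h1] at h3
        filter_upwards [h3, Lp.coeFn_zero ℂ 2 (volume : Measure (Conf n))] with x h4 h5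
        rw [h5] at h4 ⊢
        have := (mul_eq_zero.1 h4.symm).resolve_left
          (by rw [resolventFun_apply]; exact inv_ne_zero (resolvent_denom_ne hμ _))
        simpa using this
      simpa using h2
    -- In the diagonal picture every smooth compactly supported function is in the range: divide it
    -- by the smooth, nowhere vanishing x · c - iμ.
    · refine ((dense_smooth n).preimage U.toHomeomorph.isOpenMap).mono ?_
      rintro y ⟨g, hyg, hg, hg'⟩
      obtain ⟨f, hf⟩ := exists_schwartz_mul (h := fun x : Conf n =>
        ((inner ℝ x c : ℝ) - Complex.I * μ)⁻¹) hg hg' (ContDiff.inv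
          ((Complex.ofRealCLM.contDiff.comp (contDiff_id.inner ℝ contDiff_const)).sub contDiff_const) fun x => by
          rw [← neg_sub, neg_ne_zero]; exact resolvent_denom_ne hμ _)
      refine ⟨_, ⟨u.symm f, rfl⟩, ?_⟩
      change (fieldSchwartz a b (u.symm f)).toLp 2 volume -
        (Complex.I * μ) • (u.symm f).toLp 2 volume = y
      apply U.injective
      refine Lp.ext ?_
      filter_upwards [hsub (u.symm f), hyg] with x h1 h2
      have h3 : (inner ℝ x c : ℝ) - Complex.I * μ ≠ 0 := by
        rw [← neg_sub, neg_ne_zero]; exact resolvent_denom_ne hμ _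
      rw [h1, Equiv.apply_symm_apply, hf, mul_inv_cancel_left₀ h3]
      exact h2.symm
  rw [fieldResolvent, key.resolventOp_eq, neg_neg]

theorem inner_toLp (a : Fin n → ℝ) (x : Conf n) :
    inner ℝ x (WithLp.toLp 2 a) = ∑ k, a k * x k := by
  simp [PiLp.inner_apply]

theorem inner_single (k : Fin n) (x : Conf n) :
    inner ℝ x (EuclideanSpace.single k (1 : ℝ)) = x k := by
  simp [PiLp.inner_apply]

theorem fieldResolvent_position (a : Fin n → ℝ) {μ : ℝ} (hμ : μ ≠ 0) :
    fieldResolvent μ a 0 = mulHom n (resolventFun (WithLp.toLp 2 a) hμ) := by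
  rw [fieldResolvent_eq_of_intertwine (c := WithLp.toLp 2 a) (LinearIsometryEquiv.refl ℂ _)
    (Equiv.refl _) (fun f => rfl) (fun f x => ?_) hμ]
  · ext1 φ; rfl
  · have h : ∀ k : Fin n, (fun x : Conf n => ((x k : ℝ) : ℂ)).HasTemperateGrowth := fun k => by
      simp_rw [← inner_single k]
      fun_prop
    simp only [fieldSchwartz, Equiv.refl_apply]
    simp [inner_toLp, SchwartzMap.smulLeftCLM_apply_apply (h _), Finset.sum_mul, mul_assoc]

/-- The Fourier kernel is exp(-2πi x · ξ), so -i∂ₖ becomes multiplication by 2πξₖ. -/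
theorem fourier_fieldSchwartz (b : Fin n → ℝ) (f : 𝓢(Conf n, ℂ)) (x : Conf n) :
    𝓕 (fieldSchwartz 0 b f) x =
      (inner ℝ x ((2 * Real.pi) • (WithLp.toLp 2 b : Conf n)) : ℝ) * 𝓕 f x := by
  have h : ∀ k : Fin n, (fun x : Conf n =>
      (x k : ℝ)).HasTemperateGrowth := fun k => by
    simp_rw [← inner_single k]
    fun_prop
  have h1 : fieldSchwartz 0 b f =
      ∑ k, ((b k : ℂ) * -Complex.I) • ∂_{(EuclideanSpace.single k (1 : ℝ) : Conf n)} f := by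
    simp [fieldSchwartz, smul_smul]
  rw [h1, FourierTransform.fourier_sum]
  simp only [_root_.sum_apply, FourierTransform.fourier_smul, SchwartzMap.fourier_lineDerivOp_eq,
    _root_.smul_apply, SchwartzMap.smulLeftCLM_apply_apply (h _), inner_smul_right, inner_toLp,
    inner_single, smul_eq_mul, Complex.ofReal_mul, Complex.ofReal_sum, Finset.mul_sum,
    Finset.sum_mul, Complex.real_smul]
  refine Finset.sum_congr rfl fun k _ => ?_
  push_cast
  linear_combination (-2 * Real.pi * b k * x k * 𝓕 f x) * Complex.I_mul_I

theorem fieldResolvent_momentum (b : Fin n → ℝ) {μ : ℝ} (hμ : μ ≠ 0) :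
    fieldResolvent μ 0 b =
      fourierHom n (resolventFun ((2 * Real.pi) • (WithLp.toLp 2 b : Conf n)) hμ) :=
  fieldResolvent_eq_of_intertwine (fourierL2 n)
    (FourierTransform.fourierEquiv ℂ 𝓢(Conf n, ℂ)).toEquiv
    SchwartzMap.toLp_fourier_eq (fourier_fieldSchwartz b) hμ

end FieldResolvents

/-! ### Functions vanishing at infinity -/

section VanishingAtInfinity

variable {n : ℕ}

/-- Restriction of continuous functions from the one-point compactification. -/
def onePointRestrict (n : ℕ) : C(OnePoint (Conf n), ℂ) →⋆ₐ[ℂ] (Conf n →ᵇ ℂ) where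
  toFun F := (BoundedContinuousFunction.mkOfCompact F).compContinuous
    ⟨((↑) : Conf n → OnePoint (Conf n)), OnePoint.continuous_coe⟩
  map_one' := rfl
  map_mul' _ _ := rfl
  map_zero' := rfl
  map_add' _ _ := rfl
  commutes' _ := rfl
  map_star' _ := rfl

theorem onePointRestrict_apply (F : C(OnePoint (Conf n), ℂ)) (x : Conf n) :
    onePointRestrict n F x = F x := rfl

theorem continuous_onePointRestrict : Continuous (onePointRestrict n) :=
  AddMonoidHomClass.continuous_of_bound (onePointRestrict n) 1 fun F => by
    rw [one_mul, BoundedContinuousFunction.norm_le (norm_nonneg F)]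
    exact fun x => F.norm_coe_le_norm x

theorem exists_onePoint_extension {f : Conf n →ᵇ ℂ} (hf : Tendsto f (cocompact _) (𝓝 0)) :
    ∃ F : C(OnePoint (Conf n), ℂ), onePointRestrict n F = f ∧ F OnePoint.infty = 0 :=
  ⟨OnePoint.continuousMapMk f.toContinuousMap 0 (by rwa [coclosedCompact_eq_cocompact]),
    by ext x; rfl, rfl⟩

/-- A product of resolvents of all coordinates. -/
def resolventProd (n : ℕ) : Conf n →ᵇ ℂ :=
  ∏ k, resolventFun (EuclideanSpace.single k 1) one_ne_zero

theorem resolventProd_apply (x : Conf n) :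
    resolventProd n x = ∏ k, (Complex.I - (x k : ℂ))⁻¹ := by
  simp [resolventProd, BoundedContinuousFunction.coe_prod, resolventFun_apply, inner_single]

theorem coord_resolvent_norm_sq (r : ℝ) : ‖(Complex.I - (r : ℂ))⁻¹‖ ^ 2 = (1 + r ^ 2)⁻¹ := by
  rw [norm_inv, inv_pow, Complex.sq_norm, Complex.normSq_apply]
  simp
  ring_nf

theorem sq_norm_mul_resolventProd_le (x : Conf n) : (‖x‖ * ‖resolventProd n x‖) ^ 2 ≤ n := by
  rw [mul_pow, EuclideanSpace.norm_sq_eq, Finset.sum_mul]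
  calc ∑ k, ‖x k‖ ^ 2 * ‖resolventProd n x‖ ^ 2 ≤ ∑ k : Fin n, (1 : ℝ) := by
        refine Finset.sum_le_sum fun k _ => ?_
        rw [resolventProd_apply, norm_prod, ← Finset.prod_pow,
          ← Finset.mul_prod_erase _ _ (Finset.mem_univ k)]
        simp_rw [coord_resolvent_norm_sq]
        have h1 : ∏ j ∈ Finset.univ.erase k, (1 + x j ^ 2)⁻¹ ≤ 1 :=
          Finset.prod_le_one (fun j _ => by positivity) fun j _ =>
            inv_le_one_of_one_le₀ (by nlinarith [sq_nonneg (x j)])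
        have h2 : ‖x k‖ ^ 2 * (1 + x k ^ 2)⁻¹ ≤ 1 := by
          rw [← div_eq_mul_inv, div_le_one (by positivity), Real.norm_eq_abs, sq_abs]
          linarith
        rw [← mul_assoc]
        exact mul_le_one₀ h2 (Finset.prod_nonneg fun j _ => by positivity) h1
    _ = n := by simp

theorem tendsto_resolventProd : Tendsto (resolventProd n) (cocompact _) (𝓝 0) := by
  rw [tendsto_zero_iff_norm_tendsto_zero]
  have h0 : Tendsto (fun x : Conf n => √n * ‖x‖⁻¹) (cocompact _) (𝓝 0) := by
    simpa using (tendsto_norm_cocompact_atTop (E := Conf n)).inv_tendsto_atTop.const_mul (√n)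
  refine squeeze_zero' (Eventually.of_forall fun x => norm_nonneg _) ?_ h0
  filter_upwards [(tendsto_norm_cocompact_atTop (E := Conf n)).eventually_gt_atTop 0] with x hx
  rw [← div_eq_mul_inv, le_div_iff₀ hx, mul_comm]
  exact Real.le_sqrt_of_sq_le (sq_norm_mul_resolventProd_le x)

/-- Stone–Weierstrass on the one-point compactification. A single resolvent function is constant
along hyperplanes and need not extend to infinity; the product over all coordinates does, vanishes
there, and has no zero at finite points. -/
theorem mem_of_tendsto_zero {𝒜 : StarSubalgebra ℂ (Conf n →ᵇ ℂ)}
    (hc : IsClosed (𝒜 : Set (Conf n →ᵇ ℂ)))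
    (hres : ∀ (c : Conf n) {μ : ℝ} (hμ : μ ≠ 0), resolventFun c hμ ∈ 𝒜)
    {f : Conf n →ᵇ ℂ} (hf : Tendsto f (cocompact _) (𝓝 0)) : f ∈ 𝒜 := by
  let 𝒞 : StarSubalgebra ℂ C(OnePoint (Conf n), ℂ) := 𝒜.comap (onePointRestrict n)
  have hP : resolventProd n ∈ 𝒜 := prod_mem fun k _ => hres _ _
  have hsep1 : ∀ x : Conf n, ∃ F ∈ 𝒞, F x ≠ F OnePoint.infty := by
    intro x
    obtain ⟨F, hF, h0⟩ := exists_onePoint_extension (tendsto_resolventProd (n := n))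
    refine ⟨F, ?_, ?_⟩
    · change onePointRestrict n F ∈ 𝒜
      rwa [hF]
    · rw [h0, ← onePointRestrict_apply, hF, resolventProd_apply]
      refine Finset.prod_ne_zero_iff.2 fun k _ => inv_ne_zero ?_
      simpa using resolvent_denom_ne one_ne_zero (x k)
  have hsep2 : ∀ x y : Conf n, x ≠ y → ∃ F ∈ 𝒞, F x ≠ F y := by
    intro x y hxy
    obtain ⟨k, hk⟩ : ∃ k, x k ≠ y k := by
      by_contra! h
      exact hxy (PiLp.ext h)
    by_contra! hall
    have key : ∀ f : Conf n →ᵇ ℂ, f ∈ 𝒜 → Tendsto f (cocompact _) (𝓝 0) → f x = f y := by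
      intro f hf hf0
      obtain ⟨F, hF, -⟩ := exists_onePoint_extension hf0
      have := hall F (show onePointRestrict n F ∈ 𝒜 by rwa [hF])
      rwa [← onePointRestrict_apply, ← onePointRestrict_apply, hF] at this
    -- If the product P and P times the k-th coordinate resolvent both agree at x and y, cancelling
    -- P(y) ≠ 0 forces xₖ = yₖ.
    have h1 := key _ hP tendsto_resolventProd
    have h2 := key _ (mul_mem hP (hres (EuclideanSpace.single k 1) one_ne_zero)) (by
      refine squeeze_zero_norm (a := fun x => ‖resolventProd n x‖ * |(1 : ℝ)|⁻¹) (fun x => ?_) (by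
        simpa using (tendsto_zero_iff_norm_tendsto_zero.1 (tendsto_resolventProd (n := n))))
      rw [BoundedContinuousFunction.mul_apply, norm_mul]
      gcongr
      exact norm_resolvent_le one_ne_zero _)
    have h3 : resolventProd n y ≠ 0 := by
      rw [resolventProd_apply]
      refine Finset.prod_ne_zero_iff.2 fun k _ => inv_ne_zero ?_
      simpa using resolvent_denom_ne one_ne_zero (y k)
    rw [BoundedContinuousFunction.mul_apply, BoundedContinuousFunction.mul_apply, h1] at h2
    have h4 := mul_left_cancel₀ h3 h2
    rw [resolventFun_apply, resolventFun_apply, inv_inj, inner_single, inner_single] at h4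
    exact hk (by exact_mod_cast sub_right_injective h4)
  have hsep : 𝒞.SeparatesPoints := by
    intro p q hpq
    suffices ∃ F ∈ 𝒞, F p ≠ F q by
      obtain ⟨F, hF, h⟩ := this
      exact ⟨F, ⟨F, hF, rfl⟩, h⟩
    induction p using OnePoint.rec with
    | infty =>
      induction q using OnePoint.rec with
      | infty => exact absurd rfl hpq
      | coe y =>
        obtain ⟨F, hF, h⟩ := hsep1 y
        exact ⟨F, hF, h.symm⟩
    | coe x =>
      induction q using OnePoint.rec with
      | infty => exact hsep1 x
      | coe y => exact hsep2 x y fun h => hpq (h ▸ rfl)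
  have htop := ContinuousMap.starSubalgebra_topologicalClosure_eq_top_of_separatesPoints 𝒞 hsep
  obtain ⟨F, rfl, -⟩ := exists_onePoint_extension hf
  have hF : F ∈ 𝒞.topologicalClosure := htop ▸ StarSubalgebra.mem_top
  have hcl : IsClosed (𝒞 : Set C(OnePoint (Conf n), ℂ)) := hc.preimage continuous_onePointRestrict
  exact StarSubalgebra.topologicalClosure_minimal le_rfl hcl hF

end VanishingAtInfinity

/-! ### Functions of position and of momentum in the resolvent algebra -/

section ResolventAlgebra

variable {n : ℕ}

theorem subset_cstarGenerated (S : Set (Bdd n)) : S ⊆ cstarGenerated S :=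
  (NonUnitalStarAlgebra.subset_adjoin ℂ S).trans
    (NonUnitalStarSubalgebra.le_topologicalClosure _)

theorem isClosed_cstarGenerated (S : Set (Bdd n)) : IsClosed (cstarGenerated S : Set (Bdd n)) :=
  NonUnitalStarSubalgebra.isClosed_topologicalClosure _

theorem cstarGenerated_le {S : Set (Bdd n)} {B : NonUnitalStarSubalgebra ℂ (Bdd n)}
    (hB : IsClosed (B : Set (Bdd n))) (h : S ⊆ B) : cstarGenerated S ≤ B :=
  NonUnitalStarSubalgebra.topologicalClosure_minimal _ (NonUnitalStarAlgebra.adjoin_le h) hB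

theorem fieldResolvent_mem {μ : ℝ} (hμ : μ ≠ 0) (a b : Fin n → ℝ) :
    fieldResolvent μ a b ∈ resolventAlgebra n :=
  subset_cstarGenerated _ ⟨μ, a, b, hμ, rfl⟩

theorem mulHom_resolventFun_mem (c : Conf n) {μ : ℝ} (hμ : μ ≠ 0) :
    mulHom n (resolventFun c hμ) ∈ resolventAlgebra n := by
  have := fieldResolvent_mem hμ c.ofLp 0
  rwa [fieldResolvent_position] at this

theorem fourierHom_resolventFun_mem (c : Conf n) {μ : ℝ} (hμ : μ ≠ 0) :
    fourierHom n (resolventFun c hμ) ∈ resolventAlgebra n := by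
  have := fieldResolvent_mem hμ 0 ((2 * Real.pi)⁻¹ • c.ofLp)
  rwa [fieldResolvent_momentum, WithLp.toLp_smul, smul_smul,
    mul_inv_cancel₀ (by positivity), one_smul] at this

theorem one_mem_resolventAlgebra : (1 : Bdd n) ∈ resolventAlgebra n := by
  have h := mulHom_resolventFun_mem (0 : Conf n) one_ne_zero
  -- The resolvent of the zero field at μ = 1 is the scalar 1/i.
  have h1 : resolventFun (0 : Conf n) one_ne_zero = (-Complex.I) • (1 : Conf n →ᵇ ℂ) := by
    ext x
    simp [resolventFun_apply]
  rw [h1, map_smul, map_one] at h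
  have h2 := SMulMemClass.smul_mem Complex.I h
  rwa [smul_smul, mul_neg, Complex.I_mul_I, neg_neg, one_smul] at h2

/-- The resolvent algebra as a unital `*`-subalgebra. -/
def resolventStarSubalgebra (n : ℕ) : StarSubalgebra ℂ (Bdd n) where
  __ := resolventAlgebra n
  algebraMap_mem' c := by
    rw [Algebra.algebraMap_eq_smul_one]
    exact SMulMemClass.smul_mem c one_mem_resolventAlgebra

theorem isClosed_resolventAlgebra : IsClosed (resolventAlgebra n : Set (Bdd n)) :=
  isClosed_cstarGenerated _

theorem mulHom_mem {f : Conf n →ᵇ ℂ} (hf : Tendsto f (cocompact _) (𝓝 0)) :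
    mulHom n f ∈ resolventAlgebra n :=
  mem_of_tendsto_zero (𝒜 := (resolventStarSubalgebra n).comap (mulHom n))
    (isClosed_resolventAlgebra.preimage continuous_mulHom)
    (fun c _ hμ => mulHom_resolventFun_mem c hμ) hf

theorem fourierHom_mem {f : Conf n →ᵇ ℂ} (hf : Tendsto f (cocompact _) (𝓝 0)) :
    fourierHom n f ∈ resolventAlgebra n :=
  mem_of_tendsto_zero (𝒜 := (resolventStarSubalgebra n).comap (fourierHom n))
    (isClosed_resolventAlgebra.preimage continuous_fourierHom)
    (fun c _ hμ => fourierHom_resolventFun_mem c hμ) hf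

end ResolventAlgebra

/-! ### Compact operators in the resolvent algebra -/

section Compact

variable {n : ℕ}

/-- A Schwartz function as an element of `L²(ℝⁿ)`. -/
abbrev sL2 (f : 𝓢(Conf n, ℂ)) : L2 (Fin n) := f.toLp 2 volume

theorem denseRange_sL2 : DenseRange (sL2 : 𝓢(Conf n, ℂ) → L2 (Fin n)) :=
  SchwartzMap.denseRange_toLpCLM (p := 2) (μ := volume) ENNReal.ofNat_ne_top

theorem opNorm_le_of_schwartz {T : Bdd n} {C : ℝ} (hC : 0 ≤ C)
    (h : ∀ φ ψ : 𝓢(Conf n, ℂ), ‖inner ℂ (sL2 φ) (T (sL2 ψ))‖ ≤ C * ‖sL2 φ‖ * ‖sL2 ψ‖) :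
    ‖T‖ ≤ C := by
  have h1 : ∀ φ ψ : L2 (Fin n), ‖inner ℂ φ (T ψ)‖ ≤ C * ‖φ‖ * ‖ψ‖ := fun φ ψ =>
    denseRange_sL2.induction_on₂ (p := fun φ ψ => ‖inner ℂ φ (T ψ)‖ ≤ C * ‖φ‖ * ‖ψ‖)
      (isClosed_le (by fun_prop) (by fun_prop)) h φ ψ
  refine T.opNorm_le_bound hC fun ψ => ?_
  rcases (norm_nonneg (T ψ)).eq_or_lt with h0 | h0
  · rw [← h0]; positivity
  · have h2 := h1 (T ψ) ψ
    rw [inner_self_eq_norm_sq_to_K, norm_pow, RCLike.norm_ofReal, abs_norm] at h2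
    nlinarith

/-- The product `conj f · φ` of Schwartz functions. -/
def conjMul (f φ : 𝓢(Conf n, ℂ)) : 𝓢(Conf n, ℂ) :=
  SchwartzMap.smulLeftCLM ℂ (fun x => starRingEnd ℂ (f x)) φ

theorem conjMul_apply (f φ : 𝓢(Conf n, ℂ)) (x : Conf n) :
    conjMul f φ x = starRingEnd ℂ (f x) * φ x :=
  SchwartzMap.smulLeftCLM_apply_apply
    ((Complex.conjCLE.toContinuousLinearMap).hasTemperateGrowth.comp f.hasTemperateGrowth) _ _

/-- The character `x ↦ exp(2 π i x · ξ)`. -/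
def charFun (ξ : Conf n) : Conf n →ᵇ ℂ :=
  BoundedContinuousFunction.ofNormedAddCommGroup
    (fun x => Complex.exp ((2 * Real.pi * inner ℝ x ξ : ℝ) * Complex.I)) (by fun_prop) 1
    fun x => (Complex.norm_exp_ofReal_mul_I _).le

theorem charFun_apply (ξ x : Conf n) :
    charFun ξ x = Complex.exp ((2 * Real.pi * inner ℝ x ξ : ℝ) * Complex.I) := rfl

theorem fourier_conjMul (f φ : 𝓢(Conf n, ℂ)) (ξ : Conf n) :
    𝓕 (conjMul f φ) ξ = inner ℂ (mulOp (charFun ξ) (sL2 f)) (sL2 φ) := by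
  rw [SchwartzMap.fourier_coe, Real.fourier_eq', L2.inner_def]
  refine integral_congr_ae ?_
  filter_upwards [coeFn_mulOp (charFun ξ) (sL2 f), f.coeFn_toLp 2 volume,
    φ.coeFn_toLp 2 volume] with x h1 h2 h3
  rw [h1, h2, h3, RCLike.inner_apply, conjMul_apply, map_mul, charFun_apply, ← Complex.exp_conj]
  simp only [map_mul, Complex.conj_ofReal, Complex.conj_I, smul_eq_mul]
  push_cast
  ring_nf

theorem fourier_conjMul_zero (f φ : 𝓢(Conf n, ℂ)) :
    𝓕 (conjMul f φ) 0 = inner ℂ (sL2 f) (sL2 φ) := by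
  rw [fourier_conjMul]
  congr 1
  refine mulOp_eq_of_ae (Eventually.of_forall fun x => ?_)
  simp [charFun_apply]

theorem norm_fourier_conjMul_le (f φ : 𝓢(Conf n, ℂ)) (ξ : Conf n) :
    ‖𝓕 (conjMul f φ) ξ‖ ≤ ‖sL2 f‖ * ‖sL2 φ‖ := by
  rw [fourier_conjMul]
  refine (norm_inner_le_norm _ _).trans ?_
  gcongr
  refine Lp.norm_le_norm_of_ae_le ?_
  filter_upwards [coeFn_mulOp (charFun ξ) (sL2 f)] with x h1
  rw [h1, norm_mul, charFun_apply, Complex.norm_exp_ofReal_mul_I, one_mul]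

/-- Since |exp(2πi x · ξ) - 1| ≤ 2π|x||ξ|, the growing factor |x| can be charged to the fixed f,
leaving only the L² norm of φ. The weight 1 + |x|² dominates |x| and, unlike it, is smooth, so the
weighted f is again Schwartz. -/
theorem exists_norm_charFun_sub_le (f : 𝓢(Conf n, ℂ)) :
    ∃ C : ℝ, 0 ≤ C ∧ ∀ (ξ : Conf n) (φ : 𝓢(Conf n, ℂ)),
      ‖𝓕 (conjMul f φ) ξ - 𝓕 (conjMul f φ) 0‖ ≤ C * ‖ξ‖ * ‖sL2 φ‖ := by
  have ht : (fun x : Conf n => ((1 + ‖x‖ ^ 2 : ℝ) : ℂ)).HasTemperateGrowth := by fun_prop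
  let k : 𝓢(Conf n, ℂ) := SchwartzMap.smulLeftCLM ℂ (fun x : Conf n => ((1 + ‖x‖ ^ 2 : ℝ) : ℂ)) f
  refine ⟨2 * Real.pi * ‖sL2 k‖, by positivity, fun ξ φ => ?_⟩
  rw [fourier_conjMul_zero, fourier_conjMul, ← inner_sub_left]
  refine (norm_inner_le_norm _ _).trans ?_
  gcongr
  rw [mul_right_comm]
  refine Lp.norm_le_mul_norm_of_ae_le_mul ?_
  filter_upwards [Lp.coeFn_sub (mulOp (charFun ξ) (sL2 f)) (sL2 f),
    coeFn_mulOp (charFun ξ) (sL2 f), f.coeFn_toLp 2 volume, k.coeFn_toLp 2 volume] with x h1 h2 h3 h4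
  rw [h1, Pi.sub_apply, h2, h3, h4, SchwartzMap.smulLeftCLM_apply_apply ht, ← sub_one_mul, norm_mul,
    smul_eq_mul, norm_mul, ← mul_assoc]
  gcongr
  rw [charFun_apply, mul_comm _ Complex.I, Complex.norm_real, Real.norm_of_nonneg (by positivity)]
  refine (Real.norm_exp_I_mul_ofReal_sub_one_le).trans ?_
  rw [Real.norm_eq_abs, abs_mul, abs_of_nonneg (by positivity : (0 : ℝ) ≤ 2 * Real.pi)]
  have h5 : ‖x‖ ≤ 1 + ‖x‖ ^ 2 := by nlinarith [sq_nonneg (‖x‖ - 1), norm_nonneg x]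
  calc 2 * Real.pi * |inner ℝ x ξ| ≤ 2 * Real.pi * (‖x‖ * ‖ξ‖) := by
        gcongr; exact abs_real_inner_le_norm x ξ
    _ ≤ 2 * Real.pi * ((1 + ‖x‖ ^ 2) * ‖ξ‖) := by gcongr
    _ = 2 * Real.pi * ‖ξ‖ * (1 + ‖x‖ ^ 2) := by ring

/-- The bounded function underlying a Schwartz function. -/
abbrev sBdd (f : 𝓢(Conf n, ℂ)) : Conf n →ᵇ ℂ := f.toBoundedContinuousFunction

theorem mulOp_star_sL2 (f φ : 𝓢(Conf n, ℂ)) : mulOp (star (sBdd f)) (sL2 φ) = sL2 (conjMul f φ) := by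
  refine mulOp_eq_of_ae ?_
  filter_upwards [φ.coeFn_toLp 2 volume, (conjMul f φ).coeFn_toLp 2 volume] with x h1 h2
  rw [h1, h2, conjMul_apply]
  rfl

theorem inner_localized_multiplier (f h φ ψ G : 𝓢(Conf n, ℂ)) :
    inner ℂ (sL2 φ) ((mulHom n (sBdd f) * fourierHom n (sBdd G) * mulHom n (star (sBdd h))) (sL2 ψ)) =
      ∫ ξ, G ξ * (starRingEnd ℂ (𝓕 (conjMul f φ) ξ) * 𝓕 (conjMul h ψ) ξ) := by
  have h1 : mulHom n (sBdd f) = ContinuousLinearMap.adjoint (mulHom n (star (sBdd f))) := by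
    rw [← ContinuousLinearMap.star_eq_adjoint, ← map_star, star_star]
  rw [mul_apply_eq_comp, mul_apply_eq_comp, h1, ContinuousLinearMap.adjoint_inner_right]
  change inner ℂ (mulOp (star (sBdd f)) (sL2 φ)) ((fourierL2 n).symm (mulOp (sBdd G) (fourierL2 n
    (mulOp (star (sBdd h)) (sL2 ψ))))) = _
  rw [mulOp_star_sL2, mulOp_star_sL2, ← (fourierL2 n).inner_map_map,
    LinearIsometryEquiv.apply_symm_apply]
  have h2 : ∀ u : 𝓢(Conf n, ℂ), fourierL2 n (sL2 u) = sL2 (𝓕 u) := SchwartzMap.toLp_fourier_eq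
  rw [h2, h2, L2.inner_def]
  refine integral_congr_ae ?_
  filter_upwards [coeFn_mulOp (sBdd G) (sL2 (𝓕 (conjMul h ψ))),
    (𝓕 (conjMul f φ)).coeFn_toLp 2 volume, (𝓕 (conjMul h ψ)).coeFn_toLp 2 volume] with ξ e1 e2 e3
  rw [e1, e2, e3, RCLike.inner_apply, SchwartzMap.toBoundedContinuousFunction_apply]
  ring

theorem mulHom_schwartz_mem (f : 𝓢(Conf n, ℂ)) : mulHom n (sBdd f) ∈ resolventAlgebra n :=
  mulHom_mem f.tendsto_cocompact

/-- By Plancherel the form of f(Q) G(P) h(Q)* integrates G against conj û · v̂, where u = conj f · φ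
and v = conj h · ψ. For G a bump of integral one near 0 this is close to conj û(0) · v̂(0) = ⟨φ,
f⟩⟨h, ψ⟩, uniformly for φ, ψ in the unit ball, hence in operator norm. -/
theorem rankOne_schwartz_mem (f h : 𝓢(Conf n, ℂ)) :
    InnerProductSpace.rankOne ℂ (sL2 f) (sL2 h) ∈ resolventAlgebra n := by
  obtain ⟨C, hC, hf⟩ := exists_norm_charFun_sub_le f
  obtain ⟨C', hC', hh⟩ := exists_norm_charFun_sub_le h
  set K : ℝ := C * ‖sL2 h‖ + ‖sL2 f‖ * C' with hK
  have hK0 : 0 ≤ K := by positivity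
  refine isClosed_resolventAlgebra.closure_subset ?_
  refine Metric.mem_closure_iff.2 fun ε hε => ?_
  -- The error is at most K δ; the summand 1 avoids division by zero when K = 0.
  set δ : ℝ := ε / (2 * (K + 1)) with hδ
  have hδ0 : 0 < δ := by positivity
  let b : ContDiffBump (0 : Conf n) := ⟨δ / 2, δ, by positivity, by linarith⟩
  let g : Conf n → ℝ := b.normed volume
  have hgc : HasCompactSupport fun ξ => (g ξ : ℂ) :=
    b.hasCompactSupport_normed.comp_left Complex.ofReal_zero
  let G : 𝓢(Conf n, ℂ) := hgc.toSchwartzMap (Complex.ofRealCLM.contDiff.comp b.contDiff_normed)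
  have hG : ∀ ξ, G ξ = (g ξ : ℂ) := fun _ => rfl
  have hg1 : ∫ ξ, g ξ = 1 := b.integral_normed
  have hgi : Integrable g := b.integrable_normed
  refine ⟨_, mul_mem (mul_mem (mulHom_schwartz_mem f) (fourierHom_mem (f := sBdd G) G.tendsto_cocompact))
    ((map_star (mulHom n) (sBdd h)).symm ▸ star_mem (mulHom_schwartz_mem h)), ?_⟩
  rw [dist_comm, dist_eq_norm]
  refine lt_of_le_of_lt (opNorm_le_of_schwartz (C := K * δ) (by positivity) fun φ ψ => ?_) ?_
  · rw [_root_.sub_apply (F := Bdd n), inner_sub_right]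
    change ‖inner ℂ (sL2 φ) ((mulHom n (sBdd f) * fourierHom n (sBdd G) *
      mulHom n (star (sBdd h))) (sL2 ψ)) - _‖ ≤ _
    rw [inner_localized_multiplier, InnerProductSpace.rankOne_apply, inner_smul_right,
      ← fourier_conjMul_zero, ← inner_conj_symm, ← fourier_conjMul_zero]
    set u := 𝓕 (conjMul f φ)
    set v := 𝓕 (conjMul h ψ)
    have hcont : Continuous fun ξ => starRingEnd ℂ (u ξ) * v ξ :=
      (Complex.continuous_conj.comp u.continuous).mul v.continuous
    have hint : Integrable fun ξ => G ξ * (starRingEnd ℂ (u ξ) * v ξ) :=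
      (G.continuous.mul hcont).integrable_of_hasCompactSupport hgc.mul_right
    have hint' : Integrable fun ξ => G ξ * (starRingEnd ℂ (u 0) * v 0) :=
      G.integrable.mul_const _
    have hone : ∫ ξ, G ξ * (starRingEnd ℂ (u 0) * v 0) = starRingEnd ℂ (u 0) * v 0 := by
      rw [integral_mul_const]
      simp_rw [hG]
      rw [integral_complex_ofReal, hg1, Complex.ofReal_one, one_mul]
    rw [mul_comm (v 0), ← hone, ← integral_sub hint hint']
    have hbound : ∀ ξ, ‖G ξ * (starRingEnd ℂ (u ξ) * v ξ) - G ξ * (starRingEnd ℂ (u 0) * v 0)‖ ≤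
        g ξ * (K * δ * ‖sL2 φ‖ * ‖sL2 ψ‖) := by
      intro ξ
      rw [← mul_sub, norm_mul, hG, Complex.norm_real, Real.norm_of_nonneg (b.nonneg_normed ξ)]
      by_cases hξ : ‖ξ‖ < δ
      · refine mul_le_mul_of_nonneg_left ?_ (b.nonneg_normed ξ)
        have e1 : starRingEnd ℂ (u ξ) * v ξ - starRingEnd ℂ (u 0) * v 0 =
            starRingEnd ℂ (u ξ - u 0) * v ξ + starRingEnd ℂ (u 0) * (v ξ - v 0) := by
          rw [map_sub]; ring
        rw [e1]
        refine (norm_add_le _ _).trans ?_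
        rw [norm_mul, norm_mul, RCLike.norm_conj, RCLike.norm_conj]
        calc ‖u ξ - u 0‖ * ‖v ξ‖ + ‖u 0‖ * ‖v ξ - v 0‖
            ≤ (C * ‖ξ‖ * ‖sL2 φ‖) * (‖sL2 h‖ * ‖sL2 ψ‖) +
              (‖sL2 f‖ * ‖sL2 φ‖) * (C' * ‖ξ‖ * ‖sL2 ψ‖) := by
              gcongr
              · exact hf ξ φ
              · exact norm_fourier_conjMul_le h ψ ξ
              · exact norm_fourier_conjMul_le f φ 0
              · exact hh ξ ψ
          _ = K * ‖ξ‖ * ‖sL2 φ‖ * ‖sL2 ψ‖ := by rw [hK]; ring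
          _ ≤ K * δ * ‖sL2 φ‖ * ‖sL2 ψ‖ := by gcongr
      · have h0 : g ξ = 0 := by
          have : ξ ∉ Function.support g := by
            rw [b.support_normed_eq]
            simpa using hξ
          simpa using this
        rw [show b.normed volume ξ = 0 from h0, h0, zero_mul, zero_mul]
    refine (norm_integral_le_of_norm_le (hgi.mul_const _) (Eventually.of_forall hbound)).trans ?_
    rw [integral_mul_const, hg1, one_mul]
  · rw [hδ]
    have : K * (ε / (2 * (K + 1))) = ε * (K / (2 * (K + 1))) := by ring
    rw [this]
    have h2 : K / (2 * (K + 1)) < 1 := by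
      rw [div_lt_one (by positivity)]; linarith
    nlinarith

theorem rankOne_mem (x y : L2 (Fin n)) :
    InnerProductSpace.rankOne ℂ x y ∈ resolventAlgebra n := by
  have h1 : ∀ (f : 𝓢(Conf n, ℂ)) (y : L2 (Fin n)),
      InnerProductSpace.rankOne ℂ (sL2 f) y ∈ resolventAlgebra n := fun f y =>
    denseRange_sL2.induction_on y (isClosed_resolventAlgebra.preimage
      (InnerProductSpace.rankOne ℂ (sL2 f)).continuous) (rankOne_schwartz_mem f)
  refine denseRange_sL2.induction_on y (isClosed_resolventAlgebra.preimage
    (InnerProductSpace.rankOne ℂ x).continuous) fun f => ?_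
  have h2 := star_mem (h1 f x)
  rwa [ContinuousLinearMap.star_eq_adjoint, InnerProductSpace.adjoint_rankOne] at h2

/-- Projecting onto the span of a finite ε/2-net of the image of the unit ball changes K by less
than ε, and the projected operator is a finite sum of rank-one operators. -/
theorem compact_mem_of_rankOne_mem {𝒜 : NonUnitalStarSubalgebra ℂ (Bdd n)}
    (hc : IsClosed (𝒜 : Set (Bdd n)))
    (h1 : ∀ x y : L2 (Fin n), InnerProductSpace.rankOne ℂ x y ∈ 𝒜) {K : Bdd n}
    (hK : IsCompactOperator K) : K ∈ 𝒜 := by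
  refine hc.closure_subset (Metric.mem_closure_iff.2 fun ε hε => ?_)
  have htb : TotallyBounded (K '' Metric.closedBall 0 1) :=
    (hK.isCompact_closure_image_closedBall 1).totallyBounded.subset subset_closure
  obtain ⟨t, ht, hcov⟩ := Metric.totallyBounded_iff.1 htb (ε / 2) (by positivity)
  let V : Submodule ℂ (L2 (Fin n)) := Submodule.span ℂ t
  have : FiniteDimensional ℂ V := FiniteDimensional.span_of_finite ℂ ht
  refine ⟨V.starProjection * K, ?_, ?_⟩
  · rw [OrthonormalBasis.starProjection_eq_sum_rankOne (stdOrthonormalBasis ℂ V), Finset.sum_mul]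
    refine sum_mem fun i _ => ?_
    rw [ContinuousLinearMap.mul_def, InnerProductSpace.rankOne_comp]
    exact h1 _ _
  · rw [dist_eq_norm]
    refine lt_of_le_of_lt (ContinuousLinearMap.opNorm_le_of_unit_norm (C := ε / 2)
      (by positivity) fun x hx => ?_) (half_lt_self hε)
    have hKx : K x ∈ K '' Metric.closedBall 0 1 := ⟨x, by simp [hx], rfl⟩
    obtain ⟨y, hy, hxy⟩ := Set.mem_iUnion₂.1 (hcov hKx)
    rw [_root_.sub_apply (F := Bdd n), mul_apply_eq_comp, Submodule.starProjection_minimal]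
    refine (ciInf_le ⟨0, ?_⟩ (⟨y, Submodule.subset_span hy⟩ : V)).trans ?_
    · rintro _ ⟨v, rfl⟩
      exact norm_nonneg _
    · rw [← dist_eq_norm]
      exact (Metric.mem_ball.1 hxy).le

theorem algK_le_resolventAlgebra : algK n ≤ resolventAlgebra n := by
  refine cstarGenerated_le isClosed_resolventAlgebra ?_
  rintro K (hK | rfl)
  · exact compact_mem_of_rankOne_mem isClosed_resolventAlgebra rankOne_mem hK
  · exact one_mem_resolventAlgebra

end Compact

/-! ### The Sobolev space in momentum space -/

section Sobolev

variable {n : ℕ}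

theorem toTemperedDistribution_injective :
    Function.Injective (Lp.toTemperedDistributionCLM (E := Conf n) ℂ volume 2) :=
  LinearMap.ker_eq_bot.1 Lp.ker_toTemperedDistributionCLM_eq_bot

theorem sobolevH1_ext {u v : sobolevH1 n} (h : u.1.1 = v.1.1) : u = v := by
  refine Subtype.ext (Prod.ext h (funext fun j => ?_))
  apply toTemperedDistribution_injective
  rw [← u.2 j, ← v.2 j, h]

theorem lineDeriv_eq_iff_fourier (j : Fin n) (φ ψ : L2 (Fin n)) :
    ∂_{(EuclideanSpace.single j (1 : ℝ) : Conf n)} (Lp.toTemperedDistributionCLM ℂ volume 2 φ) =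
        Lp.toTemperedDistributionCLM ℂ volume 2 ψ ↔
      ∀ᵐ ξ : Conf n, fourierL2 n ψ ξ = (2 * Real.pi * Complex.I) * (ξ j : ℝ) * fourierL2 n φ ξ := by
  have ht : (fun x : Conf n => ((inner ℝ x (EuclideanSpace.single j (1 : ℝ)) : ℝ) :
      ℂ)).HasTemperateGrowth := by fun_prop
  have ht' : (fun x : Conf n => ((x j : ℝ) : ℂ)).HasTemperateGrowth := by
    simpa only [inner_single] using ht
  have hF : ∀ f : L2 (Fin n), 𝓕 (Lp.toTemperedDistributionCLM ℂ volume 2 f) =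
      Lp.toTemperedDistributionCLM ℂ volume 2 (fourierL2 n f) :=
    Lp.fourier_toTemperedDistribution_eq
  have hinj : Function.Injective (𝓕 : 𝓢'(Conf n, ℂ) → 𝓢'(Conf n, ℂ)) :=
    (FourierTransform.fourierEquiv ℂ 𝓢'(Conf n, ℂ)).injective
  rw [← hinj.eq_iff, TemperedDistribution.fourier_lineDerivOp_eq, hF, hF]
  have hl : ∀ g : 𝓢(Conf n, ℂ), ((2 * Real.pi * Complex.I) •
      TemperedDistribution.smulLeftCLM ℂ (fun x : Conf n => ((inner ℝ x
        (EuclideanSpace.single j (1 : ℝ)) : ℝ) : ℂ))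
        (Lp.toTemperedDistributionCLM ℂ volume 2 (fourierL2 n φ))) g =
      ∫ ξ, g ξ * ((2 * Real.pi * Complex.I) * (ξ j : ℝ) * fourierL2 n φ ξ) := by
    intro g
    rw [_root_.smul_apply, TemperedDistribution.smulLeftCLM_apply_apply,
      Lp.toTemperedDistributionCLM_apply, Lp.toTemperedDistribution_apply, smul_eq_mul,
      ← integral_const_mul]
    refine integral_congr_ae (Eventually.of_forall fun ξ => ?_)
    simp only [inner_single, SchwartzMap.smulLeftCLM_apply_apply ht', smul_eq_mul]
    ring
  have hr : ∀ g : 𝓢(Conf n, ℂ), (Lp.toTemperedDistributionCLM ℂ volume 2 (fourierL2 n ψ)) g =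
      ∫ ξ, g ξ * fourierL2 n ψ ξ := fun g => by
    rw [Lp.toTemperedDistributionCLM_apply, Lp.toTemperedDistribution_apply]
    rfl
  constructor
  · intro h
    -- The product of ξⱼ with the transform of φ is so far only locally integrable, so functions are
    -- compared by testing against smooth functions of compact support.
    have hloc : ∀ f : L2 (Fin n), LocallyIntegrable f volume := fun f =>
      (Lp.memLp f).locallyIntegrable (by norm_num)
    have hloc1 : LocallyIntegrable (fun ξ : Conf n =>
        (2 * Real.pi * Complex.I) * (ξ j : ℝ) * fourierL2 n φ ξ) volume := by
      rw [← locallyIntegrableOn_univ]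
      exact ((hloc _).locallyIntegrableOn _).continuousOn_mul (by fun_prop) isOpen_univ.isLocallyClosed
    refine ae_eq_of_integral_contDiff_smul_eq (hloc _) hloc1 fun g hg hgc => ?_
    let G : 𝓢(Conf n, ℂ) := (hgc.comp_left Complex.ofReal_zero).toSchwartzMap
      (Complex.ofRealCLM.contDiff.comp hg)
    have h1 := (hl G).symm.trans ((congrArg (fun T : 𝓢'(Conf n, ℂ) => T G) h).trans (hr G))
    simp_rw [Complex.real_smul]
    exact h1.symm
  · intro h
    ext g
    refine (hl g).trans (Eq.trans ?_ (hr g).symm)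
    refine integral_congr_ae ?_
    filter_upwards [h] with ξ hξ
    rw [hξ]

/-! ### Parametrization of H¹ by (H₀ + λ)^(-1/2) -/

variable {m : Fin n → ℝ} {lam : ℝ}

/-- The symbol `λ + ∑ⱼ (2 π ξⱼ)² / (2 mⱼ)` of `H₀ + λ`. -/
def freeWeight (m : Fin n → ℝ) (lam : ℝ) (ξ : Conf n) : ℝ :=
  lam + ∑ j, (2 * m j)⁻¹ * (2 * Real.pi * ξ j) ^ 2

theorem le_freeWeight (hm : ∀ i, 0 < m i) (ξ : Conf n) : lam ≤ freeWeight m lam ξ :=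
  le_add_of_nonneg_right (Finset.sum_nonneg fun j _ => by have := hm j; positivity)

theorem coord_le_freeWeight (hm : ∀ i, 0 < m i) (hl : 0 < lam) (ξ : Conf n) (j : Fin n) :
    (2 * Real.pi * ξ j) ^ 2 ≤ 2 * m j * freeWeight m lam ξ := by
  have h := Finset.single_le_sum (f := fun j => (2 * m j)⁻¹ * (2 * Real.pi * ξ j) ^ 2)
    (fun j _ => by have := hm j; positivity) (Finset.mem_univ j)
  have hj := hm j
  calc (2 * Real.pi * ξ j) ^ 2 = 2 * m j * ((2 * m j)⁻¹ * (2 * Real.pi * ξ j) ^ 2) := by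
        field_simp
    _ ≤ 2 * m j * freeWeight m lam ξ := by
        gcongr
        exact h.trans (le_add_of_nonneg_left hl.le)

theorem freeWeight_pos (hm : ∀ i, 0 < m i) (hl : 0 < lam) (ξ : Conf n) : 0 < freeWeight m lam ξ :=
  hl.trans_le (le_freeWeight hm ξ)

theorem contDiff_freeWeight : ContDiff ℝ ∞ (freeWeight m lam) := by
  have h : ∀ j : Fin n, ContDiff ℝ ∞ fun ξ : Conf n => ξ j := fun j => by
    simp_rw [← inner_single j]
    exact contDiff_id.inner ℝ contDiff_const
  exact contDiff_const.add (ContDiff.sum fun j _ =>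
    contDiff_const.mul ((contDiff_const.mul (h j)).pow 2))

/-- The symbol of `(H₀ + λ)^(-1/2)`. -/
def rootSymbol (hm : ∀ i, 0 < m i) (hl : 0 < lam) : Conf n →ᵇ ℂ :=
  BoundedContinuousFunction.ofNormedAddCommGroup (fun ξ => (((√(freeWeight m lam ξ))⁻¹ : ℝ) : ℂ))
    (Complex.continuous_ofReal.comp ((contDiff_freeWeight.continuous.sqrt).inv₀ fun ξ =>
      (Real.sqrt_pos.2 (freeWeight_pos hm hl ξ)).ne')) (√lam)⁻¹ fun ξ => by
    rw [Complex.norm_real, Real.norm_of_nonneg (by positivity)]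
    exact inv_anti₀ (Real.sqrt_pos.2 hl) (Real.sqrt_le_sqrt (le_freeWeight hm ξ))

/-- The symbol of `∂ⱼ (H₀ + λ)^(-1/2)`. -/
def derivSymbol (hm : ∀ i, 0 < m i) (hl : 0 < lam) (j : Fin n) : Conf n →ᵇ ℂ :=
  BoundedContinuousFunction.ofNormedAddCommGroup
    (fun ξ => 2 * Real.pi * Complex.I * (ξ j : ℝ) * rootSymbol hm hl ξ) (by fun_prop)
    √(2 * m j) fun ξ => by
      have hw := freeWeight_pos hm hl ξ
      have h1 : ‖2 * Real.pi * Complex.I * (ξ j : ℝ) * rootSymbol hm hl ξ‖ =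
          |2 * Real.pi * ξ j| * (√(freeWeight m lam ξ))⁻¹ := by
        change ‖2 * Real.pi * Complex.I * (ξ j : ℝ) * (((√(freeWeight m lam ξ))⁻¹ : ℝ) : ℂ)‖ = _
        rw [norm_mul, Complex.norm_real, Real.norm_of_nonneg (by positivity)]
        simp [abs_mul]
      rw [h1, ← div_eq_mul_inv, div_le_iff₀ (Real.sqrt_pos.2 hw),
        ← Real.sqrt_mul (by have := hm j; positivity)]
      exact Real.abs_le_sqrt (coord_le_freeWeight hm hl ξ j)

theorem rootSymbol_apply (hm : ∀ i, 0 < m i) (hl : 0 < lam) (ξ : Conf n) :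
    rootSymbol hm hl ξ = (((√(freeWeight m lam ξ))⁻¹ : ℝ) : ℂ) := rfl

theorem derivSymbol_apply (hm : ∀ i, 0 < m i) (hl : 0 < lam) (j : Fin n) (ξ : Conf n) :
    derivSymbol hm hl j ξ = 2 * Real.pi * Complex.I * (ξ j : ℝ) * rootSymbol hm hl ξ := rfl

theorem rootSymbol_sq (hm : ∀ i, 0 < m i) (hl : 0 < lam) (ξ : Conf n) :
    rootSymbol hm hl ξ ^ 2 * freeWeight m lam ξ = 1 := by
  have hw := freeWeight_pos hm hl ξ
  rw [rootSymbol_apply]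
  norm_cast
  rw [inv_pow, Real.sq_sqrt hw.le, inv_mul_cancel₀ hw.ne']

theorem star_rootSymbol (hm : ∀ i, 0 < m i) (hl : 0 < lam) :
    star (rootSymbol hm hl) = rootSymbol hm hl := by
  ext ξ
  rw [BoundedContinuousFunction.star_apply, rootSymbol_apply]
  exact Complex.conj_ofReal _

/-- The weight divided by itself. Its operator form says that (H₀ + λ)^(-1/2) is isometric from L²
into H¹ with the inner product of kinetic energy plus λ. -/
theorem symbol_identity (hm : ∀ i, 0 < m i) (hl : 0 < lam) :
    ∑ j, (((2 * m j)⁻¹ : ℝ) : ℂ) • (star (derivSymbol hm hl j) * derivSymbol hm hl j) +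
      (lam : ℂ) • (star (rootSymbol hm hl) * rootSymbol hm hl) = 1 := by
  ext ξ
  rw [star_rootSymbol]
  simp only [BoundedContinuousFunction.add_apply, BoundedContinuousFunction.coe_sum,
    Finset.sum_apply, BoundedContinuousFunction.coe_smul, BoundedContinuousFunction.mul_apply,
    BoundedContinuousFunction.star_apply, BoundedContinuousFunction.coe_one, Pi.one_apply, derivSymbol_apply,
    smul_eq_mul]
  have h1 : star (rootSymbol hm hl ξ) = rootSymbol hm hl ξ :=
    congrArg (fun f : Conf n →ᵇ ℂ => f ξ) (star_rootSymbol hm hl)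
  rw [← rootSymbol_sq hm hl ξ, freeWeight]
  push_cast
  rw [mul_add, Finset.mul_sum, add_comm]
  congr 1
  · ring
  · refine Finset.sum_congr rfl fun j _ => ?_
    rw [star_mul', h1]
    simp only [star_mul', Complex.star_def, Complex.conj_I, Complex.conj_ofReal, map_ofNat]
    linear_combination (-(2 * (m j : ℂ))⁻¹ * (2 * Real.pi * ξ j * rootSymbol hm hl ξ) ^ 2) *
      Complex.I_sq

/-- `(H₀ + λ)^(-1/2)`. -/
def rootOp (hm : ∀ i, 0 < m i) (hl : 0 < lam) : Bdd n := fourierHom n (rootSymbol hm hl)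

/-- `∂ⱼ (H₀ + λ)^(-1/2)`. -/
def derivOp (hm : ∀ i, 0 < m i) (hl : 0 < lam) (j : Fin n) : Bdd n :=
  fourierHom n (derivSymbol hm hl j)

theorem star_rootOp (hm : ∀ i, 0 < m i) (hl : 0 < lam) : star (rootOp hm hl) = rootOp hm hl := by
  rw [rootOp, ← map_star, star_rootSymbol]

theorem operator_identity (hm : ∀ i, 0 < m i) (hl : 0 < lam) :
    ∑ j, (((2 * m j)⁻¹ : ℝ) : ℂ) • (star (derivOp hm hl j) * derivOp hm hl j) +
      (lam : ℂ) • (star (rootOp hm hl) * rootOp hm hl) = 1 := by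
  have h := congrArg (fourierHom n) (symbol_identity hm hl)
  unfold derivOp rootOp
  simpa only [map_add, map_sum, map_smul, map_mul, map_star, map_one] using h

theorem inner_identity (hm : ∀ i, 0 < m i) (hl : 0 < lam) (φ ψ : L2 (Fin n)) :
    ∑ j, (((2 * m j)⁻¹ : ℝ) : ℂ) * inner ℂ (derivOp hm hl j φ) (derivOp hm hl j ψ) +
      (lam : ℂ) * inner ℂ (rootOp hm hl φ) (rootOp hm hl ψ) = inner ℂ φ ψ := by
  have h := congrArg (fun T : Bdd n => inner ℂ φ (T ψ)) (operator_identity hm hl)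
  simpa only [_root_.add_apply, _root_.sum_apply, _root_.smul_apply, mul_apply_eq_comp,
    one_apply_eq_self, inner_add_right, inner_sum, inner_smul_right,
    ContinuousLinearMap.star_eq_adjoint, ContinuousLinearMap.adjoint_inner_right] using h

theorem norm_sq_identity (hm : ∀ i, 0 < m i) (hl : 0 < lam) (φ : L2 (Fin n)) :
    ∑ j, (2 * m j)⁻¹ * ‖derivOp hm hl j φ‖ ^ 2 + lam * ‖rootOp hm hl φ‖ ^ 2 = ‖φ‖ ^ 2 := by
  have h := inner_identity hm hl φ φ
  simp only [inner_self_eq_norm_sq_to_K] at h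
  apply Complex.ofReal_injective
  push_cast at h ⊢
  exact h

theorem fourier_rootOp (hm : ∀ i, 0 < m i) (hl : 0 < lam) (φ : L2 (Fin n)) :
    ∀ᵐ ξ, fourierL2 n (rootOp hm hl φ) ξ = rootSymbol hm hl ξ * fourierL2 n φ ξ := by
  rw [rootOp, fourierHom_apply, LinearIsometryEquiv.apply_symm_apply]
  exact coeFn_mulOp _ _

theorem fourier_derivOp (hm : ∀ i, 0 < m i) (hl : 0 < lam) (j : Fin n) (φ : L2 (Fin n)) :
    ∀ᵐ ξ, fourierL2 n (derivOp hm hl j φ) ξ = derivSymbol hm hl j ξ * fourierL2 n φ ξ := by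
  rw [derivOp, fourierHom_apply, LinearIsometryEquiv.apply_symm_apply]
  exact coeFn_mulOp _ _

/-- `(H₀ + λ)^(-1/2)` as a map from `L²(ℝⁿ)` onto `H¹(ℝⁿ)`. -/
def toH1 (hm : ∀ i, 0 < m i) (hl : 0 < lam) : L2 (Fin n) →L[ℂ] sobolevH1 n :=
  ((rootOp hm hl).prod (ContinuousLinearMap.pi (derivOp hm hl))).codRestrict (sobolevH1 n)
    fun φ j => (lineDeriv_eq_iff_fourier j _ _).2 (by
      change ∀ᵐ ξ, fourierL2 n (derivOp hm hl j φ) ξ = _ * fourierL2 n (rootOp hm hl φ) ξ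
      filter_upwards [fourier_rootOp hm hl φ, fourier_derivOp hm hl j φ] with ξ h1 h2
      rw [h1, h2, derivSymbol_apply, mul_assoc])

theorem toH1_fst (hm : ∀ i, 0 < m i) (hl : 0 < lam) (φ : L2 (Fin n)) :
    (toH1 hm hl φ).1.1 = rootOp hm hl φ := rfl

theorem toH1_snd (hm : ∀ i, 0 < m i) (hl : 0 < lam) (φ : L2 (Fin n)) (j : Fin n) :
    (toH1 hm hl φ).1.2 j = derivOp hm hl j φ := rfl

theorem toH1_surjective (hm : ∀ i, 0 < m i) (hl : 0 < lam) :
    Function.Surjective (toH1 hm hl) := by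
  intro u
  have hu : ∀ j, ∀ᵐ ξ : Conf n, fourierL2 n (u.1.2 j) ξ =
      (2 * Real.pi * Complex.I) * (ξ j : ℝ) * fourierL2 n u.1.1 ξ := fun j =>
    (lineDeriv_eq_iff_fourier j _ _).1 (u.2 j)
  -- This is (H₀ + λ)^(1/2) u written with bounded operators only. Applying `rootOp` and using that
  -- it turns ∂ⱼu into `derivOp` of u gives back `operator_identity` at u.
  refine ⟨∑ j, (((2 * m j)⁻¹ : ℝ) : ℂ) • star (derivOp hm hl j) (u.1.2 j) +
    (lam : ℂ) • star (rootOp hm hl) u.1.1, sobolevH1_ext ?_⟩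
  have hcomm : ∀ j, rootOp hm hl (star (derivOp hm hl j) (u.1.2 j)) =
      star (derivOp hm hl j) (derivOp hm hl j u.1.1) := by
    intro j
    have h1 : rootOp hm hl (u.1.2 j) = derivOp hm hl j u.1.1 := by
      apply (fourierL2 n).injective
      refine Lp.ext ?_
      filter_upwards [fourier_rootOp hm hl (u.1.2 j), fourier_derivOp hm hl j u.1.1, hu j]
        with ξ h1 h2 h3
      rw [h1, h2, h3, derivSymbol_apply]
      ring
    rw [← h1, rootOp, derivOp, ← map_star, ← mul_apply_eq_comp, ← mul_apply_eq_comp, ← map_mul,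
      ← map_mul, mul_comm]
  rw [toH1_fst, map_add, map_sum]
  simp_rw [map_smul, hcomm]
  have h := congrArg (fun T : Bdd n => T u.1.1) (operator_identity hm hl)
  simpa only [_root_.add_apply, _root_.sum_apply, _root_.smul_apply, mul_apply_eq_comp,
    one_apply_eq_self, star_rootOp] using h

/-- Functions with smooth compactly supported Fourier transform are dense in L², and the smooth
symbol of (H₀ + λ)^(-1/2) keeps them Schwartz. Any masses and λ serve here; all are set to 1. -/
theorem denseRange_schwartzToH1 : DenseRange (schwartzToH1 n) := by
  have hm : ∀ i : Fin n, 0 < (fun _ => 1 : Fin n → ℝ) i := fun _ => one_pos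
  have hl : (0 : ℝ) < 1 := one_pos
  have hd := (dense_smooth n).preimage (fourierL2 n).toHomeomorph.isOpenMap
  refine (((toH1_surjective hm hl).denseRange).dense_image (toH1 hm hl).continuous hd).mono ?_
  rintro _ ⟨φ, ⟨g, hφg, hg, hg'⟩, rfl⟩
  obtain ⟨k, hk⟩ := exists_schwartz_mul (h := rootSymbol hm hl) hg hg'
    (Complex.ofRealCLM.contDiff.comp ((contDiff_freeWeight.sqrt fun ξ =>
      (freeWeight_pos hm hl ξ).ne').inv fun ξ => (Real.sqrt_pos.2 (freeWeight_pos hm hl ξ)).ne'))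
  refine ⟨𝓕⁻ k, sobolevH1_ext ?_⟩
  change sL2 (𝓕⁻ k) = rootOp hm hl φ
  apply (fourierL2 n).injective
  have h1 : fourierL2 n (sL2 (𝓕⁻ k)) = sL2 k := by
    refine (SchwartzMap.toLp_fourier_eq _).trans ?_
    rw [FourierTransform.fourier_fourierInv_eq]
  rw [h1]
  refine Lp.ext ?_
  filter_upwards [fourier_rootOp hm hl φ, k.coeFn_toLp 2 volume, hφg] with ξ h2 h3 h4
  rw [h2, h3, hk]
  exact congrArg _ h4.symm

end Sobolev

/-! ### One-dimensional estimates -/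

section OneDimensional

theorem norm_sq_toLp {D : Type*} [NormedAddCommGroup D] [InnerProductSpace ℝ D]
    [FiniteDimensional ℝ D] [MeasurableSpace D] [BorelSpace D] (f : 𝓢(D, ℂ)) :
    ‖f.toLp 2 volume‖ ^ 2 = ∫ x, ‖f x‖ ^ 2 := by
  have h := SchwartzMap.inner_toL2_toL2_eq f f volume
  rw [inner_self_eq_norm_sq_to_K] at h
  simp_rw [inner_self_eq_norm_sq_to_K] at h
  apply Complex.ofReal_injective
  rw [← integral_complex_ofReal]
  push_cast
  exact h

theorem integrable_norm_sq {D : Type*} [NormedAddCommGroup D] [NormedSpace ℝ D]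
    [FiniteDimensional ℝ D] [MeasurableSpace D] [BorelSpace D] (μ : Measure D)
    [μ.HasTemperateGrowth] (f : 𝓢(D, ℂ)) : Integrable (fun x => ‖f x‖ ^ 2) μ :=
  (f.memLp 2 μ).integrable_norm_pow (by norm_num)

/-- Integrate the derivative of |f|² from -∞ to s and apply the weighted arithmetic–geometric
inequality. The free κ later makes the derivative term as small as needed. -/
theorem norm_sq_le_integral (f : 𝓢(ℝ, ℂ)) {κ : ℝ} (hκ : 0 < κ) (s : ℝ) :
    ‖f s‖ ^ 2 ≤ κ * (∫ r, ‖f r‖ ^ 2) + κ⁻¹ * ∫ r, ‖deriv f r‖ ^ 2 := by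
  have hf := integrable_norm_sq volume f
  have hf' : Integrable fun r => ‖deriv f r‖ ^ 2 :=
    integrable_norm_sq volume (SchwartzMap.derivCLM ℂ ℂ f)
  have hint : Integrable fun r => κ * ‖f r‖ ^ 2 + κ⁻¹ * ‖deriv f r‖ ^ 2 :=
    (hf.const_mul _).add (hf'.const_mul _)
  have hbound : ∀ r, ‖2 * inner ℝ (f r) (deriv f r)‖ ≤
      κ * ‖f r‖ ^ 2 + κ⁻¹ * ‖deriv f r‖ ^ 2 := by
    intro r
    rw [norm_mul, Real.norm_ofNat]
    have h1 := norm_inner_le_norm (𝕜 := ℝ) (f r) (deriv f r)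
    have h2 : 2 * (‖f r‖ * ‖deriv f r‖) ≤ κ * ‖f r‖ ^ 2 + κ⁻¹ * ‖deriv f r‖ ^ 2 := by
      have h3 : 0 ≤ κ * (‖f r‖ - κ⁻¹ * ‖deriv f r‖) ^ 2 := by positivity
      have h4 : κ * (‖f r‖ - κ⁻¹ * ‖deriv f r‖) ^ 2 =
          κ * ‖f r‖ ^ 2 + κ⁻¹ * ‖deriv f r‖ ^ 2 - 2 * (‖f r‖ * ‖deriv f r‖) := by
        field_simp
        ring
      linarith
    linarith
  have hcont : Continuous fun r => 2 * inner ℝ (f r) (deriv f r) :=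
    continuous_const.mul (f.continuous.inner (SchwartzMap.derivCLM ℂ ℂ f).continuous)
  have hint2 : Integrable fun r => 2 * inner ℝ (f r) (deriv f r) :=
    hint.mono' hcont.aestronglyMeasurable (Eventually.of_forall hbound)
  have hlim : Tendsto (fun r => ‖f r‖ ^ 2) atBot (𝓝 0) := by
    have := (f.tendsto_cocompact.mono_left atBot_le_cocompact).norm.pow 2
    simpa using this
  have key := integral_Iic_of_hasDerivAt_of_tendsto' (a := s)
    (fun r _ => (f.hasDerivAt r).norm_sq) hint2.integrableOn hlim
  rw [sub_zero] at key
  rw [← key]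
  calc ∫ r in Set.Iic s, 2 * inner ℝ (f r) (deriv f r)
      ≤ ‖∫ r in Set.Iic s, 2 * inner ℝ (f r) (deriv f r)‖ := le_abs_self _
    _ ≤ ∫ r in Set.Iic s, (κ * ‖f r‖ ^ 2 + κ⁻¹ * ‖deriv f r‖ ^ 2) :=
        norm_integral_le_of_norm_le hint.integrableOn (Eventually.of_forall hbound)
    _ ≤ ∫ r, (κ * ‖f r‖ ^ 2 + κ⁻¹ * ‖deriv f r‖ ^ 2) :=
        setIntegral_le_integral hint (Eventually.of_forall fun r => by positivity)
    _ = _ := by rw [integral_add (hf.const_mul _) (hf'.const_mul _), integral_const_mul,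
          integral_const_mul]

theorem norm_sub_sq_le_integral (f : 𝓢(ℝ, ℂ)) (s : ℝ) :
    ‖f s - f 0‖ ^ 2 ≤ |s| * ∫ r, ‖deriv f r‖ ^ 2 := by
  have hcont : Continuous (deriv f) := (SchwartzMap.derivCLM ℂ ℂ f).continuous
  have hf' : Integrable fun r => ‖deriv f r‖ ^ 2 :=
    integrable_norm_sq volume (SchwartzMap.derivCLM ℂ ℂ f)
  rcases eq_or_ne s 0 with rfl | hs
  · simp
  have hL : 0 < |s| := abs_pos.2 hs
  set N := ∫ r, ‖deriv f r‖ ^ 2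
  set A := ∫ r in Set.uIoc 0 s, ‖deriv f r‖ with hA
  have hfs : ‖f s - f 0‖ ≤ A := by
    rw [← intervalIntegral.integral_deriv_eq_sub (fun r _ => f.differentiableAt)
      (hcont.intervalIntegrable _ _)]
    exact intervalIntegral.norm_integral_le_integral_norm_uIoc
  have hvol : (volume : Measure ℝ).real (Set.uIoc 0 s) = |s| := by
    rw [Measure.real, Real.volume_uIoc, sub_zero, ENNReal.toReal_ofReal (abs_nonneg s)]
  have hiA : IntegrableOn (fun r => ‖deriv f r‖) (Set.uIoc 0 s) :=
    (hcont.norm.intervalIntegrable 0 s).def'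
  have hiN : IntegrableOn (fun r => ‖deriv f r‖ ^ 2) (Set.uIoc 0 s) := hf'.integrableOn
  have hfin : IntegrableOn (fun _ : ℝ => (A / |s|) ^ 2) (Set.uIoc 0 s) :=
    (continuous_const.intervalIntegrable 0 s).def'
  -- Cauchy–Schwarz on the interval, as non-negativity of the variance of |f'|; A/|s| is its mean.
  have hsq : 0 ≤ ∫ r in Set.uIoc 0 s, (‖deriv f r‖ - A / |s|) ^ 2 :=
    integral_nonneg fun r => sq_nonneg _
  have hexp : ∫ r in Set.uIoc 0 s, (‖deriv f r‖ - A / |s|) ^ 2 =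
      (∫ r in Set.uIoc 0 s, ‖deriv f r‖ ^ 2) - A ^ 2 / |s| := by
    have h1 : ∀ r, (‖deriv f r‖ - A / |s|) ^ 2 =
        ‖deriv f r‖ ^ 2 - (2 * (A / |s|)) * ‖deriv f r‖ + (A / |s|) ^ 2 := fun r => by ring
    simp_rw [h1]
    have hi : IntegrableOn (fun r => ‖deriv f r‖ ^ 2 - (2 * (A / |s|)) * ‖deriv f r‖)
      (Set.uIoc 0 s) := hiN.sub (hiA.const_mul _)
    rw [integral_add hi hfin, integral_sub hiN (hiA.const_mul _),
      integral_const_mul, ← hA, setIntegral_const, hvol, smul_eq_mul]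
    field_simp
    ring
  have hle : ∫ r in Set.uIoc 0 s, ‖deriv f r‖ ^ 2 ≤ N :=
    setIntegral_le_integral hf' (Eventually.of_forall fun r => by positivity)
  have h2 : A ^ 2 / |s| ≤ N := by linarith
  rw [div_le_iff₀ hL] at h2
  calc ‖f s - f 0‖ ^ 2 ≤ A ^ 2 := by gcongr
    _ ≤ |s| * N := by linarith

end OneDimensional

/-! ### Slices parallel to a collision hyperplane -/

section Slices

variable {n : ℕ}

/-- The coordinates on a collision hyperplane. -/
abbrev Plane (σ : Pair n) : Type := EuclideanSpace ℝ {k : Fin n // k ≠ σ.1.2}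

/-- The unit vector transversal to the collision hyperplane. -/
abbrev transversal (σ : Pair n) : Conf n := EuclideanSpace.single σ.1.2 1

/-- The point at relative distance `s` over a point of the collision hyperplane. -/
def linePt (σ : Pair n) (p : Plane σ × ℝ) : Conf n := hyperplane σ p.1 + p.2 • transversal σ

theorem linePt_apply (σ : Pair n) (p : Plane σ × ℝ) (k : Fin n) :
    linePt σ p k = if h : k ≠ σ.1.2 then p.1 ⟨k, h⟩ else p.1 ⟨σ.1.1, σ.2.ne⟩ + p.2 := by
  by_cases h : k = σ.1.2 <;> simp [linePt, hyperplane_apply, h]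

/-- The map is a shear: the coordinate missing from the plane is s translated by the value R of its
partner, and translations preserve Lebesgue measure on each fibre. -/
theorem measurePreserving_linePt (σ : Pair n) :
    MeasurePreserving (linePt σ) ((volume : Measure (Plane σ)).prod volume) volume := by
  let i : {k : Fin n // k ≠ σ.1.2} := ⟨σ.1.1, σ.2.ne⟩
  have : Unique {k : Fin n // ¬k ≠ σ.1.2} := ⟨⟨⟨σ.1.2, by simp⟩⟩, fun k => Subtype.ext (by
    simpa using k.2)⟩
  have h1 : MeasurePreserving (fun p : Plane σ × ℝ =>
      ((WithLp.ofLp p.1, fun _ => p.1 i + p.2) :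
        ({k : Fin n // k ≠ σ.1.2} → ℝ) × ({k : Fin n // ¬k ≠ σ.1.2} → ℝ)))
      ((volume : Measure (Plane σ)).prod volume) (volume.prod volume) := by
    refine (PiLp.volume_preserving_ofLp _).skew_product
      (g := fun (y : Plane σ) (s : ℝ) => (fun _ => y i + s : {k : Fin n // ¬k ≠ σ.1.2} → ℝ)) ?_ ?_
    · refine Continuous.measurable ?_
      unfold Function.uncurry
      fun_prop
    · refine Eventually.of_forall fun y => ?_
      convert ((volume_preserving_funUnique {k : Fin n // ¬k ≠ σ.1.2} ℝ).symm.comp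
        (measurePreserving_add_left volume (y i))).map_eq
      all_goals rfl
  have h2 := (PiLp.volume_preserving_toLp (Fin n)).comp
    (((volume_preserving_piEquivPiSubtypeProd (fun _ : Fin n => ℝ)
      (fun k => k ≠ σ.1.2)).symm).comp h1)
  have h3 : linePt σ = WithLp.toLp 2 ∘ (MeasurableEquiv.piEquivPiSubtypeProd (fun _ : Fin n => ℝ)
      fun k => k ≠ σ.1.2).symm ∘ fun p => (WithLp.ofLp p.1, fun _ => p.1 i + p.2) := by
    funext p
    ext k
    rw [linePt_apply]
    rfl
  rw [h3]
  exact h2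

theorem integral_eq_slices {G : Type*} [NormedAddCommGroup G] [NormedSpace ℝ G] (σ : Pair n)
    {F : Conf n → G} (hF : Integrable F) : ∫ x, F x = ∫ y, ∫ s, F (linePt σ (y, s)) := by
  have hp := measurePreserving_linePt σ
  rw [← hp.map_eq, integral_map hp.measurable.aemeasurable (hp.map_eq ▸ hF.aestronglyMeasurable)]
  exact integral_prod _ (hp.integrable_comp_of_integrable hF)

theorem integrable_slices {G : Type*} [NormedAddCommGroup G] [NormedSpace ℝ G] (σ : Pair n)
    {F : Conf n → G} (hF : Integrable F) : Integrable fun y => ∫ s, F (linePt σ (y, s)) :=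
  ((measurePreserving_linePt σ).integrable_comp_of_integrable hF).integral_prod_left

/-- The restriction of a Schwartz function to a line transversal to the collision hyperplane. -/
def lineS (σ : Pair n) (y : Plane σ) (φ : 𝓢(Conf n, ℂ)) : 𝓢(ℝ, ℂ) :=
  SchwartzMap.compCLMOfAntilipschitz ℂ (g := fun s => linePt σ (y, s)) (K := 1)
    (by unfold linePt; fun_prop)
    (Isometry.antilipschitz (Isometry.of_dist_eq fun r s => by
      rw [dist_eq_norm, linePt, linePt, add_sub_add_left_eq_sub, ← sub_smul, norm_smul]
      simp [Real.dist_eq])) φ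

theorem lineS_apply (σ : Pair n) (y : Plane σ) (φ : 𝓢(Conf n, ℂ)) (s : ℝ) :
    lineS σ y φ s = φ (linePt σ (y, s)) := rfl

theorem deriv_lineS (σ : Pair n) (y : Plane σ) (φ : 𝓢(Conf n, ℂ)) (s : ℝ) :
    deriv (lineS σ y φ) s = ∂_{transversal σ} φ (linePt σ (y, s)) := by
  rw [SchwartzMap.lineDerivOp_apply_eq_fderiv]
  have h1 : HasDerivAt (fun s : ℝ => linePt σ (y, s)) (transversal σ) s := by
    have := ((hasDerivAt_id s).smul_const (transversal σ)).const_add (hyperplane σ y)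
    rwa [one_smul] at this
  exact ((φ.hasFDerivAt (linePt σ (y, s))).comp_hasDerivAt s h1).deriv

/-- The restriction of a Schwartz function to the hyperplane at relative distance `s`. -/
def slice (σ : Pair n) (s : ℝ) (φ : 𝓢(Conf n, ℂ)) : 𝓢(Plane σ, ℂ) :=
  SchwartzMap.compCLMOfAntilipschitz ℂ (hyperplane σ).hasTemperateGrowth
    (hyperplane_antilipschitz σ) (SchwartzMap.compSubConstCLM ℂ (-(s • transversal σ)) φ)

theorem slice_apply (σ : Pair n) (s : ℝ) (φ : 𝓢(Conf n, ℂ)) (y : Plane σ) :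
    slice σ s φ y = φ (linePt σ (y, s)) := by
  simp [slice, linePt]

/-- The `L²` norm of the slices. -/
abbrev sliceL2 (σ : Pair n) (s : ℝ) (φ : 𝓢(Conf n, ℂ)) : L2 {k : Fin n // k ≠ σ.1.2} :=
  (slice σ s φ).toLp 2 volume

theorem restrictHyperplane_eq (σ : Pair n) (φ : 𝓢(Conf n, ℂ)) :
    restrictHyperplane σ φ = sliceL2 σ 0 φ := by
  have h : slice σ 0 φ = SchwartzMap.compCLMOfAntilipschitz ℂ (hyperplane σ).hasTemperateGrowth
      (hyperplane_antilipschitz σ) φ := by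
    ext y
    simp [slice_apply, linePt]
  rw [sliceL2, h]
  rfl

theorem norm_sq_slice_le (σ : Pair n) (s : ℝ) (φ : 𝓢(Conf n, ℂ)) {κ : ℝ} (hκ : 0 < κ) :
    ‖sliceL2 σ s φ‖ ^ 2 ≤ κ * ‖sL2 φ‖ ^ 2 + κ⁻¹ * ‖sL2 (∂_{transversal σ} φ)‖ ^ 2 := by
  have hφ := integrable_norm_sq volume φ
  have hφ' := integrable_norm_sq volume (∂_{transversal σ} φ)
  rw [norm_sq_toLp, norm_sq_toLp, norm_sq_toLp, integral_eq_slices σ hφ, integral_eq_slices σ hφ',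
    ← integral_const_mul, ← integral_const_mul,
    ← integral_add ((integrable_slices σ hφ).const_mul _) ((integrable_slices σ hφ').const_mul _)]
  refine integral_mono (integrable_norm_sq volume _)
    (((integrable_slices σ hφ).const_mul _).add ((integrable_slices σ hφ').const_mul _)) fun y => ?_
  have h := norm_sq_le_integral (lineS σ y φ) hκ s
  simp_rw [deriv_lineS, lineS_apply] at h
  rw [slice_apply]
  exact h

theorem norm_sq_slice_sub_le (σ : Pair n) (s : ℝ) (φ : 𝓢(Conf n, ℂ)) :
    ‖sliceL2 σ s φ - sliceL2 σ 0 φ‖ ^ 2 ≤ |s| * ‖sL2 (∂_{transversal σ} φ)‖ ^ 2 := by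
  have hφ' := integrable_norm_sq volume (∂_{transversal σ} φ)
  have hsub : sliceL2 σ s φ - sliceL2 σ 0 φ = (slice σ s φ - slice σ 0 φ).toLp 2 volume :=
    (map_sub (SchwartzMap.toLpCLM ℂ ℂ 2 volume) _ _).symm
  rw [hsub, norm_sq_toLp, norm_sq_toLp, integral_eq_slices σ hφ', ← integral_const_mul]
  refine integral_mono (integrable_norm_sq volume _) ((integrable_slices σ hφ').const_mul _)
    fun y => ?_
  have h := norm_sub_sq_le_integral (lineS σ y φ) s
  simp_rw [deriv_lineS, lineS_apply] at h
  change ‖(slice σ s φ - slice σ 0 φ) y‖ ^ 2 ≤ _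
  rw [_root_.sub_apply, slice_apply, slice_apply]
  exact h

end Slices

/-! ### The trace operators -/

section Trace

variable {n : ℕ}

theorem norm_fst_le (u : sobolevH1 n) : ‖u.1.1‖ ≤ ‖u‖ := _root_.norm_fst_le u.1

theorem norm_snd_le (u : sobolevH1 n) (j : Fin n) : ‖u.1.2 j‖ ≤ ‖u‖ :=
  (norm_le_pi_norm u.1.2 j).trans (_root_.norm_snd_le u.1)

theorem schwartzToH1_fst (φ : 𝓢(Conf n, ℂ)) : (schwartzToH1 n φ).1.1 = sL2 φ := rfl

theorem schwartzToH1_snd (φ : 𝓢(Conf n, ℂ)) (j : Fin n) : (schwartzToH1 n φ).1.2 j =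
    sL2 (∂_{(EuclideanSpace.single j (1 : ℝ) : Conf n)} φ) := rfl

theorem norm_slice_le (σ : Pair n) (s : ℝ) (φ : 𝓢(Conf n, ℂ)) :
    ‖sliceL2 σ s φ‖ ≤ 2 * ‖schwartzToH1 n φ‖ := by
  refine abs_le_of_sq_le_sq' ?_ (by positivity) |>.2
  have h := norm_sq_slice_le σ s φ one_pos
  have h1 := norm_fst_le (schwartzToH1 n φ)
  have h2 := norm_snd_le (schwartzToH1 n φ) σ.1.2
  rw [schwartzToH1_fst] at h1
  rw [schwartzToH1_snd] at h2
  nlinarith [norm_nonneg (sL2 φ), norm_nonneg (sL2 (∂_{transversal σ} φ))]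

/-- Hölder continuity of exponent 1/2 in s serves small s; the cap 4, from bounding the two slices
separately, gives a bounded factor to integrate against the Poisson kernel. -/
theorem norm_slice_sub_le (σ : Pair n) (s : ℝ) (φ : 𝓢(Conf n, ℂ)) :
    ‖sliceL2 σ s φ - sliceL2 σ 0 φ‖ ≤ min √|s| 4 * ‖schwartzToH1 n φ‖ := by
  rw [min_mul_of_nonneg _ _ (norm_nonneg _)]
  refine le_min ?_ ?_
  · refine abs_le_of_sq_le_sq' ?_ (by positivity) |>.2
    have h := norm_sq_slice_sub_le σ s φ
    have h2 := norm_snd_le (schwartzToH1 n φ) σ.1.2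
    rw [schwartzToH1_snd] at h2
    rw [mul_pow, Real.sq_sqrt (abs_nonneg s)]
    refine h.trans ?_
    gcongr
  · refine (norm_sub_le _ _).trans ?_
    linarith [norm_slice_le σ s φ, norm_slice_le σ 0 φ]

/-- `extendOfNorm` is a true extension only because Schwartz functions are dense in H¹ and
restriction is bounded in the H¹ norm; both enter here. -/
theorem trace_schwartz (σ : Pair n) (φ : 𝓢(Conf n, ℂ)) :
    trace σ (schwartzToH1 n φ) = sliceL2 σ 0 φ := by
  rw [← restrictHyperplane_eq]
  exact LinearMap.extendOfNorm_eq denseRange_schwartzToH1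
    ⟨2, fun φ => by rw [restrictHyperplane_eq]; exact norm_slice_le σ 0 φ⟩ φ

theorem norm_sq_trace_le (σ : Pair n) (u : sobolevH1 n) {κ : ℝ} (hκ : 0 < κ) :
    ‖trace σ u‖ ^ 2 ≤ κ * ‖u.1.1‖ ^ 2 + κ⁻¹ * ‖u.1.2 σ.1.2‖ ^ 2 :=
  denseRange_schwartzToH1.induction_on (p := fun u : sobolevH1 n =>
    ‖trace σ u‖ ^ 2 ≤ κ * ‖u.1.1‖ ^ 2 + κ⁻¹ * ‖u.1.2 σ.1.2‖ ^ 2) u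
    (isClosed_le (by fun_prop) (by fun_prop)) fun φ => by
      rw [trace_schwartz]
      exact norm_sq_slice_le σ 0 φ hκ

end Trace

/-! ### Approximation of the contact interaction by Poisson kernels -/

section Poisson

variable {n : ℕ}

/-- The Poisson kernel `ε / (π (ε² + s²))`. -/
def poissonKernel (ε s : ℝ) : ℝ := ε / (Real.pi * (ε ^ 2 + s ^ 2))

theorem poissonKernel_nonneg {ε : ℝ} (hε : 0 < ε) (s : ℝ) : 0 ≤ poissonKernel ε s := by
  unfold poissonKernel; positivity

theorem poissonKernel_mul {ε : ℝ} (hε : 0 < ε) (r : ℝ) :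
    poissonKernel ε (ε * r) = ε⁻¹ * (Real.pi⁻¹ * (1 + r ^ 2)⁻¹) := by
  have : 1 + r ^ 2 ≠ 0 := by positivity
  unfold poissonKernel
  field_simp

theorem integral_poissonKernel_mul {G : Type*} [NormedAddCommGroup G] [NormedSpace ℝ G] {ε : ℝ}
    (hε : 0 < ε) (f : ℝ → G) :
    ∫ s, poissonKernel ε s • f s = ∫ r, (Real.pi⁻¹ * (1 + r ^ 2)⁻¹) • f (ε * r) := by
  have h := Measure.integral_comp_mul_left (fun s => poissonKernel ε s • f s) ε
  simp_rw [poissonKernel_mul hε, mul_smul ε⁻¹] at h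
  rw [integral_smul, abs_of_pos (by positivity)] at h
  exact (smul_right_injective G (inv_ne_zero hε.ne') h).symm

theorem integrable_poissonKernel {ε : ℝ} (hε : 0 < ε) : Integrable (poissonKernel ε) := by
  rw [← integrable_comp_mul_left_iff _ hε.ne']
  simp_rw [poissonKernel_mul hε]
  exact (integrable_inv_one_add_sq.const_mul _).const_mul _

theorem integral_poissonKernel {ε : ℝ} (hε : 0 < ε) : ∫ s, poissonKernel ε s = 1 := by
  have h := integral_poissonKernel_mul hε fun _ => (1 : ℝ)
  simp only [smul_eq_mul, mul_one] at h
  rw [h, integral_const_mul, integral_univ_inv_one_add_sq, inv_mul_cancel₀ Real.pi_ne_zero]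

/-- The bound for the distance between the contact interaction and its Poisson approximation. -/
def poissonDefect (ε : ℝ) : ℝ := ∫ s, poissonKernel ε s * (4 * min √|s| 4)

theorem poissonDefect_nonneg {ε : ℝ} (hε : 0 < ε) : 0 ≤ poissonDefect ε :=
  integral_nonneg fun s => mul_nonneg (poissonKernel_nonneg hε s) (by positivity)

theorem tendsto_poissonDefect :
    Tendsto (fun k : ℕ => poissonDefect (1 / ((k : ℝ) + 1))) atTop (𝓝 0) := by
  have h0 : ∀ k : ℕ, poissonDefect (1 / ((k : ℝ) + 1)) =
      ∫ r, (Real.pi⁻¹ * (1 + r ^ 2)⁻¹) * (4 * min √|1 / ((k : ℝ) + 1) * r| 4) := fun k =>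
    integral_poissonKernel_mul (by positivity) fun s => 4 * min √|s| 4
  simp_rw [h0]
  have hz : (0 : ℝ) = ∫ r : ℝ, (0 : ℝ) := by simp
  rw [hz]
  -- After the substitution s = εr the kernel no longer depends on ε, and 4 · min(√|εr|, 4) ≤ 16
  -- gives the majorant.
  refine tendsto_integral_of_dominated_convergence
    (fun r => (Real.pi⁻¹ * (1 + r ^ 2)⁻¹) * 16) (fun k => ?_)
    ((integrable_inv_one_add_sq.const_mul _).mul_const _) (fun k => ?_) ?_
  · refine Continuous.aestronglyMeasurable (.mul (.mul continuous_const (.inv₀ (by fun_prop)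
      fun r => by positivity)) (by fun_prop))
  · refine Eventually.of_forall fun r => ?_
    rw [Real.norm_of_nonneg (by positivity)]
    gcongr
    linarith [min_le_right √|1 / ((k : ℝ) + 1) * r| 4]
  · refine Eventually.of_forall fun r => ?_
    have h1 : Tendsto (fun k : ℕ => 1 / ((k : ℝ) + 1)) atTop (𝓝 0) :=
      tendsto_one_div_add_atTop_nhds_zero_nat
    have h2 : Continuous fun t : ℝ => (Real.pi⁻¹ * (1 + r ^ 2)⁻¹) * (4 * min √|t * r| 4) := by
      fun_prop
    have h3 : (Real.pi⁻¹ * (1 + r ^ 2)⁻¹) * (4 * min √|0 * r| 4) = 0 := by simp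
    have h4 := (h2.tendsto 0).comp h1
    rw [h3] at h4
    exact h4

/-- The normal of a collision hyperplane. -/
abbrev normal (σ : Pair n) : Conf n :=
  EuclideanSpace.single σ.1.2 1 - EuclideanSpace.single σ.1.1 1

theorem inner_normal_linePt (σ : Pair n) (p : Plane σ × ℝ) :
    inner ℝ (linePt σ p) (normal σ) = p.2 := by
  rw [inner_sub_right, inner_single, inner_single, linePt_apply, linePt_apply, dif_neg (by simp),
    dif_pos σ.2.ne, add_sub_cancel_left]

/-- The Poisson kernel as a function of the relative coordinate of a pair of particles. -/
def poissonFun (σ : Pair n) {ε : ℝ} (hε : ε ≠ 0) : Conf n →ᵇ ℂ :=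
  (Complex.I / (2 * Real.pi)) •
    (resolventFun (normal σ) hε - resolventFun (normal σ) (neg_ne_zero.2 hε))

/-- Partial fractions: (iε - s)⁻¹ - (-iε - s)⁻¹ = -2iε/(ε² + s²). This is why the Poisson kernel is
the approximate delta function of choice: it is a combination of resolvents of one position field.
-/
theorem poissonFun_linePt (σ : Pair n) {ε : ℝ} (hε : 0 < ε) (p : Plane σ × ℝ) :
    poissonFun σ hε.ne' (linePt σ p) = (poissonKernel ε p.2 : ℂ) := by
  have h1 := resolvent_denom_ne hε.ne' p.2
  have h2 := resolvent_denom_ne (neg_ne_zero.2 hε.ne') p.2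
  have h3 : ((ε : ℂ) ^ 2 + (p.2 : ℂ) ^ 2) ≠ 0 := by
    have : ε ^ 2 + p.2 ^ 2 ≠ 0 := by positivity
    exact_mod_cast this
  have hpi : (Real.pi : ℂ) ≠ 0 := by exact_mod_cast Real.pi_ne_zero
  change (Complex.I / (2 * Real.pi)) * ((Complex.I * (ε : ℝ) - (inner ℝ (linePt σ p) (normal σ) : ℝ))⁻¹ -
    (Complex.I * ((-ε : ℝ) : ℂ) - (inner ℝ (linePt σ p) (normal σ) : ℝ))⁻¹) = _
  rw [inner_normal_linePt, poissonKernel, inv_sub_inv h1 h2]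
  have h4 : (Complex.I * (ε : ℂ) - p.2) * (Complex.I * ((-ε : ℝ) : ℂ) - p.2) =
      (ε : ℂ) ^ 2 + (p.2 : ℂ) ^ 2 := by
    push_cast
    linear_combination (-(ε : ℂ) ^ 2) * Complex.I_sq
  rw [h4]
  push_cast
  field_simp
  linear_combination (-2 * (ε : ℂ)) * Complex.I_sq

theorem mulHom_poissonFun_mem (σ : Pair n) {ε : ℝ} (hε : ε ≠ 0) :
    mulHom n (poissonFun σ hε) ∈ resolventAlgebra n := by
  rw [poissonFun, map_smul, map_sub]
  exact SMulMemClass.smul_mem _ (sub_mem (mulHom_resolventFun_mem _ _) (mulHom_resolventFun_mem _ _))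

theorem integral_eq_slices_symm {G : Type*} [NormedAddCommGroup G] [NormedSpace ℝ G] (σ : Pair n)
    {F : Conf n → G} (hF : Integrable F) : ∫ x, F x = ∫ s, ∫ y, F (linePt σ (y, s)) := by
  have hp := measurePreserving_linePt σ
  rw [← hp.map_eq, integral_map hp.measurable.aemeasurable (hp.map_eq ▸ hF.aestronglyMeasurable)]
  exact integral_prod_symm _ (hp.integrable_comp_of_integrable hF)

theorem integrable_slices_symm {G : Type*} [NormedAddCommGroup G] [NormedSpace ℝ G] (σ : Pair n)
    {F : Conf n → G} (hF : Integrable F) : Integrable fun s => ∫ y, F (linePt σ (y, s)) :=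
  ((measurePreserving_linePt σ).integrable_comp_of_integrable hF).integral_prod_right

theorem inner_poisson (σ : Pair n) {ε : ℝ} (hε : 0 < ε) (u v : 𝓢(Conf n, ℂ)) :
    Integrable (fun s => (poissonKernel ε s : ℂ) * inner ℂ (sliceL2 σ s u) (sliceL2 σ s v)) ∧
    inner ℂ (sL2 u) (mulHom n (poissonFun σ hε.ne') (sL2 v)) =
      ∫ s, (poissonKernel ε s : ℂ) * inner ℂ (sliceL2 σ s u) (sliceL2 σ s v) := by
  set F : Conf n → ℂ := fun x => inner ℂ (u x) (poissonFun σ hε.ne' x * v x) with hF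
  have hae : (fun x => inner ℂ (sL2 u x) (mulHom n (poissonFun σ hε.ne') (sL2 v) x)) =ᵐ[volume] F := by
    filter_upwards [coeFn_mulOp (poissonFun σ hε.ne') (sL2 v), u.coeFn_toLp 2 volume,
      v.coeFn_toLp 2 volume] with x h1 h2 h3
    change inner ℂ (sL2 u x) (mulOp (poissonFun σ hε.ne') (sL2 v) x) = _
    rw [h1, h2, h3]
  have hFi : Integrable F := (L2.integrable_inner (𝕜 := ℂ) (sL2 u)
    (mulHom n (poissonFun σ hε.ne') (sL2 v))).congr hae
  have hsl : ∀ s, ∫ y, F (linePt σ (y, s)) =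
      (poissonKernel ε s : ℂ) * inner ℂ (sliceL2 σ s u) (sliceL2 σ s v) := by
    intro s
    rw [SchwartzMap.inner_toL2_toL2_eq (slice σ s u) (slice σ s v) volume, ← integral_const_mul]
    refine integral_congr_ae (Eventually.of_forall fun y => ?_)
    simp only [hF, poissonFun_linePt σ hε, slice_apply, RCLike.inner_apply]
    ring
  constructor
  · simp_rw [← hsl]
    exact integrable_slices_symm σ hFi
  · rw [L2.inner_def, integral_congr_ae hae, integral_eq_slices_symm σ hFi]
    simp_rw [hsl]

/-- By Fubini the multiplication operator averages the inner products of the slices at distance s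
with the Poisson weight, while the trace form is the slice at 0. As the weight has integral one,
only differences of slices remain, and these are controlled by H¹ norms. -/
theorem norm_inner_trace_sub_schwartz (σ : Pair n) {ε : ℝ} (hε : 0 < ε) (u v : 𝓢(Conf n, ℂ)) :
    ‖inner ℂ (trace σ (schwartzToH1 n u)) (trace σ (schwartzToH1 n v)) -
      inner ℂ (sL2 u) (mulHom n (poissonFun σ hε.ne') (sL2 v))‖ ≤
      poissonDefect ε * ‖schwartzToH1 n u‖ * ‖schwartzToH1 n v‖ := by
  obtain ⟨hi, he⟩ := inner_poisson σ hε u v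
  rw [trace_schwartz, trace_schwartz, he]
  have hone : inner ℂ (sliceL2 σ 0 u) (sliceL2 σ 0 v) =
      ∫ s, (poissonKernel ε s : ℂ) * inner ℂ (sliceL2 σ 0 u) (sliceL2 σ 0 v) := by
    rw [integral_mul_const, integral_complex_ofReal, integral_poissonKernel hε, Complex.ofReal_one,
      one_mul]
  have hi0 : Integrable fun s =>
      (poissonKernel ε s : ℂ) * inner ℂ (sliceL2 σ 0 u) (sliceL2 σ 0 v) :=
    Integrable.mul_const (f := fun s => (poissonKernel ε s : ℂ))
      (integrable_poissonKernel hε).ofReal _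
  rw [hone, ← integral_sub hi0 hi, poissonDefect,
    mul_assoc, ← integral_mul_const]
  have hdi : Integrable fun s => poissonKernel ε s * (4 * min √|s| 4) := by
    refine ((integrable_poissonKernel hε).mul_const 16).mono' ?_ (Eventually.of_forall fun s => ?_)
    · exact (integrable_poissonKernel hε).aestronglyMeasurable.mul
        (Continuous.aestronglyMeasurable (by fun_prop))
    · rw [Real.norm_of_nonneg (mul_nonneg (poissonKernel_nonneg hε s) (by positivity))]
      refine mul_le_mul_of_nonneg_left ?_ (poissonKernel_nonneg hε s)
      linarith [min_le_right √|s| 4]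
  refine norm_integral_le_of_norm_le (hdi.mul_const _) (Eventually.of_forall fun s => ?_)
  rw [← mul_sub, norm_mul, Complex.norm_real, Real.norm_of_nonneg (poissonKernel_nonneg hε s),
    mul_assoc]
  refine mul_le_mul_of_nonneg_left ?_ (poissonKernel_nonneg hε s)
  have e1 : inner ℂ (sliceL2 σ 0 u) (sliceL2 σ 0 v) - inner ℂ (sliceL2 σ s u) (sliceL2 σ s v) =
      -(inner ℂ (sliceL2 σ 0 u) (sliceL2 σ s v - sliceL2 σ 0 v) +
        inner ℂ (sliceL2 σ s u - sliceL2 σ 0 u) (sliceL2 σ s v)) := by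
    rw [inner_sub_right, inner_sub_left]; ring
  rw [e1, norm_neg]
  refine (norm_add_le _ _).trans ?_
  calc ‖inner ℂ (sliceL2 σ 0 u) (sliceL2 σ s v - sliceL2 σ 0 v)‖ +
        ‖inner ℂ (sliceL2 σ s u - sliceL2 σ 0 u) (sliceL2 σ s v)‖
      ≤ ‖sliceL2 σ 0 u‖ * ‖sliceL2 σ s v - sliceL2 σ 0 v‖ +
        ‖sliceL2 σ s u - sliceL2 σ 0 u‖ * ‖sliceL2 σ s v‖ :=
        add_le_add (norm_inner_le_norm _ _) (norm_inner_le_norm _ _)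
    _ ≤ (2 * ‖schwartzToH1 n u‖) * (min √|s| 4 * ‖schwartzToH1 n v‖) +
        (min √|s| 4 * ‖schwartzToH1 n u‖) * (2 * ‖schwartzToH1 n v‖) := by
        gcongr
        · exact norm_slice_le σ 0 u
        · exact norm_slice_sub_le σ s v
        · exact norm_slice_sub_le σ s u
        · exact norm_slice_le σ s v
    _ = 4 * min √|s| 4 * (‖schwartzToH1 n u‖ * ‖schwartzToH1 n v‖) := by ring

theorem norm_inner_trace_sub (σ : Pair n) {ε : ℝ} (hε : 0 < ε) (u v : sobolevH1 n) :
    ‖inner ℂ (trace σ u) (trace σ v) - inner ℂ u.1.1 (mulHom n (poissonFun σ hε.ne') v.1.1)‖ ≤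
      poissonDefect ε * ‖u‖ * ‖v‖ :=
  denseRange_schwartzToH1.induction_on₂ (p := fun u v : sobolevH1 n =>
    ‖inner ℂ (trace σ u) (trace σ v) - inner ℂ u.1.1 (mulHom n (poissonFun σ hε.ne') v.1.1)‖ ≤
      poissonDefect ε * ‖u‖ * ‖v‖) (isClosed_le (by fun_prop) (by fun_prop))
    (norm_inner_trace_sub_schwartz σ hε) u v

/-! ### The relative contact interaction in the resolvent algebra -/

variable {m : Fin n → ℝ} {lam : ℝ}

theorem tendsto_rootSymbol (hm : ∀ i, 0 < m i) (hl : 0 < lam) :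
    Tendsto (rootSymbol hm hl) (cocompact _) (𝓝 0) := by
  set M : ℝ := ∑ j, 2 * m j + 1 with hM
  have hM0 : 0 < M := by
    have : 0 ≤ ∑ j, 2 * m j := Finset.sum_nonneg fun j _ => by have := hm j; positivity
    linarith
  have hw : ∀ ξ : Conf n, ‖ξ‖ ≤ √M * √(freeWeight m lam ξ) := by
    intro ξ
    have hw0 := freeWeight_pos hm hl ξ
    rw [← Real.sqrt_mul hM0.le]
    refine Real.le_sqrt_of_sq_le ?_
    rw [EuclideanSpace.norm_sq_eq]
    calc ∑ j, ‖ξ j‖ ^ 2 ≤ ∑ j, 2 * m j * freeWeight m lam ξ := by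
          refine Finset.sum_le_sum fun j _ => le_trans ?_ (coord_le_freeWeight hm hl ξ j)
          rw [Real.norm_eq_abs, sq_abs, mul_pow]
          have : 1 ≤ (2 * Real.pi) ^ 2 := by nlinarith [Real.pi_gt_three]
          nlinarith [sq_nonneg (ξ j)]
      _ ≤ M * freeWeight m lam ξ := by
          rw [← Finset.sum_mul, hM]
          gcongr
          linarith
  have h0 : Tendsto (fun ξ : Conf n => √M * ‖ξ‖⁻¹) (cocompact _) (𝓝 0) := by
    simpa using (tendsto_norm_cocompact_atTop (E := Conf n)).inv_tendsto_atTop.const_mul (√M)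
  rw [tendsto_zero_iff_norm_tendsto_zero]
  refine squeeze_zero' (Eventually.of_forall fun x => norm_nonneg _) ?_ h0
  filter_upwards [(tendsto_norm_cocompact_atTop (E := Conf n)).eventually_gt_atTop 0] with ξ hξ
  rw [rootSymbol_apply, Complex.norm_real, Real.norm_of_nonneg (by positivity), ← div_eq_mul_inv,
    le_div_iff₀ hξ, inv_mul_le_iff₀ (Real.sqrt_pos.2 (freeWeight_pos hm hl ξ)), mul_comm]
  exact hw ξ

theorem rootOp_mem (hm : ∀ i, 0 < m i) (hl : 0 < lam) : rootOp hm hl ∈ resolventAlgebra n :=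
  fourierHom_mem (tendsto_rootSymbol hm hl)

/-- The trace of `(H₀ + λ)^(-1/2) φ`. -/
def traceOp (hm : ∀ i, 0 < m i) (hl : 0 < lam) (σ : Pair n) :
    L2 (Fin n) →L[ℂ] L2 {k : Fin n // k ≠ σ.1.2} :=
  trace σ ∘L toH1 hm hl

/-- The relative contact interaction `(H₀ + λ)^(-1/2) τ* τ (H₀ + λ)^(-1/2)` of a pair. -/
def contactOp (hm : ∀ i, 0 < m i) (hl : 0 < lam) (σ : Pair n) : Bdd n :=
  ContinuousLinearMap.adjoint (traceOp hm hl σ) ∘L traceOp hm hl σ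

theorem inner_contactOp (hm : ∀ i, 0 < m i) (hl : 0 < lam) (σ : Pair n) (φ ψ : L2 (Fin n)) :
    inner ℂ φ (contactOp hm hl σ ψ) = inner ℂ (trace σ (toH1 hm hl φ)) (trace σ (toH1 hm hl ψ)) := by
  rw [contactOp, ContinuousLinearMap.comp_apply, ContinuousLinearMap.adjoint_inner_right]
  rfl

/-- The Poisson approximation converges only as forms on H¹; sandwiching between two factors (H₀ +
λ)^(-1/2) turns the H¹ bound into an operator norm bound on L². -/
theorem contactOp_mem (hm : ∀ i, 0 < m i) (hl : 0 < lam) (σ : Pair n) :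
    contactOp hm hl σ ∈ resolventAlgebra n := by
  refine isClosed_resolventAlgebra.mem_of_tendsto (b := atTop) (f := fun k : ℕ =>
    rootOp hm hl * mulHom n (poissonFun σ (ε := 1 / ((k : ℝ) + 1)) (by positivity)) * rootOp hm hl)
    ?_ (Eventually.of_forall fun k => mul_mem (mul_mem (rootOp_mem hm hl)
      (mulHom_poissonFun_mem σ _)) (rootOp_mem hm hl))
  rw [tendsto_iff_norm_sub_tendsto_zero]
  set N := ‖toH1 hm hl‖
  refine squeeze_zero (g := fun k : ℕ => poissonDefect (1 / ((k : ℝ) + 1)) * N ^ 2)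
    (fun k => norm_nonneg _) (fun k => ?_) (by simpa using tendsto_poissonDefect.mul_const (N ^ 2))
  have hk : 0 < 1 / ((k : ℝ) + 1) := by positivity
  have hd := poissonDefect_nonneg hk
  refine opNorm_le_of_schwartz (by positivity) fun φ ψ => ?_
  rw [_root_.sub_apply (F := Bdd n), inner_sub_right, inner_contactOp, norm_sub_rev,
    mul_apply_eq_comp, mul_apply_eq_comp, ← star_rootOp, ContinuousLinearMap.star_eq_adjoint,
    ContinuousLinearMap.adjoint_inner_right, ← ContinuousLinearMap.star_eq_adjoint, star_rootOp]
  refine (norm_inner_trace_sub σ hk (toH1 hm hl (sL2 φ)) (toH1 hm hl (sL2 ψ))).trans ?_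
  calc poissonDefect (1 / ((k : ℝ) + 1)) * ‖toH1 hm hl (sL2 φ)‖ * ‖toH1 hm hl (sL2 ψ)‖
      ≤ poissonDefect (1 / ((k : ℝ) + 1)) * (N * ‖sL2 φ‖) * (N * ‖sL2 ψ‖) := by
        gcongr
        · exact (toH1 hm hl).le_opNorm _
        · exact (toH1 hm hl).le_opNorm _
    _ = _ := by ring

end Poisson

/-! ### Self-adjoint operators given by a bounded resolvent -/

section Generator

variable {E : Type*} [NormedAddCommGroup E] [InnerProductSpace ℂ E]
variable {B : E →L[ℂ] E} {T : E →ₗ.[ℂ] E} {lam : ℝ}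

theorem mem_graph_apply (hT : ∀ ψ φ : E, (ψ, φ) ∈ T.graph ↔ B (φ + (lam : ℂ) • ψ) = ψ) (χ : E) :
    (B χ, χ - (lam : ℂ) • B χ) ∈ T.graph := by
  rw [hT, sub_add_cancel]

/-- The resolvents of `T`, in terms of `B = (T + λ)⁻¹`. -/
theorem isResolvent_of_graph
    (hT : ∀ ψ φ : E, (ψ, φ) ∈ T.graph ↔ B (φ + (lam : ℂ) • ψ) = ψ) {z : ℂ}
    {V : (E →L[ℂ] E)ˣ} (hV : (V : E →L[ℂ] E) = 1 - ((lam : ℂ) + z) • B) :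
    IsResolvent T z ((V⁻¹ : (E →L[ℂ] E)ˣ) * B) := by
  intro φ ψ
  rw [hT, add_assoc, ← add_smul, map_add, map_smul, mul_apply_eq_comp]
  have h1 : ∀ x, V.val ((V⁻¹ : (E →L[ℂ] E)ˣ).val x) = x := fun x => by
    rw [← mul_apply_eq_comp, Units.mul_inv, one_apply_eq_self]
  have h2 : ∀ x, (V⁻¹ : (E →L[ℂ] E)ˣ).val (V.val x) = x := fun x => by
    rw [← mul_apply_eq_comp, Units.inv_mul, one_apply_eq_self]
  have h3 : V.val ψ = ψ - ((lam : ℂ) + z) • B ψ := by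
    rw [hV, _root_.sub_apply, one_apply_eq_self, _root_.smul_apply]
  rw [add_comm (lam : ℂ)] at h3
  -- The graph condition has become B φ = (1 - (λ + z) B) ψ, to be solved with the inverse of `V`.
  rw [← eq_sub_iff_add_eq, ← h3]
  constructor
  · rintro rfl
    rw [h1]
  · intro h
    rw [h, h2]

theorem left_cancel_of_injective (hi : Function.Injective B) {X Y : E →L[ℂ] E}
    (h : B * X = B * Y) : X = Y := by
  ext x
  apply hi
  rw [← mul_apply_eq_comp, h, mul_apply_eq_comp]

variable [CompleteSpace E]

theorem denseRange_of_isSelfAdjoint (hB : IsSelfAdjoint B) (hi : Function.Injective B) :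
    DenseRange B := by
  have h : (LinearMap.range B.toLinearMap)ᗮ = ⊥ := by
    rw [Submodule.eq_bot_iff]
    intro x hx
    apply hi
    rw [map_zero]
    refine ext_inner_left ℂ fun y => ?_
    rw [inner_zero_right, ← ContinuousLinearMap.adjoint_inner_left,
      ← ContinuousLinearMap.star_eq_adjoint, hB.star_eq]
    exact (Submodule.mem_orthogonal _ _).1 hx (B y) ⟨y, rfl⟩
  have h2 := Submodule.dense_iff_topologicalClosure_eq_top.2
    ((Submodule.topologicalClosure_eq_top_iff).2 h)
  exact h2

theorem inner_isSelfAdjoint (hB : IsSelfAdjoint B) (x y : E) : inner ℂ (B x) y = inner ℂ x (B y) := by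
  conv_lhs => rw [← hB.star_eq, ContinuousLinearMap.star_eq_adjoint,
    ContinuousLinearMap.adjoint_inner_left]

theorem dense_domain_of_graph (hB : IsSelfAdjoint B) (hi : Function.Injective B)
    (hT : ∀ ψ φ : E, (ψ, φ) ∈ T.graph ↔ B (φ + (lam : ℂ) • ψ) = ψ) :
    Dense (T.domain : Set E) := by
  refine Dense.mono ?_ (denseRange_of_isSelfAdjoint hB hi)
  rintro _ ⟨χ, rfl⟩
  exact LinearPMap.mem_domain_iff.2 ⟨_, mem_graph_apply hT χ⟩

/-- The graph of T consists of the pairs (Bχ, χ - λBχ). Testing (x, y) against them and moving B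
across the inner product gives ⟨χ, x - B (y + λx)⟩ = 0 for every χ, which is the graph condition
itself. -/
theorem isSelfAdjoint_of_graph (hB : IsSelfAdjoint B) (hi : Function.Injective B)
    (hT : ∀ ψ φ : E, (ψ, φ) ∈ T.graph ↔ B (φ + (lam : ℂ) • ψ) = ψ) : IsSelfAdjoint T := by
  rw [LinearPMap.isSelfAdjoint_def]
  refine LinearPMap.eq_of_eq_graph ?_
  rw [LinearPMap.adjoint_graph_eq_graph_adjoint (dense_domain_of_graph hB hi hT)]
  have key : ∀ x y χ : E, inner ℂ (χ - (lam : ℂ) • B χ) x - inner ℂ (B χ) y =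
      inner ℂ χ (x - B (y + (lam : ℂ) • x)) := by
    intro x y χ
    rw [inner_sub_left, inner_sub_right, inner_smul_left, inner_isSelfAdjoint hB,
      inner_isSelfAdjoint hB, map_add, map_smul, inner_add_right, inner_smul_right,
      Complex.conj_ofReal]
    ring
  ext ⟨x, y⟩
  rw [Submodule.mem_adjoint_iff, hT]
  constructor
  · intro h
    refine (sub_eq_zero.1 (ext_inner_left ℂ fun χ => ?_)).symm
    rw [← key, inner_zero_right]
    exact h _ _ (mem_graph_apply hT χ)
  · intro h a b hab
    rw [hT] at hab
    have h1 := key x y (b + (lam : ℂ) • a)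
    rw [hab, add_sub_cancel_right, h, sub_self, inner_zero_right] at h1
    exact h1

theorem isUnit_one_sub_smul (hB : IsSelfAdjoint B) {w : ℂ} (hw : w.im ≠ 0) :
    IsUnit (1 - w • B) := by
  have hw0 : w ≠ 0 := fun h => hw (by simp [h])
  have h1 : w⁻¹ ∉ spectrum ℂ B := fun h => by
    have := hB.im_eq_zero_of_mem_spectrum h
    rw [Complex.inv_im, div_eq_zero_iff, neg_eq_zero, Complex.normSq_eq_zero] at this
    tauto
  rw [spectrum.notMem_iff, Algebra.algebraMap_eq_smul_one] at h1
  -- Since 1 - wB = w (w⁻¹ - B), it suffices that w⁻¹ is not real, the spectrum of B being real.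
  have h2 := h1.smul (Units.mk0 w hw0)
  rwa [Units.smul_mk0, smul_sub, smul_smul, mul_inv_cancel₀ hw0, one_smul] at h2

/-! ### The regularized evolution by continuous functional calculus -/

/-- The function `b ↦ b exp(i t (b⁻¹ - λ))`. -/
def evolFun (lam t : ℝ) (z : ℂ) : ℂ :=
  (z.re : ℂ) * Complex.exp (Complex.I * ((t * (z.re⁻¹ - lam) : ℝ) : ℂ))

/-- For t ≠ 0 the phase alone oscillates without limit as b → 0, a point that may lie in the
spectrum of B; the factor b damps it, so continuous functional calculus suffices. -/
theorem continuous_evolFun (lam t : ℝ) : Continuous (evolFun lam t) := by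
  have h : Continuous fun b : ℝ =>
      (b : ℂ) * Complex.exp (Complex.I * ((t * (b⁻¹ - lam) : ℝ) : ℂ)) := by
    rw [continuous_iff_continuousAt]
    intro b
    rcases eq_or_ne b 0 with rfl | hb
    · rw [ContinuousAt, Complex.ofReal_zero, zero_mul, tendsto_zero_iff_norm_tendsto_zero]
      refine ((continuous_abs.tendsto (0 : ℝ)).congr fun b => ?_).trans (by simp)
      rw [norm_mul, mul_comm Complex.I, Complex.norm_exp_ofReal_mul_I, mul_one, Complex.norm_real,
        Real.norm_eq_abs]
    · refine ContinuousAt.mul (by fun_prop) (Complex.continuous_exp.continuousAt.comp ?_)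
      refine continuousAt_const.mul (Complex.continuous_ofReal.continuousAt.comp ?_)
      exact continuousAt_const.mul ((continuousAt_inv₀ hb).sub continuousAt_const)
  exact h.comp Complex.continuous_re

/-- The operator `exp(i t T) (T + λ)⁻¹`, where `B = (T + λ)⁻¹`. -/
def evolOp (B : E →L[ℂ] E) (lam t : ℝ) : E →L[ℂ] E := cfc (evolFun lam t) B

theorem cfc_re (hB : IsSelfAdjoint B) : cfc (fun z : ℂ => (z.re : ℂ)) B = B := by
  have hn := hB.isStarNormal
  conv_rhs => rw [← cfc_id ℂ B]
  exact cfc_congr fun z hz => (hB.mem_spectrum_eq_re hz).symm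

theorem evolOp_zero (hB : IsSelfAdjoint B) : evolOp B lam 0 = B := by
  conv_rhs => rw [← cfc_re hB]
  rw [evolOp]
  congr 1
  ext z
  simp [evolFun]

theorem evolOp_mul (hB : IsSelfAdjoint B) (s t : ℝ) :
    evolOp B lam s * evolOp B lam t = B * evolOp B lam (s + t) := by
  have hn := hB.isStarNormal
  have h : B * evolOp B lam (s + t) =
      cfc (fun z : ℂ => (z.re : ℂ)) B * cfc (evolFun lam (s + t)) B := by rw [cfc_re hB, evolOp]
  rw [h, evolOp, evolOp, ← cfc_mul _ _ B (continuous_evolFun _ _).continuousOn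
    (continuous_evolFun _ _).continuousOn, ← cfc_mul _ _ B (by fun_prop)
    (continuous_evolFun _ _).continuousOn]
  congr 1
  ext z
  rw [evolFun, evolFun, evolFun, mul_mul_mul_comm, ← Complex.exp_add, mul_assoc]
  congr 3
  push_cast
  ring

theorem star_evolOp (t : ℝ) : star (evolOp B lam t) = evolOp B lam (-t) := by
  rw [evolOp, evolOp, ← cfc_star]
  congr 1
  ext z
  rw [evolFun, evolFun, star_mul', RCLike.star_def, Complex.conj_ofReal,
    ← Complex.exp_conj, map_mul, Complex.conj_ofReal, Complex.conj_I]
  congr 2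
  push_cast
  ring

theorem commute_evolOp (hB : IsSelfAdjoint B) {C : E →L[ℂ] E} (h : Commute B C) (t : ℝ) :
    Commute (evolOp B lam t) C := by
  refine Commute.cfc h ?_ _
  rwa [hB.star_eq]

theorem norm_evolOp_apply (hB : IsSelfAdjoint B) (t : ℝ) (φ : E) :
    ‖evolOp B lam t φ‖ = ‖B φ‖ := by
  have h1 : star (evolOp B lam t) * evolOp B lam t = star B * B := by
    rw [star_evolOp, evolOp_mul hB, neg_add_cancel, evolOp_zero hB, hB.star_eq]
  have h2 : ∀ A : E →L[ℂ] E, (inner ℂ (A φ) (A φ) : ℂ) = inner ℂ φ ((star A * A) φ) := fun A => by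
    rw [mul_apply_eq_comp, ContinuousLinearMap.star_eq_adjoint,
      ContinuousLinearMap.adjoint_inner_right]
  have h3 : (inner ℂ (evolOp B lam t φ) (evolOp B lam t φ) : ℂ) = inner ℂ (B φ) (B φ) := by
    rw [h2, h2, h1]
  rw [inner_self_eq_norm_sq_to_K, inner_self_eq_norm_sq_to_K] at h3
  have h4 : ‖evolOp B lam t φ‖ ^ 2 = ‖B φ‖ ^ 2 := by exact_mod_cast h3
  exact (sq_eq_sq₀ (norm_nonneg _) (norm_nonneg _)).1 h4

theorem norm_le_of_mem_spectrum {z : ℂ} (hz : z ∈ spectrum ℂ B) : ‖z‖ ≤ ‖B‖ :=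
  (spectrum.norm_le_norm_mul_of_mem hz).trans
    (mul_le_of_le_one_right (norm_nonneg _) ContinuousLinearMap.norm_id_le)

theorem norm_one_sub_le {x b : ℝ} (hx : |x| ≤ b) (lam : ℝ) : |1 - lam * x| ≤ 1 + |lam| * b := by
  refine (abs_sub _ _).trans ?_
  rw [abs_one, abs_mul]
  gcongr

theorem norm_exp_sub_one_sub_le (y : ℝ) :
    ‖Complex.exp (Complex.I * y) - 1 - Complex.I * y‖ ≤ 2 * y ^ 2 := by
  have hy : ‖Complex.I * (y : ℂ)‖ = |y| := by
    rw [norm_mul, Complex.norm_I, one_mul, Complex.norm_real, Real.norm_eq_abs]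
  rcases le_or_gt |y| 1 with h | h
  · refine (Complex.norm_exp_sub_one_sub_id_le (hy.trans_le h)).trans ?_
    rw [hy, sq_abs]
    nlinarith [sq_nonneg y]
  · refine (norm_sub_le _ _).trans ?_
    have h1 := Real.norm_exp_I_mul_ofReal_sub_one_le (x := y)
    rw [Real.norm_eq_abs] at h1
    rw [hy, ← sq_abs]
    nlinarith

theorem norm_evolOp_sub_le (hB : IsSelfAdjoint B) (t : ℝ) :
    ‖evolOp B lam t - B‖ ≤ |t| * (1 + |lam| * ‖B‖) := by
  have hn := hB.isStarNormal
  conv_lhs => rw [← cfc_re hB, cfc_re hB]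
  have h : evolOp B lam t - B = cfc (fun z => evolFun lam t z - (z.re : ℂ)) B := by
    rw [cfc_sub _ _ B (continuous_evolFun _ _).continuousOn (by fun_prop), cfc_re hB, evolOp]
  rw [h]
  refine norm_cfc_le (by positivity) fun z hz => ?_
  have hz1 : |z.re| ≤ ‖B‖ := (Complex.abs_re_le_norm z).trans (norm_le_of_mem_spectrum hz)
  rcases eq_or_ne z.re 0 with h0 | h0
  · rw [evolFun, h0]
    simp only [Complex.ofReal_zero, zero_mul, sub_self, norm_zero]
    positivity
  · rw [evolFun, ← mul_sub_one, norm_mul, Complex.norm_real]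
    have h1 := Real.norm_exp_I_mul_ofReal_sub_one_le (x := t * (z.re⁻¹ - lam))
    calc ‖z.re‖ * _ ≤ ‖z.re‖ * ‖t * (z.re⁻¹ - lam)‖ := by gcongr
      _ = |t| * |1 - lam * z.re| := by
        rw [← norm_mul, mul_left_comm, mul_sub, mul_inv_cancel₀ h0, norm_mul, mul_comm z.re,
          Real.norm_eq_abs, Real.norm_eq_abs]
      _ ≤ _ := by
        gcongr
        exact norm_one_sub_le hz1 lam

/-- The second-order Taylor remainder of the phase is of size t²(b⁻¹ - λ)², singular at b = 0. The
extra factor B supplies b² in total and leaves the bounded t²(1 - λb)². -/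
theorem norm_evolOp_sub_sub_le (hB : IsSelfAdjoint B) (t : ℝ) :
    ‖(evolOp B lam t - B) * B - ((t : ℂ) * Complex.I) • ((1 - (lam : ℂ) • B) * B)‖ ≤
      2 * t ^ 2 * (1 + |lam| * ‖B‖) ^ 2 := by
  have hn := hB.isStarNormal
  have hc := continuous_evolFun lam t
  have h : (evolOp B lam t - B) * B - ((t : ℂ) * Complex.I) • ((1 - (lam : ℂ) • B) * B) =
      cfc (fun z => (evolFun lam t z - (z.re : ℂ)) * (z.re : ℂ) -
        ((t : ℂ) * Complex.I) * ((1 - (lam : ℂ) * (z.re : ℂ)) * (z.re : ℂ))) B := by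
    rw [cfc_sub _ _ B (by fun_prop) (by fun_prop), cfc_mul _ _ B (by fun_prop) (by fun_prop),
      cfc_sub _ _ B (by fun_prop) (by fun_prop), cfc_const_mul _ _ B (by fun_prop),
      cfc_mul _ _ B (by fun_prop) (by fun_prop), cfc_sub _ _ B (by fun_prop) (by fun_prop),
      cfc_const_mul _ _ B (by fun_prop), cfc_re hB, cfc_const_one ℂ B, evolOp]
  rw [h]
  refine norm_cfc_le (by positivity) fun z hz => ?_
  have hz1 : |z.re| ≤ ‖B‖ := (Complex.abs_re_le_norm z).trans (norm_le_of_mem_spectrum hz)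
  rcases eq_or_ne z.re 0 with h0 | h0
  · rw [h0]
    simp only [Complex.ofReal_zero, mul_zero, sub_self, norm_zero]
    positivity
  · have h0' : (z.re : ℂ) ≠ 0 := by exact_mod_cast h0
    have h1 := norm_exp_sub_one_sub_le (t * (z.re⁻¹ - lam))
    have e1 : (evolFun lam t z - (z.re : ℂ)) * (z.re : ℂ) -
        ((t : ℂ) * Complex.I) * ((1 - (lam : ℂ) * (z.re : ℂ)) * (z.re : ℂ)) =
        (z.re : ℂ) ^ 2 * (Complex.exp (Complex.I * ((t * (z.re⁻¹ - lam) : ℝ) : ℂ)) - 1 -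
          Complex.I * ((t * (z.re⁻¹ - lam) : ℝ) : ℂ)) := by
      rw [evolFun]
      push_cast
      field_simp
    rw [e1, norm_mul, norm_pow, Complex.norm_real, Real.norm_eq_abs]
    calc |z.re| ^ 2 * _ ≤ |z.re| ^ 2 * (2 * (t * (z.re⁻¹ - lam)) ^ 2) := by gcongr
      _ = 2 * t ^ 2 * |1 - lam * z.re| ^ 2 := by
        rw [sq_abs, sq_abs]
        field_simp
      _ ≤ _ := by
        gcongr
        exact norm_one_sub_le hz1 lam

/-! ### The unitary group and its generator -/

/-- The unitary group generated by `i T`, where `B = (T + λ)⁻¹`. -/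
def groupOp (B : E →L[ℂ] E) (lam t : ℝ) : E →L[ℂ] E :=
  (evolOp B lam t).toLinearMap.extendOfNorm B.toLinearMap

/-- Bφ ↦ `evolOp` φ is isometric on the dense range of B, so `extendOfNorm` really extends it. -/
theorem groupOp_mul (hB : IsSelfAdjoint B) (hi : Function.Injective B) (t : ℝ) :
    groupOp B lam t * B = evolOp B lam t := by
  ext φ
  exact LinearMap.extendOfNorm_eq (f := (evolOp B lam t).toLinearMap) (e := B.toLinearMap)
    (denseRange_of_isSelfAdjoint hB hi) ⟨1, fun x => by
      rw [one_mul]; exact (norm_evolOp_apply hB t x).le⟩ φ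

theorem ext_of_mul (hB : IsSelfAdjoint B) (hi : Function.Injective B) {X Y : E →L[ℂ] E}
    (h : X * B = Y * B) : X = Y := by
  refine ContinuousLinearMap.ext fun x => ?_
  refine congrFun ((denseRange_of_isSelfAdjoint hB hi).equalizer X.continuous Y.continuous ?_) x
  funext y
  exact congrArg (fun Z : E →L[ℂ] E => Z y) h

theorem mul_groupOp (hB : IsSelfAdjoint B) (hi : Function.Injective B) (t : ℝ) :
    B * groupOp B lam t = evolOp B lam t :=
  ext_of_mul hB hi <| by
    rw [mul_assoc, groupOp_mul hB hi, (commute_evolOp hB (Commute.refl B) t).eq]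

/-- B cancels on the left by injectivity and on the right by density of its range, so the identity
is checked between two factors B, where it is `evolOp_mul`. -/
theorem groupOp_add (hB : IsSelfAdjoint B) (hi : Function.Injective B) (s t : ℝ) :
    groupOp B lam (s + t) = groupOp B lam s * groupOp B lam t := by
  refine left_cancel_of_injective hi (ext_of_mul hB hi ?_)
  rw [mul_groupOp hB hi, ← mul_assoc B, mul_groupOp hB hi, mul_assoc, groupOp_mul hB hi,
    evolOp_mul hB, (commute_evolOp hB (Commute.refl B) (s + t)).eq]

theorem groupOp_zero (hB : IsSelfAdjoint B) (hi : Function.Injective B) :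
    groupOp B lam 0 = 1 :=
  left_cancel_of_injective hi (by rw [mul_groupOp hB hi, evolOp_zero hB, mul_one])

theorem star_groupOp (hB : IsSelfAdjoint B) (hi : Function.Injective B) (t : ℝ) :
    star (groupOp B lam t) = groupOp B lam (-t) := by
  refine left_cancel_of_injective hi ?_
  rw [mul_groupOp hB hi, ← star_evolOp, ← groupOp_mul hB hi, star_mul, hB.star_eq]

theorem commute_groupOp (hB : IsSelfAdjoint B) (hi : Function.Injective B) {C : E →L[ℂ] E}
    (h : Commute B C) (t : ℝ) : Commute (groupOp B lam t) C := by
  refine left_cancel_of_injective hi ?_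
  rw [← mul_assoc, mul_groupOp hB hi, ← mul_assoc, h.eq, mul_assoc, mul_groupOp hB hi,
    (commute_evolOp hB h t).eq]

theorem norm_groupOp_apply (hB : IsSelfAdjoint B) (hi : Function.Injective B) (t : ℝ) (φ : E) :
    ‖groupOp B lam t φ‖ = ‖φ‖ := by
  have h : (inner ℂ (groupOp B lam t φ) (groupOp B lam t φ) : ℂ) = inner ℂ φ φ := by
    rw [← ContinuousLinearMap.adjoint_inner_right, ← ContinuousLinearMap.star_eq_adjoint,
      star_groupOp hB hi, ← mul_apply_eq_comp, ← groupOp_add hB hi, neg_add_cancel,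
      groupOp_zero hB hi, one_apply_eq_self]
  rw [inner_self_eq_norm_sq_to_K, inner_self_eq_norm_sq_to_K] at h
  have h4 : ‖groupOp B lam t φ‖ ^ 2 = ‖φ‖ ^ 2 := by exact_mod_cast h
  exact (sq_eq_sq₀ (norm_nonneg _) (norm_nonneg _)).1 h4

theorem groupOp_apply_sub (hB : IsSelfAdjoint B) (hi : Function.Injective B) (t : ℝ) (φ : E) :
    groupOp B lam t (B φ) - B φ = (evolOp B lam t - B) φ := by
  rw [_root_.sub_apply, ← groupOp_mul hB hi, mul_apply_eq_comp]

/-- Orbits of vectors in the range of B are Lipschitz; since the group is isometric, every other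
orbit is a uniform limit of these. -/
theorem continuous_groupOp (hB : IsSelfAdjoint B) (hi : Function.Injective B) (ψ : E) :
    Continuous fun t => groupOp B lam t ψ := by
  set K := 1 + |lam| * ‖B‖
  have hrange : ∀ φ : E, Continuous fun t => groupOp B lam t (B φ) := by
    intro φ
    have hL : LipschitzWith (K * ‖φ‖).toNNReal fun t => groupOp B lam t (B φ) := by
      refine LipschitzWith.of_dist_le_mul fun s t => ?_
      rw [Real.coe_toNNReal _ (by positivity), dist_eq_norm, Real.dist_eq]
      have e : groupOp B lam s (B φ) - groupOp B lam t (B φ) =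
          groupOp B lam t (groupOp B lam (s - t) (B φ) - B φ) := by
        rw [map_sub, ← mul_apply_eq_comp (groupOp B lam t) (groupOp B lam (s - t)),
          ← groupOp_add hB hi, add_sub_cancel]
      rw [e, norm_groupOp_apply hB hi, groupOp_apply_sub hB hi]
      calc _ ≤ ‖evolOp B lam (s - t) - B‖ * ‖φ‖ := ContinuousLinearMap.le_opNorm _ _
        _ ≤ (|s - t| * K) * ‖φ‖ := by gcongr; exact norm_evolOp_sub_le hB _
        _ = _ := by ring
    exact hL.continuous
  refine continuous_of_uniform_approx_of_continuous fun u hu => ?_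
  obtain ⟨ε, hε, hu⟩ := Metric.mem_uniformity_dist.1 hu
  obtain ⟨φ, hφ⟩ := (denseRange_of_isSelfAdjoint hB hi).exists_dist_lt ψ hε
  refine ⟨_, hrange φ, fun t => hu ?_⟩
  rwa [dist_eq_norm, ← map_sub, norm_groupOp_apply hB hi, ← dist_eq_norm]

theorem hasDerivAt_groupOp (hB : IsSelfAdjoint B) (hi : Function.Injective B) (φ : E) :
    HasDerivAt (fun t => groupOp B lam t (B φ)) (Complex.I • (φ - (lam : ℂ) • B φ)) 0 := by
  set K := 1 + |lam| * ‖B‖ with hK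
  set G : E →L[ℂ] E := Complex.I • (1 - (lam : ℂ) • B) with hG
  have hGφ : ∀ φ, Complex.I • (φ - (lam : ℂ) • B φ) = G φ := fun φ => by
    rw [hG, _root_.smul_apply, _root_.sub_apply, one_apply_eq_self, _root_.smul_apply]
  rw [hGφ, hasDerivAt_iff_isLittleO, Asymptotics.isLittleO_iff]
  intro c hc
  have hM : 0 < K + ‖G‖ := by positivity
  -- The quadratic remainder is available only on the range of B². So φ is replaced by Bχ, at a cost
  -- linear in t whose coefficient stays below c/2.
  obtain ⟨χ, hχ⟩ := (denseRange_of_isSelfAdjoint hB hi).exists_dist_lt φ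
    (ε := c / 2 / (K + ‖G‖)) (by positivity)
  rw [dist_eq_norm, lt_div_iff₀ hM] at hχ
  have hsm : ∀ᶠ t : ℝ in 𝓝 0, 2 * |t| * K ^ 2 * ‖χ‖ < c / 2 := by
    have : Tendsto (fun t : ℝ => 2 * |t| * K ^ 2 * ‖χ‖) (𝓝 0) (𝓝 (2 * |0| * K ^ 2 * ‖χ‖)) :=
      Continuous.tendsto (by fun_prop) 0
    rw [abs_zero, mul_zero, zero_mul, zero_mul] at this
    exact this.eventually_lt_const (by positivity)
  filter_upwards [hsm] with t ht
  have e0 : groupOp B lam 0 (B φ) = B φ := by rw [groupOp_zero hB hi, one_apply_eq_self]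
  rw [e0, groupOp_apply_sub hB hi, sub_zero, Real.norm_eq_abs]
  have e1 : (evolOp B lam t - B) φ - t • G φ = ((evolOp B lam t - B) - (t : ℂ) • G) (φ - B χ) +
      ((evolOp B lam t - B) * B -
        ((t : ℂ) * Complex.I) • ((1 - (lam : ℂ) • B) * B)) χ := by
    have e2 : ((t : ℂ) * Complex.I) • ((1 - (lam : ℂ) • B) * B) = (t : ℂ) • (G * B) := by
      rw [hG, smul_mul_assoc, smul_smul]
    clear_value G
    rw [e2, map_sub, _root_.sub_apply (evolOp B lam t - B) _ φ, _root_.sub_apply _ _ χ,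
      _root_.sub_apply (evolOp B lam t - B) _ (B χ), mul_apply_eq_comp, _root_.smul_apply,
      _root_.smul_apply, _root_.smul_apply, mul_apply_eq_comp, Complex.coe_smul]
    abel
  rw [e1]
  have hn1 : ‖(evolOp B lam t - B) - (t : ℂ) • G‖ ≤ |t| * (K + ‖G‖) := by
    refine (norm_sub_le _ _).trans ?_
    rw [norm_smul, Complex.norm_real, Real.norm_eq_abs, mul_add]
    gcongr
    exact norm_evolOp_sub_le hB t
  calc _ ≤ ‖(evolOp B lam t - B) - (t : ℂ) • G‖ * ‖φ - B χ‖ +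
        (2 * t ^ 2 * K ^ 2) * ‖χ‖ := by
        refine (norm_add_le _ _).trans (add_le_add (ContinuousLinearMap.le_opNorm _ _) ?_)
        refine (ContinuousLinearMap.le_opNorm _ _).trans ?_
        gcongr
        exact norm_evolOp_sub_sub_le hB t
    _ ≤ |t| * (‖φ - B χ‖ * (K + ‖G‖)) + |t| * (2 * |t| * K ^ 2 * ‖χ‖) := by
        have : t ^ 2 = |t| * |t| := by rw [← sq, sq_abs]
        rw [this]
        refine add_le_add ?_ (le_of_eq (by ring))
        calc _ ≤ (|t| * (K + ‖G‖)) * ‖φ - B χ‖ := by gcongr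
          _ = _ := by ring
    _ ≤ |t| * (c / 2) + |t| * (c / 2) := by gcongr
    _ = c * |t| := by ring

theorem isUnitaryGroup_groupOp (hB : IsSelfAdjoint B) (hi : Function.Injective B)
    (hT : ∀ ψ φ : E, (ψ, φ) ∈ T.graph ↔ B (φ + (lam : ℂ) • ψ) = ψ) :
    IsUnitaryGroup T (groupOp B lam) where
  map_zero := groupOp_zero hB hi
  map_add := groupOp_add hB hi
  star_eq := star_groupOp hB hi
  continuous_apply := continuous_groupOp hB hi
  hasDerivAt_zero_iff ψ φ := by
    constructor
    · intro h
      have h1 : HasDerivAt (fun t => B (groupOp B lam t ψ)) (B (Complex.I • φ)) 0 :=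
        (B.restrictScalars ℝ).hasFDerivAt.comp_hasDerivAt (0 : ℝ) h
      have h2 : (fun t => B (groupOp B lam t ψ)) = fun t => groupOp B lam t (B ψ) := by
        funext t
        rw [← mul_apply_eq_comp, mul_groupOp hB hi, ← groupOp_mul hB hi, mul_apply_eq_comp]
      rw [h2] at h1
      -- A vector differentiable along the group lies in the domain: the derivative of B U(t) ψ,
      -- computed in two ways, gives Bφ = ψ - λBψ.
      have h3 := h1.unique (hasDerivAt_groupOp (lam := lam) hB hi ψ)
      rw [map_smul] at h3
      have h4 := smul_right_injective E Complex.I_ne_zero h3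
      rw [hT, map_add, map_smul, h4, sub_add_cancel]
    · intro h
      rw [hT] at h
      have h1 := hasDerivAt_groupOp (lam := lam) hB hi (φ + (lam : ℂ) • ψ)
      rwa [h, add_sub_cancel_right] at h1

end Generator

/-! ### The bounded inverse of `H + λ` -/

section Hamiltonian

variable {n : ℕ} {m : Fin n → ℝ} {lam : ℝ}

theorem rootOp_injective (hm : ∀ i, 0 < m i) (hl : 0 < lam) :
    Function.Injective (rootOp hm hl) := by
  rw [injective_iff_map_eq_zero]
  intro φ hφ
  have h1 : toH1 hm hl φ = 0 := sobolevH1_ext hφ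
  have h2 : ∀ j, derivOp hm hl j φ = 0 := fun j => by rw [← toH1_snd, h1]; rfl
  have h3 := norm_sq_identity hm hl φ
  simp only [h2, hφ, norm_zero] at h3
  simpa using h3.symm

theorem isSelfAdjoint_contactOp (hm : ∀ i, 0 < m i) (hl : 0 < lam) (σ : Pair n) :
    IsSelfAdjoint (contactOp hm hl σ) :=
  (ContinuousLinearMap.isPositive_adjoint_comp_self (traceOp hm hl σ)).isSelfAdjoint

/-- In the trace inequality the energy identity bounds the L² part by 1/λ and the derivative part by
2m. -/
theorem norm_contactOp_le (hm : ∀ i, 0 < m i) (hl : 0 < lam) (σ : Pair n) {κ : ℝ} (hκ : 0 < κ) :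
    ‖contactOp hm hl σ‖ ≤ κ / lam + 2 * m σ.1.2 / κ := by
  have hmj := hm σ.1.2
  set c := κ / lam + 2 * m σ.1.2 / κ with hc
  have hc0 : 0 ≤ c := by positivity
  have h1 : ∀ φ, ‖traceOp hm hl σ φ‖ ≤ √c * ‖φ‖ := by
    intro φ
    refine abs_le_of_sq_le_sq' ?_ (by positivity) |>.2
    rw [mul_pow, Real.sq_sqrt hc0]
    have h2 := norm_sq_trace_le σ (toH1 hm hl φ) hκ
    rw [toH1_fst, toH1_snd] at h2
    have h3 := norm_sq_identity hm hl φ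
    have h4 : (2 * m σ.1.2)⁻¹ * ‖derivOp hm hl σ.1.2 φ‖ ^ 2 ≤
        ∑ j, (2 * m j)⁻¹ * ‖derivOp hm hl j φ‖ ^ 2 :=
      Finset.single_le_sum (f := fun j => (2 * m j)⁻¹ * ‖derivOp hm hl j φ‖ ^ 2)
        (fun j _ => by have := hm j; positivity) (Finset.mem_univ _)
    have h5 : 0 ≤ ∑ j, (2 * m j)⁻¹ * ‖derivOp hm hl j φ‖ ^ 2 :=
      Finset.sum_nonneg fun j _ => by have := hm j; positivity
    have h6 : ‖rootOp hm hl φ‖ ^ 2 ≤ lam⁻¹ * ‖φ‖ ^ 2 := by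
      rw [le_inv_mul_iff₀ hl]; linarith
    have h7 : ‖derivOp hm hl σ.1.2 φ‖ ^ 2 ≤ (2 * m σ.1.2) * ‖φ‖ ^ 2 := by
      rw [← inv_mul_le_iff₀ (by positivity)]
      have : 0 ≤ lam * ‖rootOp hm hl φ‖ ^ 2 := by positivity
      linarith
    calc ‖traceOp hm hl σ φ‖ ^ 2 ≤ κ * ‖rootOp hm hl φ‖ ^ 2 +
          κ⁻¹ * ‖derivOp hm hl σ.1.2 φ‖ ^ 2 := h2
      _ ≤ κ * (lam⁻¹ * ‖φ‖ ^ 2) + κ⁻¹ * ((2 * m σ.1.2) * ‖φ‖ ^ 2) := by gcongr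
      _ = c * ‖φ‖ ^ 2 := by rw [hc]; ring
  rw [contactOp, ContinuousLinearMap.norm_adjoint_comp_self]
  have h8 := ContinuousLinearMap.opNorm_le_bound _ (Real.sqrt_nonneg c) h1
  calc _ ≤ √c * √c := by gcongr
    _ = c := Real.mul_self_sqrt hc0

/-- `(H₀ + λ)^(-1/2) W (H₀ + λ)^(-1/2)`, where `-W` is the interaction of the particles. -/
def interactionOp (hm : ∀ i, 0 < m i) (hl : 0 < lam) (g : ℝ) : Bdd n :=
  (g : ℂ) • ∑ σ : Pair n, contactOp hm hl σ

theorem exists_norm_interactionOp_lt_one (hm : ∀ i, 0 < m i) (g : ℝ) :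
    ∃ lam : ℝ, ∃ hl : 0 < lam, ‖interactionOp hm hl g‖ < 1 := by
  set M : ℝ := ∑ j, 2 * m j + 1 with hM
  have hMj : ∀ j, 2 * m j ≤ M := fun j =>
    (Finset.single_le_sum (f := fun j => 2 * m j) (fun j _ => by have := hm j; positivity)
      (Finset.mem_univ j)).trans (by linarith)
  have hM0 : 0 < M := by
    have : 0 ≤ ∑ j, 2 * m j := Finset.sum_nonneg fun j _ => by have := hm j; positivity
    linarith
  set N : ℝ := (Fintype.card (Pair n) : ℝ)
  set K : ℝ := |g| * N + 1 with hK
  have hN : 0 ≤ N := Nat.cast_nonneg _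
  have hK0 : 0 < K := by positivity
  -- With this λ and κ = 4KM, both terms of `norm_contactOp_le` are at most 1/(4K). The sum over
  -- pairs times |g| is then at most (K - 1)/(2K).
  have hl : 0 < 16 * K ^ 2 * M := by positivity
  refine ⟨16 * K ^ 2 * M, hl, ?_⟩
  have hκ : 0 < 4 * K * M := by positivity
  have h1 : ∀ σ : Pair n, ‖contactOp hm hl σ‖ ≤ (2 * K)⁻¹ := by
    intro σ
    calc ‖contactOp hm hl σ‖ ≤ 4 * K * M / (16 * K ^ 2 * M) + 2 * m σ.1.2 / (4 * K * M) :=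
          norm_contactOp_le hm hl σ hκ
      _ ≤ 4 * K * M / (16 * K ^ 2 * M) + M / (4 * K * M) := by
          gcongr
          exact hMj _
      _ = (2 * K)⁻¹ := by field_simp; norm_num
  have h2 : ‖∑ σ : Pair n, contactOp hm hl σ‖ ≤ N * (2 * K)⁻¹ := by
    refine (norm_sum_le _ _).trans ((Finset.sum_le_card_nsmul _ _ _ fun σ _ => h1 σ).trans ?_)
    rw [nsmul_eq_mul, Finset.card_univ]
  rw [interactionOp, norm_smul, Complex.norm_real, Real.norm_eq_abs]
  calc |g| * ‖∑ σ : Pair n, contactOp hm hl σ‖ ≤ |g| * (N * (2 * K)⁻¹) := by gcongr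
    _ = (K - 1) / (2 * K) := by rw [hK, add_sub_cancel_right, div_eq_mul_inv, mul_assoc]
    _ < 1 := by rw [div_lt_one (by positivity)]; linarith

theorem isSelfAdjoint_interactionOp (hm : ∀ i, 0 < m i) (hl : 0 < lam) (g : ℝ) :
    IsSelfAdjoint (interactionOp hm hl g) := by
  refine IsSelfAdjoint.smul (Complex.conj_ofReal g) ?_
  exact isSelfAdjoint_sum _ fun σ _ => isSelfAdjoint_contactOp hm hl σ

theorem interactionOp_mem (hm : ∀ i, 0 < m i) (hl : 0 < lam) (g : ℝ) :
    interactionOp hm hl g ∈ resolventAlgebra n :=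
  SMulMemClass.smul_mem _ (sum_mem fun σ _ => contactOp_mem hm hl σ)

theorem energyForm_toH1 (hm : ∀ i, 0 < m i) (hl : 0 < lam) (g : ℝ) (φ χ : L2 (Fin n)) :
    energyForm m g (toH1 hm hl φ) (toH1 hm hl χ) =
      inner ℂ φ ((1 - interactionOp hm hl g) χ) -
        (lam : ℂ) * inner ℂ (rootOp hm hl φ) (rootOp hm hl χ) := by
  rw [_root_.sub_apply (F := Bdd n), one_apply_eq_self, inner_sub_right, interactionOp,
    _root_.smul_apply, inner_smul_right, _root_.sum_apply, inner_sum,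
    ← inner_identity hm hl φ χ, energyForm]
  simp_rw [inner_contactOp, toH1_snd]
  ring

/-- A unit with inverse in the resolvent algebra, by spectral permanence. -/
theorem inv_mem_resolventAlgebra {V : (Bdd n)ˣ} (hV : (V : Bdd n) ∈ resolventAlgebra n) :
    ((V⁻¹ : (Bdd n)ˣ) : Bdd n) ∈ resolventAlgebra n := by
  have : IsClosed (resolventStarSubalgebra n : Set (Bdd n)) := isClosed_resolventAlgebra
  obtain ⟨W, hW⟩ := (StarSubalgebra.coe_isUnit (resolventStarSubalgebra n)
    (a := ⟨V, hV⟩)).1 V.isUnit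
  have h1 : (V : Bdd n) * ((W⁻¹ : (resolventStarSubalgebra n)ˣ) : resolventStarSubalgebra n) = 1 := by
    have := congrArg (Subtype.val) W.mul_inv
    rwa [hW] at this
  rw [Units.inv_eq_of_mul_eq_one_right h1]
  exact ((W⁻¹ : (resolventStarSubalgebra n)ˣ) : resolventStarSubalgebra n).2

/-- `(H + λ)⁻¹`. -/
def boundedInverse (hm : ∀ i, 0 < m i) (hl : 0 < lam) {g : ℝ}
    (h : ‖interactionOp hm hl g‖ < 1) : Bdd n :=
  rootOp hm hl * ((Units.oneSub _ h)⁻¹ : (Bdd n)ˣ) * rootOp hm hl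

section

variable (hm : ∀ i, 0 < m i) (hl : 0 < lam) {g : ℝ} (h : ‖interactionOp hm hl g‖ < 1)

theorem isSelfAdjoint_boundedInverse : IsSelfAdjoint (boundedInverse hm hl h) := by
  have h1 : star (Units.oneSub _ h) = Units.oneSub _ h :=
    Units.ext ((IsSelfAdjoint.one (Bdd n)).sub (isSelfAdjoint_interactionOp hm hl g)).star_eq
  have h2 : star ((Units.oneSub _ h)⁻¹ : (Bdd n)ˣ).val = ((Units.oneSub _ h)⁻¹ : (Bdd n)ˣ).val := by
    rw [← Units.coe_star_inv, h1]
  rw [isSelfAdjoint_iff, boundedInverse, star_mul, star_mul, star_rootOp, h2, mul_assoc]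

theorem unit_inv_apply (V : (Bdd n)ˣ) (φ ψ : L2 (Fin n)) :
    (V⁻¹ : (Bdd n)ˣ).val φ = ψ ↔ V.val ψ = φ := by
  constructor
  · rintro rfl
    rw [← mul_apply_eq_comp, Units.mul_inv, one_apply_eq_self]
  · rintro rfl
    rw [← mul_apply_eq_comp, Units.inv_mul, one_apply_eq_self]

theorem boundedInverse_injective : Function.Injective (boundedInverse hm hl h) := by
  intro φ ψ hφψ
  simp only [boundedInverse, mul_apply_eq_comp] at hφψ
  have h1 := rootOp_injective hm hl hφψ
  rw [unit_inv_apply, (unit_inv_apply _ _ _).1 rfl] at h1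
  exact (rootOp_injective hm hl h1).symm

theorem boundedInverse_mem : boundedInverse hm hl h ∈ resolventAlgebra n :=
  mul_mem (mul_mem (rootOp_mem hm hl) (inv_mem_resolventAlgebra
    (sub_mem one_mem_resolventAlgebra (interactionOp_mem hm hl g)))) (rootOp_mem hm hl)

/-- Write u = Aχ and let the test vectors be Aφ, with A = `rootOp` on the L² level. The weak
equation becomes (1 - W) χ = A (η + λψ), and applying A (1 - W)⁻¹ gives ψ = B (η + λψ). -/
theorem mem_hamiltonianGraph_iff (ψ η : L2 (Fin n)) : (ψ, η) ∈ hamiltonianGraph m g ↔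
    boundedInverse hm hl h (η + (lam : ℂ) • ψ) = ψ := by
  have key : ∀ χ, (∀ v, energyForm m g v (toH1 hm hl χ) = inner ℂ v.1.1 η) ↔
      (Units.oneSub _ h).val χ = rootOp hm hl (η + (lam : ℂ) • rootOp hm hl χ) := by
    intro χ
    have hA : ∀ φ ψ, inner ℂ (rootOp hm hl φ) ψ = inner ℂ φ (rootOp hm hl ψ) :=
      inner_isSelfAdjoint (star_rootOp hm hl)
    rw [(toH1_surjective hm hl).forall]
    simp_rw [energyForm_toH1, toH1_fst, sub_eq_iff_eq_add, ← inner_smul_right, ← inner_add_right,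
      hA]
    exact ⟨fun h => ext_inner_left ℂ h, fun h φ => congrArg _ h⟩
  simp only [boundedInverse, mul_apply_eq_comp]
  constructor
  · rintro ⟨u, hu, hu'⟩
    obtain ⟨χ, rfl⟩ := toH1_surjective hm hl u
    rw [key] at hu'
    rw [toH1_fst] at hu
    change rootOp hm hl χ = ψ at hu
    rw [hu] at hu'
    rw [(unit_inv_apply _ _ _).2 hu', hu]
  · intro hψ
    refine ⟨toH1 hm hl _, hψ, (key _).2 ?_⟩
    rw [(unit_inv_apply _ _ _).1 rfl, hψ]

theorem mem_hamiltonian_graph_iff (ψ η : L2 (Fin n)) : (ψ, η) ∈ (hamiltonian m g).graph ↔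
    boundedInverse hm hl h (η + (lam : ℂ) • ψ) = ψ := by
  rw [hamiltonian, Submodule.toLinearPMap_graph_eq, mem_hamiltonianGraph_iff hm hl h]
  -- `toLinearPMap` has the given graph only if that is single-valued, which follows from
  -- injectivity of B.
  rintro ⟨x, y⟩ hx (rfl : x = 0)
  rw [mem_hamiltonianGraph_iff hm hl h, smul_zero, add_zero] at hx
  exact boundedInverse_injective hm hl h (hx.trans (map_zero _).symm)

end

end Hamiltonian

/-! ### The algebras `f₀(H)` and `𝔖₀` and their time evolution -/

section Evolution

variable {n : ℕ}

/-- Conjugation with a unitary maps the C*-algebra generated by `S` into any C*-algebra that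
contains the conjugates of the elements of `S`. -/
theorem conj_mem_of_mem_cstarGenerated {U V : Bdd n} (hUV : star U = V) (hVU : V * U = 1)
    {S : Set (Bdd n)} {A : NonUnitalStarSubalgebra ℂ (Bdd n)} (hA : IsClosed (A : Set (Bdd n)))
    (hS : ∀ a ∈ S, U * a * V ∈ A) {a : Bdd n} (ha : a ∈ cstarGenerated S) : U * a * V ∈ A := by
  let 𝒞 : NonUnitalStarSubalgebra ℂ (Bdd n) :=
    { carrier := {a | U * a * V ∈ A}
      add_mem' := fun {a b} ha hb => by
        rw [Set.mem_ofPred_eq, mul_add, add_mul]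
        exact add_mem ha hb
      zero_mem' := by
        rw [Set.mem_ofPred_eq, mul_zero, zero_mul]
        exact zero_mem _
      mul_mem' := fun {a b} ha hb => by
        have h : U * (a * b) * V = (U * a * V) * (U * b * V) := by
          calc U * (a * b) * V = U * a * 1 * b * V := by simp only [mul_one, mul_assoc]
            _ = _ := by rw [← hVU]; simp only [mul_assoc]
        rw [Set.mem_ofPred_eq, h]
        exact mul_mem ha hb
      smul_mem' := fun c a ha => by
        rw [Set.mem_ofPred_eq, mul_smul_comm, smul_mul_assoc]
        exact SMulMemClass.smul_mem _ ha
      star_mem' := fun {a} ha => by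
        have h : U * star a * V = star (U * a * V) := by
          rw [star_mul, star_mul, hUV, ← hUV, star_star, mul_assoc]
        change U * star a * V ∈ A
        rw [h]
        exact star_mem ha }
  have hc : IsClosed (𝒞 : Set (Bdd n)) :=
    hA.preimage (f := fun a : Bdd n => U * a * V) (by fun_prop)
  exact cstarGenerated_le hc hS ha

theorem isClosed_algS (m : Fin n → ℝ) (g : ℝ) : IsClosed (algS m g : Set (Bdd n)) :=
  isClosed_cstarGenerated _

theorem algF_le_algS (m : Fin n → ℝ) (g : ℝ) : algF m g ≤ algS m g := fun _ ha =>
  subset_cstarGenerated _ (Or.inl ha)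

theorem algK_le_algS (m : Fin n → ℝ) (g : ℝ) : algK n ≤ algS m g := fun _ ha =>
  subset_cstarGenerated _ (Or.inr ha)

variable {m : Fin n → ℝ} {lam : ℝ} {g : ℝ}

theorem exists_resolvent_eq (hm : ∀ i, 0 < m i) (hl : 0 < lam)
    (h : ‖interactionOp hm hl g‖ < 1) {s : ℝ} (hs : s ≠ 0) : ∃ V : (Bdd n)ˣ,
    (V : Bdd n) = 1 - ((lam : ℂ) + Complex.I * s) • boundedInverse hm hl h ∧
    IsResolvent (hamiltonian m g) (Complex.I * s) ((V⁻¹ : (Bdd n)ˣ) * boundedInverse hm hl h) := by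
  obtain ⟨V, hV⟩ := isUnit_one_sub_smul (isSelfAdjoint_boundedInverse hm hl h)
    (w := (lam : ℂ) + Complex.I * s) (by simpa using hs)
  exact ⟨V, hV, isResolvent_of_graph (mem_hamiltonian_graph_iff hm hl h) hV⟩

theorem resolventOp_hamiltonian_mem (hm : ∀ i, 0 < m i) (hl : 0 < lam)
    (h : ‖interactionOp hm hl g‖ < 1) {s : ℝ} (hs : s ≠ 0) :
    resolventOp (hamiltonian m g) (Complex.I * s) ∈ resolventAlgebra n := by
  obtain ⟨V, hV, hR⟩ := exists_resolvent_eq hm hl h hs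
  have hB := boundedInverse_mem hm hl h
  rw [hR.resolventOp_eq]
  refine mul_mem (inv_mem_resolventAlgebra ?_) hB
  rw [hV]
  exact sub_mem one_mem_resolventAlgebra (SMulMemClass.smul_mem _ hB)

theorem commute_boundedInverse (hm : ∀ i, 0 < m i) (hl : 0 < lam)
    (h : ‖interactionOp hm hl g‖ < 1) {C : Bdd n} (hC : Commute (boundedInverse hm hl h) C) {s : ℝ}
    (hs : s ≠ 0) : Commute (resolventOp (hamiltonian m g) (Complex.I * s)) C := by
  obtain ⟨V, hV, hR⟩ := exists_resolvent_eq hm hl h hs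
  rw [hR.resolventOp_eq]
  refine Commute.mul_left (Commute.units_inv_left ?_) hC
  rw [hV]
  exact (Commute.one_left C).sub_left (hC.smul_left _)

theorem algF_le_resolventAlgebra (hm : ∀ i, 0 < m i) (hl : 0 < lam)
    (h : ‖interactionOp hm hl g‖ < 1) : algF m g ≤ resolventAlgebra n :=
  cstarGenerated_le isClosed_resolventAlgebra fun _ ⟨_, hs, hA⟩ =>
    hA ▸ resolventOp_hamiltonian_mem hm hl h hs

theorem algS_le_resolventAlgebra (hm : ∀ i, 0 < m i) (hl : 0 < lam)
    (h : ‖interactionOp hm hl g‖ < 1) : algS m g ≤ resolventAlgebra n :=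
  cstarGenerated_le isClosed_resolventAlgebra
    (Set.union_subset (algF_le_resolventAlgebra hm hl h) algK_le_resolventAlgebra)

theorem boundedInverse_mem_centralizer (hm : ∀ i, 0 < m i) (hl : 0 < lam)
    (h : ‖interactionOp hm hl g‖ < 1) :
    boundedInverse hm hl h ∈ NonUnitalStarSubalgebra.centralizer ℂ
      {A | ∃ s : ℝ, s ≠ 0 ∧ A = resolventOp (hamiltonian m g) (Complex.I * s)} := by
  rw [NonUnitalStarSubalgebra.mem_centralizer_iff]
  rintro _ ⟨s, hs, rfl⟩
  have h1 := commute_boundedInverse hm hl h (Commute.refl _) hs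
  refine ⟨h1, ?_⟩
  have h2 := congrArg star h1.eq
  rw [star_mul, star_mul, (isSelfAdjoint_boundedInverse hm hl h).star_eq] at h2
  exact h2.symm

/-- f₀(H) lies in the double centralizer of the resolvents. As B lies in the centralizer, b and b*
commute with B, hence b commutes with the resolvents and their adjoints. So b is in the centralizer
too, and a commutes with it. -/
theorem commute_of_mem_algF (hm : ∀ i, 0 < m i) (hl : 0 < lam)
    (h : ‖interactionOp hm hl g‖ < 1) {a b : Bdd n} (ha : a ∈ algF m g) (hb : b ∈ algF m g) :
    a * b = b * a := by
  have hle := NonUnitalStarSubalgebra.topologicalClosure_adjoin_le_centralizer_centralizer ℂ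
    {A : Bdd n | ∃ s : ℝ, s ≠ 0 ∧ A = resolventOp (hamiltonian m g) (Complex.I * s)}
  have hBb : Commute (boundedInverse hm hl h) b :=
    ((NonUnitalStarSubalgebra.mem_centralizer_iff ℂ).1 (hle hb) _
      (boundedInverse_mem_centralizer hm hl h)).1
  have hb' : b ∈ NonUnitalStarSubalgebra.centralizer ℂ
      {A | ∃ s : ℝ, s ≠ 0 ∧ A = resolventOp (hamiltonian m g) (Complex.I * s)} := by
    rw [NonUnitalStarSubalgebra.mem_centralizer_iff]
    rintro _ ⟨s, hs, rfl⟩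
    refine ⟨commute_boundedInverse hm hl h hBb hs, ?_⟩
    have h1 : Commute (boundedInverse hm hl h) (star b) :=
      ((NonUnitalStarSubalgebra.mem_centralizer_iff ℂ).1 (hle (star_mem hb)) _
        (boundedInverse_mem_centralizer hm hl h)).1
    have h2 := congrArg star (commute_boundedInverse hm hl h h1 hs).eq
    rw [star_mul, star_mul, star_star] at h2
    exact h2.symm
  exact (((NonUnitalStarSubalgebra.mem_centralizer_iff ℂ).1 (hle ha) _ hb').1).symm

theorem groupOp_neg_mul (hm : ∀ i, 0 < m i) (hl : 0 < lam)
    (h : ‖interactionOp hm hl g‖ < 1) (t : ℝ) :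
    groupOp (boundedInverse hm hl h) lam (-t) * groupOp (boundedInverse hm hl h) lam t = 1 := by
  have hB := isSelfAdjoint_boundedInverse hm hl h
  have hi := boundedInverse_injective hm hl h
  rw [← groupOp_add hB hi, neg_add_cancel, groupOp_zero hB hi]

theorem groupOp_conj_mem_algS (hm : ∀ i, 0 < m i) (hl : 0 < lam)
    (h : ‖interactionOp hm hl g‖ < 1) (t : ℝ) {a : Bdd n} (ha : a ∈ algS m g) :
    groupOp (boundedInverse hm hl h) lam t * a * groupOp (boundedInverse hm hl h) lam (-t) ∈
      algS m g := by
  have hB := isSelfAdjoint_boundedInverse hm hl h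
  have hi := boundedInverse_injective hm hl h
  have hst := star_groupOp (lam := lam) hB hi t
  have h1 := groupOp_neg_mul hm hl h t
  have h2 := groupOp_neg_mul hm hl h (-t)
  rw [neg_neg] at h2
  have hcl := isClosed_algS m g
  refine conj_mem_of_mem_cstarGenerated hst h1 hcl ?_ ha
  rintro b (hb | hb)
  · refine conj_mem_of_mem_cstarGenerated hst h1 hcl ?_ hb
    rintro _ ⟨s, hs, rfl⟩
    -- The resolvents of H commute with B, hence with the group, and are fixed by the conjugation.
    have hc := commute_groupOp (lam := lam) hB hi
      (commute_boundedInverse hm hl h (Commute.refl _) hs).symm t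
    rw [hc.eq, mul_assoc, h2, mul_one]
    exact algF_le_algS m g (subset_cstarGenerated _ ⟨s, hs, rfl⟩)
  · refine conj_mem_of_mem_cstarGenerated hst h1 hcl ?_ hb
    rintro _ (hK | rfl)
    · refine algK_le_algS m g (subset_cstarGenerated _ (Or.inl ?_))
      exact (IsCompactOperator.clm_comp hK _).comp_clm _
    · rw [mul_one, h2]
      exact algK_le_algS m g (subset_cstarGenerated _ (Or.inr rfl))

end Evolution

end DeltaGas

end

theorem mainTheorem7 (n : ℕ) (hn : 2 ≤ n) (m : Fin n → ℝ) (hm : ∀ i, 0 < m i)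
    (g : ℝ) (hg : g ≠ 0) :
    IsSelfAdjoint (DeltaGas.hamiltonian m g) ∧
    (∀ s : ℝ, s ≠ 0 → DeltaGas.IsResolvent (DeltaGas.hamiltonian m g) (Complex.I * s)
      (DeltaGas.resolventOp (DeltaGas.hamiltonian m g) (Complex.I * s))) ∧
    DeltaGas.IsUnitaryGroup (DeltaGas.hamiltonian m g)
      (DeltaGas.expI (DeltaGas.hamiltonian m g)) ∧
    (∀ a ∈ DeltaGas.algF m g, ∀ b ∈ DeltaGas.algF m g, a * b = b * a) ∧
    DeltaGas.algS m g ≤ DeltaGas.resolventAlgebra n ∧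
    ∀ t : ℝ, ∀ a ∈ DeltaGas.algS m g,
      DeltaGas.expI (DeltaGas.hamiltonian m g) t * a *
        DeltaGas.expI (DeltaGas.hamiltonian m g) (-t) ∈ DeltaGas.algS m g := by
  obtain ⟨lam, hl, h⟩ := DeltaGas.exists_norm_interactionOp_lt_one hm g
  have hB := DeltaGas.isSelfAdjoint_boundedInverse hm hl h
  have hi := DeltaGas.boundedInverse_injective hm hl h
  have hT := DeltaGas.mem_hamiltonian_graph_iff hm hl h
  have hU := DeltaGas.isUnitaryGroup_groupOp hB hi hT
  -- `expI` is selected by choice; uniqueness of the group, which needs the dense domain, identifies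
  -- it with `groupOp`.
  have hexp := hU.expI_eq (DeltaGas.dense_domain_of_graph hB hi hT)
  rw [hexp]
  refine ⟨DeltaGas.isSelfAdjoint_of_graph hB hi hT, fun s hs => ?_, hU,
    fun a ha b hb => DeltaGas.commute_of_mem_algF hm hl h ha hb,
    DeltaGas.algS_le_resolventAlgebra hm hl h,
    fun t a ha => DeltaGas.groupOp_conj_mem_algS hm hl h t ha⟩
  obtain ⟨V, -, hR⟩ := DeltaGas.exists_resolvent_eq hm hl h hs
  rwa [hR.resolventOp_eq]
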